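/- **Setting.** Let $d\in\{2,3\}$, let $\Omega\subset\mathbb R^d$ be a bounded domain (nonempty, open, connected), and let $\mathcal A$ be a measurable, bounded, symmetric and uniformly positive definite matrix function on $\Omega$. Put $V=H_0^1(\Omega)$ (the closure of $C_c^\infty(\Omega)$ in $H^1(\Omega)$), $a(u,v)=\int_\Omega \mathcal A\nabla u\cdot\nabla v$, $b(u,v)=\int_\Omega uv$, $\|v\|_a=\sqrt{a(v,v)}$, $\|v\|_b=\sqrt{b(v,v)}$. For a subspace $X\subseteq V$, an eigenpair in $X$ is a pair $(\lambda,u)\in\mathbb R\times X$, $u\ne0$, with $a(u,v)=\lambda b(u,v)$ for all $v\in X$. Let $0<\lambda_1\le\lambda_2\le\cdots$ be the eigenvalues in $V$ and $\bar\lambda_{1}(X)\le\bar\lambda_{2}(X)\le\cdots\le\bar\lambda_{\dim X}(X)$ those in a finite-dimensional $X$, repeated according to geometric multiplicity. Let $T:L^2(\Omega)\to V$ be given by $a(Tf,v)=\int_\Omega fv$ for all $v\in V$, let $M(\lambda_i)=\{w\in V: a(w,v)=\lambda_i b(w,v)\ \forall v\in V\}$, and set $$\eta(X)=\sup_{\|f\|_{L^2(\Omega)}=1}\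 \inf_{v\in X}\|Tf-v\|_a,\qquad \delta_X(\lambda_i)=\sup_{w\in M(\lambda_i),\,\|w\|_a=1}\ \inf_{v\in X}\|w-v\|_a .$$ A mesh is a finite set of convex polytopes with nonempty, pairwise disjoint interiors and with union $\overline\Omega$; its linear finite element space consists of the $v\in V$ that are continuous on $\Omega$ and affine on each cell. Let $n\ge2$ and $\beta>1$, let $\mathcal T_H,\mathcal T_{h_1},\dots,\mathcal T_{h_n}$ be meshes, each obtained from the preceding one by subdividing cells, with maximal cell diameters satisfying $h_k=h_{k-1}/\beta$ for $2\le k\le n$, and let $V_H\subseteq V_{h_1}\subseteq\cdots\subseteq V_{h_n}$ be their linear finite element spaces. Write $\delta_{h_k}=\delta_{V_{h_k}}$ and $\bar\lambda_{j,h_k}=\bar\lambda_j(V_{h_k})$. **Algorithm.** Let $0\le\theta<1$. A *correction step* in $V_{h_k}$ for the target $\lambda_i$ sends $(\lambda^{(\ell)},u^{(\ell)})$ to a pair $(\lambda^{(\ell+1)},u^{(\ell+1)})$ obtained as follows: let $\widehat u\in V_{h_k}$ satisfy $a(\widehat u,v)=\lambda^{(\ell)}b(u^{(\ell)},v)$ for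 all $v\in V_{h_k}$; take any $\widetilde u\in V_{h_k}$ with $\|\widehat u-\widetilde u\|_a\le\theta\|\widehat u-u^{(\ell)}\|_a$; then $(\lambda^{(\ell+1)},u^{(\ell+1)})$ is an eigenpair in $V_H+\mathrm{span}\{\widetilde u\}$ with $\|u^{(\ell+1)}\|_a=1$ for which $1/\lambda^{(\ell+1)}$ is closest to $1/\lambda_i$ among all eigenpairs in that space. Given integers $m,\varpi,\varpi_n\ge 0$, the parallel augmented subspace scheme computes, independently for each $i=1,\dots,m$: an eigenpair $(\lambda_{i,h_1},u_{i,h_1})$ in $V_{h_1}$ with $\lambda_{i,h_1}=\bar\lambda_{i,h_1}$ and $\|u_{i,h_1}\|_a=1$; then, for $k=2,\dots,n-1$, the pair $(\lambda_{i,h_k},u_{i,h_k})$ from $(\lambda_{i,h_{k-1}},u_{i,h_{k-1}})$ by $\varpi$ correction steps in $V_{h_k}$; finally $(\lambda_{i,h_n},u_{i,h_n})$ from $(\lambda_{i,h_{n-1}},u_{i,h_{n-1}})$ by $\varpi_n$ correction steps in $V_{h_n}$. **Theorem.** Consider any run of the scheme and let $i\in\{1,\dots,m\}$. Assume: 1.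 $\delta_{h_{k-1}}(\lambda_i)\le\beta\,\delta_{h_k}(\lambda_i)$ for $2\le k\le n$; 2. $\delta_\lambda>0$ is a lower bound for the spectral gaps: $\big|1/\bar\lambda_j(X)-1/\lambda_i\big|\ge\delta_\lambda$ for every $X\in\{V_H,V_{h_1},\dots,V_{h_n}\}$ and all $1\le j\le\dim X$ with $j\ne i$; 3. $\bar D_\lambda\,\eta(V_H)<1$ and $\gamma^{\varpi}\beta<1$, where $$\bar C_\lambda=2\lambda_i\Big(1+\frac1{\lambda_1\delta_\lambda}\Big)+\bar\lambda_{i,h_1}\sqrt{1+\frac{\eta^2(V_H)}{\lambda_1\delta_\lambda^2}},\qquad \bar D_\lambda=\frac{\bar C_\lambda}{\sqrt{\lambda_1}},\qquad \gamma=\frac{1}{1-\bar D_\lambda\eta(V_H)}\Big(\theta+(1+\theta)\frac{\bar C_\lambda}{\sqrt{\lambda_1}}\eta(V_H)\Big).$$ Then there is an exact eigenpair $(\lambda_i,u_i)$, $u_i\in M(\lambda_i)$, $\|u_i\|_a=1$, such that $$\|u_i-u_{i,h_n}\|_a\le\Big(\sqrt{2\Big(1+\tfrac{\eta^2(V_{h_n})}{\lambda_1\delta_\lambda^2}\Big)}+2\beta\gamma^{\varpi_n}\Big(1+\tfrac{2\gamma^\varpi\beta}{1-\gamma^\varpi\beta}\Big)\Big)\delta_{h_n}(\lambda_i),$$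 $$\|u_i-u_{i,h_n}\|_b\le2\Big(1+\tfrac1{\lambda_1\delta_\lambda}\Big)\Big(\eta(V_{h_n})\sqrt{2\Big(1+\tfrac{\eta^2(V_{h_n})}{\lambda_1\delta_\lambda^2}\Big)}+2\eta(V_H)\beta\gamma^{\varpi_n}\Big(1+\tfrac{2\gamma^\varpi\beta}{1-\gamma^\varpi\beta}\Big)\Big)\delta_{h_n}(\lambda_i),$$ $$|\lambda_i-\lambda_{i,h_n}|\le\lambda_{i,h_n}\Big(\sqrt{2\Big(1+\tfrac{\eta^2(V_{h_n})}{\lambda_1\delta_\lambda^2}\Big)}+2\beta\gamma^{\varpi_n}\Big(1+\tfrac{2\gamma^\varpi\beta}{1-\gamma^\varpi\beta}\Big)\Big)^2\delta_{h_n}^2(\lambda_i).$$ -/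

import Mathlib

open MeasureTheory
open scoped ContDiff

noncomputable section

namespace AugSub

/-- The Euclidean space `ℝᵈ`. -/
abbrev E (d : ℕ) : Type := EuclideanSpace ℝ (Fin d)

/-- `Ω` is a bounded domain: a nonempty, connected, open and bounded set. -/
structure IsBoundedDomain {d : ℕ} (Ω : Set (E d)) : Prop where
  isOpen : IsOpen Ω
  isConnected : IsConnected Ω
  isBounded : Bornology.IsBounded Ω

/-! ### The spaces `L²(Ω)` and `H₀¹(Ω)` -/

/-- `L²(Ω)`. -/
abbrev L2 {d : ℕ} (Ω : Set (E d)) : Type := Lp ℝ 2 (volume.restrict Ω)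

/-- The space of pairs (function in `L²(Ω)`, vector field in `L²(Ω)ᵈ`) with the Hilbert norm
`(‖u‖² + ‖g‖²)^{1/2}`. On pairs `(u, ∇u)` this is the `H¹(Ω)` norm. -/
abbrev L2Pair {d : ℕ} (Ω : Set (E d)) : Type :=
  WithLp 2 (Lp ℝ 2 (volume.restrict Ω) × Lp (E d) 2 (volume.restrict Ω))

/-- The pairs `(φ, ∇φ)` with `φ ∈ C_c^∞(Ω)`. -/
def testPairs {d : ℕ} (Ω : Set (E d)) : Submodule ℝ (L2Pair Ω) where
  carrier := {p | ∃ φ : E d → ℝ, ContDiff ℝ ∞ φ ∧ HasCompactSupport φ ∧ tsupport φ ⊆ Ω ∧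
    p.fst =ᵐ[volume.restrict Ω] φ ∧ p.snd =ᵐ[volume.restrict Ω] gradient φ}
  zero_mem' := by
    refine ⟨0, contDiff_const, HasCompactSupport.zero, by simp [tsupport], ?_, ?_⟩
    · exact Lp.coeFn_zero _ _ _
    · filter_upwards [Lp.coeFn_zero (E d) 2 (volume.restrict Ω)] with x hx
      rw [WithLp.zero_snd, hx]
      simp [gradient]
  add_mem' := by
    rintro p q ⟨φ, h1, h2, h3, h4, h5⟩ ⟨ψ, k1, k2, k3, k4, k5⟩
    refine ⟨φ + ψ, h1.add k1, h2.add k2,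
      (closure_mono (Function.support_add φ ψ)).trans ?_, ?_, ?_⟩
    · rw [closure_union]
      exact Set.union_subset h3 k3
    · rw [WithLp.add_fst]
      exact (Lp.coeFn_add _ _).trans (h4.add k4)
    · rw [WithLp.add_snd]
      filter_upwards [Lp.coeFn_add p.snd q.snd, h5, k5] with x hx a b
      rw [hx, Pi.add_apply, a, b, gradient, gradient, gradient,
        fderiv_add (h1.differentiable (by simp) x) (k1.differentiable (by simp) x), map_add]
  smul_mem' := by
    rintro c p ⟨φ, h1, h2, h3, h4, h5⟩
    refine ⟨c • φ, h1.const_smul c, h2.mono (Function.support_const_smul_subset c φ),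
      (closure_mono (Function.support_const_smul_subset c φ)).trans h3, ?_, ?_⟩
    · rw [WithLp.smul_fst]
      exact (Lp.coeFn_smul _ _).trans (h4.const_smul c)
    · rw [WithLp.smul_snd]
      filter_upwards [Lp.coeFn_smul c p.snd, h5] with x hx a
      rw [hx, Pi.smul_apply, a, gradient, gradient,
        fderiv_const_smul (h1.differentiable (by simp) x), map_smul]

/-- `V = H₀¹(Ω)`, the closure of `C_c^∞(Ω)` in the `H¹(Ω)` norm. An element `v` is stored as the
pair `(v, ∇v)` of the function and its weak gradient. -/
def H10 {d : ℕ} (Ω : Set (E d)) : Submodule ℝ (L2Pair Ω) := (testPairs Ω).topologicalClosure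

/-- The `L²` function underlying an element of `H₀¹(Ω)`. -/
def fn {d : ℕ} {Ω : Set (E d)} (v : H10 Ω) : L2 Ω := v.1.fst

/-- The weak gradient of an element of `H₀¹(Ω)`. -/
def grad {d : ℕ} {Ω : Set (E d)} (v : H10 Ω) : Lp (E d) 2 (volume.restrict Ω) := v.1.snd

/-! ### The bilinear forms and the eigenvalue problem -/

/-- The diffusion matrix: measurable, bounded, symmetric and uniformly positive definite on `Ω`. -/
structure IsDiffusion {d : ℕ} (Ω : Set (E d)) (A : E d → Matrix (Fin d) (Fin d) ℝ) : Prop where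
  measurable : ∀ p q, AEStronglyMeasurable (fun x => A x p q) (volume.restrict Ω)
  bounded : ∃ M : ℝ, ∀ x ∈ Ω, ∀ p q, |A x p q| ≤ M
  symm : ∀ x ∈ Ω, (A x).IsSymm
  elliptic : ∃ c : ℝ, 0 < c ∧ ∀ x ∈ Ω, ∀ ξ : Fin d → ℝ, c * (ξ ⬝ᵥ ξ) ≤ ξ ⬝ᵥ (A x).mulVec ξ

/-- `a(u, v) = ∫_Ω A ∇u · ∇v`. -/
def aForm {d : ℕ} {Ω : Set (E d)} (A : E d → Matrix (Fin d) (Fin d) ℝ) (u v : H10 Ω) : ℝ :=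
  ∫ x in Ω, (A x).mulVec (WithLp.ofLp (grad u x)) ⬝ᵥ WithLp.ofLp (grad v x)

/-- `(f, g) = ∫_Ω f g` for `f, g ∈ L²(Ω)`. -/
def l2Form {d : ℕ} {Ω : Set (E d)} (f g : L2 Ω) : ℝ := ∫ x in Ω, f x * g x

/-- `b(u, v) = ∫_Ω u v` on `H₀¹(Ω)`. -/
def bForm {d : ℕ} {Ω : Set (E d)} (u v : H10 Ω) : ℝ := l2Form (fn u) (fn v)

/-- `‖v‖_a`. -/
def aNorm {d : ℕ} {Ω : Set (E d)} (A : E d → Matrix (Fin d) (Fin d) ℝ) (v : H10 Ω) : ℝ :=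
  √(aForm A v v)

/-- `‖v‖_b`. -/
def bNorm {d : ℕ} {Ω : Set (E d)} (v : H10 Ω) : ℝ := √(bForm v v)

/-- `(lam, u)` solves the eigenvalue problem `a(u, v) = lam b(u, v)` for all `v ∈ X`, posed in the
subspace `X` of `H₀¹(Ω)`. With `X = ⊤` this is the exact problem, with `X = V_h` the Galerkin
problem. -/
def IsEigenpair {d : ℕ} {Ω : Set (E d)} (A : E d → Matrix (Fin d) (Fin d) ℝ)
    (X : Submodule ℝ (H10 Ω)) (lam : ℝ) (u : H10 Ω) : Prop :=
  u ∈ X ∧ u ≠ 0 ∧ ∀ v ∈ X, aForm A u v = lam * bForm u v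

/-- The span of all eigenfunctions of the problem in `X` with eigenvalue at most `t`. -/
def eigenSpan {d : ℕ} {Ω : Set (E d)} (A : E d → Matrix (Fin d) (Fin d) ℝ)
    (X : Submodule ℝ (H10 Ω)) (t : ℝ) : Submodule ℝ (H10 Ω) :=
  Submodule.span ℝ {u | ∃ s : ℝ, s ≤ t ∧ IsEigenpair A X s u}

/-- The `j`-th smallest eigenvalue (`j = 1, 2, …`) of the problem in `X`, eigenvalues being repeated
according to their geometric multiplicity: the least `t` such that the eigenfunctions with
eigenvalue at most `t` span a space of dimension at least `j`. Meaningful for `1 ≤ j ≤ dim X`. -/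
def eigenvalue {d : ℕ} {Ω : Set (E d)} (A : E d → Matrix (Fin d) (Fin d) ℝ)
    (X : Submodule ℝ (H10 Ω)) (j : ℕ) : ℝ :=
  sInf {t : ℝ | (j : Cardinal) ≤ Module.rank ℝ (eigenSpan A X t)}

/-- The `j`-th exact eigenvalue `λ_j` (`j = 1, 2, …`). -/
def exactEigenvalue {d : ℕ} (Ω : Set (E d)) (A : E d → Matrix (Fin d) (Fin d) ℝ) (j : ℕ) : ℝ :=
  eigenvalue A (⊤ : Submodule ℝ (H10 Ω)) j

/-! ### Approximation quantities -/

/-- `inf_{v ∈ X} ‖w - v‖_a`. -/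
def aDist {d : ℕ} {Ω : Set (E d)} (A : E d → Matrix (Fin d) (Fin d) ℝ) (w : H10 Ω)
    (X : Submodule ℝ (H10 Ω)) : ℝ :=
  sInf {r | ∃ v ∈ X, r = aNorm A (w - v)}

/-- `δ_X(lam)`, the supremum of `inf_{v ∈ X} ‖w - v‖_a` over the `w ∈ M(lam)` with `‖w‖_a = 1`,
where `M(lam)` is the exact eigenspace. -/
def deltaApprox {d : ℕ} {Ω : Set (E d)} (A : E d → Matrix (Fin d) (Fin d) ℝ)
    (X : Submodule ℝ (H10 Ω)) (lam : ℝ) : ℝ :=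
  sSup {r | ∃ w : H10 Ω, IsEigenpair A ⊤ lam w ∧ aNorm A w = 1 ∧ r = aDist A w X}

/-- `η(X)`, the supremum of `inf_{v ∈ X} ‖Tf - v‖_a` over the `f ∈ L²(Ω)` with `‖f‖_b = 1`, where
`w = Tf ∈ V` is determined by `a(w, v) = (f, v)` for all `v ∈ V`. -/
def eta {d : ℕ} {Ω : Set (E d)} (A : E d → Matrix (Fin d) (Fin d) ℝ)
    (X : Submodule ℝ (H10 Ω)) : ℝ :=
  sSup {r | ∃ (f : L2 Ω) (w : H10 Ω), √(l2Form f f) = 1 ∧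
    (∀ v : H10 Ω, aForm A w v = l2Form f (fn v)) ∧ r = aDist A w X}

/-! ### Meshes and linear finite element spaces -/

/-- A partition of `Ω` into finitely many convex polytopes (triangles, rectangles, tetrahedra,
hexahedra, …) with nonempty and pairwise disjoint interiors. -/
structure Mesh {d : ℕ} (Ω : Set (E d)) where
  cells : Set (Set (E d))
  finite : cells.Finite
  polytope : ∀ K ∈ cells, ∃ P : Set (E d), P.Finite ∧ K = convexHull ℝ P
  interior_nonempty : ∀ K ∈ cells, (interior K).Nonempty
  disjoint : cells.Pairwise fun K L => Disjoint (interior K) (interior L)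
  cover : ⋃₀ cells = closure Ω

/-- The mesh size: the maximal diameter of a cell. -/
def Mesh.size {d : ℕ} {Ω : Set (E d)} (T : Mesh Ω) : ℝ := sSup (Metric.diam '' T.cells)

/-- `T'` is obtained by subdividing cells of `T`. -/
def Mesh.Refines {d : ℕ} {Ω : Set (E d)} (T' T : Mesh Ω) : Prop :=
  ∀ K' ∈ T'.cells, ∃ K ∈ T.cells, K' ⊆ K

/-- The linear finite element space of a mesh: the elements of `H₀¹(Ω)` represented by a continuous
function on `Ω` that is affine on every cell. -/
def feSpace {d : ℕ} {Ω : Set (E d)} (T : Mesh Ω) : Submodule ℝ (H10 Ω) where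
  carrier := {v | ∃ φ : E d → ℝ, ContinuousOn φ Ω ∧ fn v =ᵐ[volume.restrict Ω] φ ∧
    ∀ K ∈ T.cells, ∃ g : E d →ᵃ[ℝ] ℝ, Set.EqOn φ g (K ∩ Ω)}
  zero_mem' := ⟨0, continuousOn_const, Lp.coeFn_zero _ _ _, fun _ _ => ⟨0, fun _ _ => rfl⟩⟩
  add_mem' := by
    rintro u v ⟨φ, h1, h2, h3⟩ ⟨ψ, k1, k2, k3⟩
    refine ⟨φ + ψ, h1.add k1, (Lp.coeFn_add (fn u) (fn v)).trans (h2.add k2), fun K hK => ?_⟩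
    obtain ⟨g, hg⟩ := h3 K hK
    obtain ⟨g', hg'⟩ := k3 K hK
    exact ⟨g + g', fun x hx => by simp [hg hx, hg' hx]⟩
  smul_mem' := by
    rintro c u ⟨φ, h1, h2, h3⟩
    refine ⟨c • φ, h1.const_smul c, (Lp.coeFn_smul c (fn u)).trans (h2.const_smul c),
      fun K hK => ?_⟩
    obtain ⟨g, hg⟩ := h3 K hK
    exact ⟨c • g, fun x hx => by simp [hg hx]⟩

/-- The meshes `T_H` and `T_{h_1}, …, T_{h_n}`: `T_{h_1}` refines `T_H`, and for `k = 2, …, n` the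
mesh `T_{h_k}` refines `T_{h_{k-1}}` with `h_k = h_{k-1} / β`. -/
structure IsHierarchy {d : ℕ} {Ω : Set (E d)} (n : ℕ) (β : ℝ) (TH : Mesh Ω) (T : ℕ → Mesh Ω) :
    Prop where
  coarse : (T 1).Refines TH
  refines : ∀ k, 2 ≤ k → k ≤ n → (T k).Refines (T (k - 1))
  size_eq : ∀ k, 2 ≤ k → k ≤ n → (T k).size = (T (k - 1)).size / β

/-! ### The algorithm -/

/-- One correction step in `Vh` with coarse space `VH`, from `p = (λ^{(ℓ)}, u^{(ℓ)})` to
`q = (λ^{(ℓ+1)}, u^{(ℓ+1)})`. Here `uhat` is the exact solution of the linear boundary value problem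
and `utilde` its approximation by an inner solver that reduces the error by the factor `θ`. The new
pair is an `a`-normalized eigenpair in `VH + span{utilde}`; among the eigenpairs there, one is taken
whose reciprocal eigenvalue is closest to `1 / lam`, where `lam` is the targeted exact eigenvalue. -/
def IsCorrection {d : ℕ} {Ω : Set (E d)} (A : E d → Matrix (Fin d) (Fin d) ℝ) (θ lam : ℝ)
    (VH Vh : Submodule ℝ (H10 Ω)) (p q : ℝ × H10 Ω) : Prop :=
  ∃ uhat ∈ Vh, ∃ utilde ∈ Vh,
    (∀ v ∈ Vh, aForm A uhat v = p.1 * bForm p.2 v) ∧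
    aNorm A (uhat - utilde) ≤ θ * aNorm A (uhat - p.2) ∧
    IsEigenpair A (VH ⊔ Submodule.span ℝ {utilde}) q.1 q.2 ∧
    aForm A q.2 q.2 = 1 ∧
    ∀ (s : ℝ) (w : H10 Ω), IsEigenpair A (VH ⊔ Submodule.span ℝ {utilde}) s w →
      |1 / q.1 - 1 / lam| ≤ |1 / s - 1 / lam|

/-- A run of the parallel augmented subspace scheme for the first `m` eigenpairs.
`out i k` is the pair `(λ_{i,h_k}, u_{i,h_k})` and `iter i k ℓ` the pair
`(λ_{i,h_k}^{(ℓ)}, u_{i,h_k}^{(ℓ)})`. -/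
structure IsRun {d : ℕ} {Ω : Set (E d)} (A : E d → Matrix (Fin d) (Fin d) ℝ) (θ : ℝ)
    (n m ϖ ϖn : ℕ) (VH : Submodule ℝ (H10 Ω)) (V : ℕ → Submodule ℝ (H10 Ω))
    (out : ℕ → ℕ → ℝ × H10 Ω) (iter : ℕ → ℕ → ℕ → ℝ × H10 Ω) : Prop where
  /-- Step 1: the eigenvalue problem is solved in the first space. -/
  init_eigenvalue : ∀ i, 1 ≤ i → i ≤ m → (out i 1).1 = eigenvalue A (V 1) i
  init_eigenpair : ∀ i, 1 ≤ i → i ≤ m →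
    IsEigenpair A (V 1) (out i 1).1 (out i 1).2 ∧ aForm A (out i 1).2 (out i 1).2 = 1
  /-- Step 2 (A): `ϖ` correction steps in each of the spaces number `2, …, n - 1`. -/
  mid_start : ∀ i, 1 ≤ i → i ≤ m → ∀ k, 1 ≤ k → k + 2 ≤ n → iter i (k + 1) 0 = out i k
  mid_step : ∀ i, 1 ≤ i → i ≤ m → ∀ k, 1 ≤ k → k + 2 ≤ n → ∀ l, l < ϖ →
    IsCorrection A θ (exactEigenvalue Ω A i) VH (V (k + 1)) (iter i (k + 1) l) (iter i (k + 1) (l + 1))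
  mid_out : ∀ i, 1 ≤ i → i ≤ m → ∀ k, 1 ≤ k → k + 2 ≤ n → out i (k + 1) = iter i (k + 1) ϖ
  /-- Step 2 (B): `ϖn` correction steps in the finest space. -/
  fin_start : ∀ i, 1 ≤ i → i ≤ m → iter i n 0 = out i (n - 1)
  fin_step : ∀ i, 1 ≤ i → i ≤ m → ∀ l, l < ϖn →
    IsCorrection A θ (exactEigenvalue Ω A i) VH (V n) (iter i n l) (iter i n (l + 1))
  fin_out : ∀ i, 1 ≤ i → i ≤ m → out i n = iter i n ϖn

/-! ### The constants -/

/-- `gap ≤ min_{j ≠ i} |1/λ_{j,h} - 1/λ_i|`, the minimum being over `1 ≤ j ≤ dim Vh`, `j ≠ i`. -/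
def IsGapBound {d : ℕ} {Ω : Set (E d)} (A : E d → Matrix (Fin d) (Fin d) ℝ)
    (Vh : Submodule ℝ (H10 Ω)) (i : ℕ) (gap : ℝ) : Prop :=
  ∀ j, 1 ≤ j → j ≤ Module.finrank ℝ Vh → j ≠ i →
    gap ≤ |1 / eigenvalue A Vh j - 1 / exactEigenvalue Ω A i|

/-- `C̄_λ = 2 λ_i (1 + 1/(λ_1 δ_λ)) + λ_{i,h_1} (1 + η²(V_H)/(λ_1 δ_λ²))^{1/2}`. -/
def Cbar {d : ℕ} {Ω : Set (E d)} (A : E d → Matrix (Fin d) (Fin d) ℝ)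
    (VH V1 : Submodule ℝ (H10 Ω)) (i : ℕ) (gap : ℝ) : ℝ :=
  2 * |exactEigenvalue Ω A i| * (1 + 1 / (exactEigenvalue Ω A 1 * gap)) +
    eigenvalue A V1 i * √(1 + 1 / (exactEigenvalue Ω A 1 * gap ^ 2) * eta A VH ^ 2)

/-- `D̄_λ = C̄_λ / λ_1^{1/2}`. -/
def Dbar {d : ℕ} {Ω : Set (E d)} (A : E d → Matrix (Fin d) (Fin d) ℝ)
    (VH V1 : Submodule ℝ (H10 Ω)) (i : ℕ) (gap : ℝ) : ℝ :=
  1 / √(exactEigenvalue Ω A 1) * Cbar A VH V1 i gap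

/-- `γ = (θ + (1 + θ) C̄_λ η(V_H) / λ_1^{1/2}) / (1 - D̄_λ η(V_H))`. -/
def gammaRate {d : ℕ} {Ω : Set (E d)} (A : E d → Matrix (Fin d) (Fin d) ℝ)
    (VH V1 : Submodule ℝ (H10 Ω)) (i : ℕ) (gap θ : ℝ) : ℝ :=
  1 / (1 - Dbar A VH V1 i gap * eta A VH) *
    (θ + (1 + θ) * (Cbar A VH V1 i gap / √(exactEigenvalue Ω A 1)) * eta A VH)

end AugSub

end

namespace AugSub
namespace Galerkin

open Module
open scoped RealInnerProductSpace

variable {V H : Type*} [NormedAddCommGroup V] [InnerProductSpace ℝ V] [NormedAddCommGroup H]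
  [InnerProductSpace ℝ H]

/-- `(lam, u)` is an eigenpair in `X` of the form `⟪u, v⟫ = lam * ⟪J u, J v⟫`. -/
def Eigenpair (J : V →L[ℝ] H) (X : Submodule ℝ V) (lam : ℝ) (u : V) : Prop :=
  u ∈ X ∧ u ≠ 0 ∧ ∀ v ∈ X, ⟪u, v⟫ = lam * ⟪J u, J v⟫

/-- The span of the eigenvectors in `X` with eigenvalue at most `t`. -/
def specSpan (J : V →L[ℝ] H) (X : Submodule ℝ V) (t : ℝ) : Submodule ℝ V :=
  Submodule.span ℝ {u | ∃ s : ℝ, s ≤ t ∧ Eigenpair J X s u}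

/-- The `j`-th smallest eigenvalue in `X`. -/
noncomputable def specVal (J : V →L[ℝ] H) (X : Submodule ℝ V) (j : ℕ) : ℝ :=
  sInf {t : ℝ | (j : Cardinal) ≤ Module.rank ℝ (specSpan J X t)}

theorem Eigenpair.norm_sq {J : V →L[ℝ] H} {X : Submodule ℝ V} {lam : ℝ} {u : V}
    (h : Eigenpair J X lam u) : ‖u‖ ^ 2 = lam * ‖J u‖ ^ 2 := by
  rw [← real_inner_self_eq_norm_sq, ← real_inner_self_eq_norm_sq, h.2.2 u h.1]

theorem Eigenpair.pos {J : V →L[ℝ] H} {X : Submodule ℝ V} {lam : ℝ} {u : V}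
    (h : Eigenpair J X lam u) : 0 < lam := by
  have h1 := h.norm_sq
  have h2 : 0 < ‖u‖ ^ 2 := by have := norm_pos_iff.2 h.2.1; positivity
  by_contra hneg
  nlinarith [sq_nonneg ‖J u‖]

theorem Eigenpair.mono {J : V →L[ℝ] H} {X Y : Submodule ℝ V} {lam : ℝ} {u : V}
    (h : Eigenpair J Y lam u) (hXY : X ≤ Y) (hu : u ∈ X) : Eigenpair J X lam u :=
  ⟨hu, h.2.1, fun v hv => h.2.2 v (hXY hv)⟩

theorem Eigenpair.inner_eq_zero {J : V →L[ℝ] H} {X : Submodule ℝ V} {s t : ℝ} {u w : V}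
    (hu : Eigenpair J X s u) (hw : Eigenpair J X t w) (hst : s ≠ t) : ⟪u, w⟫ = 0 := by
  have h1 := hu.2.2 w hw.1
  have h2 := hw.2.2 u hu.1
  rw [real_inner_comm, real_inner_comm (J u)] at h2
  have h3 : (s - t) * ⟪J u, J w⟫ = 0 := by linarith
  rcases mul_eq_zero.1 h3 with h | h
  · exact absurd (sub_eq_zero.1 h) hst
  · rw [h1, h, mul_zero]

/-- An orthonormal basis of `X` of eigenvectors with nondecreasing eigenvalues. -/
structure EigenBasis (J : V →L[ℝ] H) (X : Submodule ℝ V) (N : ℕ) where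
  vec : Fin N → V
  val : Fin N → ℝ
  mono : Monotone val
  orthonormal : Orthonormal ℝ vec
  eig : ∀ j, Eigenpair J X (val j) (vec j)
  expand : ∀ x ∈ X, x = ∑ j, ⟪vec j, x⟫ • vec j

theorem exists_eigenBasis [CompleteSpace H] (J : V →L[ℝ] H) (hJ : Function.Injective J)
    (X : Submodule ℝ V) [FiniteDimensional ℝ X] : Nonempty (EigenBasis J X (finrank ℝ X)) := by
  have : CompleteSpace X := FiniteDimensional.complete ℝ X
  let JX : X →L[ℝ] H := J ∘L X.subtypeL
  let S : X →L[ℝ] X := (ContinuousLinearMap.adjoint JX) ∘L JX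
  have hS : ∀ x y : X, ⟪S x, y⟫ = ⟪J x, J y⟫ := fun x y => by
    simp only [S, ContinuousLinearMap.comp_apply]
    rw [ContinuousLinearMap.adjoint_inner_left]; rfl
  have hsym : (S : X →ₗ[ℝ] X).IsSymmetric := fun x y => by
    change ⟪S x, y⟫ = ⟪x, S y⟫
    exact (hS x y).trans ((real_inner_comm _ _).trans ((hS y x).symm.trans (real_inner_comm _ _)))
  set e := hsym.eigenvectorBasis rfl with he
  set m := hsym.eigenvalues rfl with hm
  have hSe : ∀ j, S (e j) = m j • e j := fun j => by
    exact hsym.apply_eigenvectorBasis rfl j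
  have hinner : ∀ j (v : X), ⟪J (e j), J v⟫ = m j * ⟪e j, v⟫ := fun j v => by
    rw [← hS, hSe, real_inner_smul_left]
  have hpos : ∀ j, 0 < m j := fun j => by
    have h1 := hinner j (e j)
    rw [real_inner_self_eq_norm_sq, real_inner_self_eq_norm_sq, e.orthonormal.1 j] at h1
    have h2 : J (e j) ≠ 0 := fun h0 => by
      have : ((e j : X) : V) = 0 := hJ (by rw [h0, map_zero])
      have h3 := e.orthonormal.1 j
      rw [Submodule.coe_eq_zero.1 this] at h3
      simp at h3
    have := norm_pos_iff.2 h2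
    have : 0 < ‖J (e j)‖ ^ 2 := by positivity
    linarith
  refine ⟨⟨fun j => e j, fun j => (m j)⁻¹, ?_, ?_, ?_, ?_⟩⟩
  · intro i j hij
    exact inv_anti₀ (hpos j) (hsym.eigenvalues_antitone rfl hij)
  · exact e.orthonormal.comp_linearIsometry X.subtypeₗᵢ
  · refine fun j => ⟨(e j).2, fun h0 => ?_, fun v hv => ?_⟩
    · have h3 := e.orthonormal.1 j
      rw [Submodule.coe_eq_zero.1 h0] at h3
      simp at h3
    · rw [hinner j ⟨v, hv⟩, ← mul_assoc, inv_mul_cancel₀ (hpos j).ne', one_mul]; rfl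
  · intro x hx
    have := (e.sum_repr' ⟨x, hx⟩).symm
    have := congrArg (Subtype.val) this
    rw [Submodule.coe_sum] at this
    simpa using this

namespace EigenBasis

variable {J : V →L[ℝ] H} {X : Submodule ℝ V} {N : ℕ} (B : EigenBasis J X N)
include B

theorem inner_J (j : Fin N) {v : V} (hv : v ∈ X) :
    ⟪J (B.vec j), J v⟫ = (B.val j)⁻¹ * ⟪B.vec j, v⟫ := by
  rw [(B.eig j).2.2 v hv, ← mul_assoc, inv_mul_cancel₀ (B.eig j).pos.ne', one_mul]

theorem norm_sq {x : V} (hx : x ∈ X) : ‖x‖ ^ 2 = ∑ j, ⟪B.vec j, x⟫ ^ 2 := by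
  rw [← real_inner_self_eq_norm_sq]
  nth_rw 1 [B.expand x hx]
  rw [sum_inner]
  exact Finset.sum_congr rfl fun j _ => by rw [real_inner_smul_left, sq]

theorem norm_J_sq {x : V} (hx : x ∈ X) :
    ‖J x‖ ^ 2 = ∑ j, (B.val j)⁻¹ * ⟪B.vec j, x⟫ ^ 2 := by
  rw [← real_inner_self_eq_norm_sq]
  nth_rw 1 [B.expand x hx]
  rw [map_sum, sum_inner]
  refine Finset.sum_congr rfl fun j _ => ?_
  rw [map_smul, real_inner_smul_left, B.inner_J j hx]
  ring

theorem eq_zero_of_inner_eq_zero {x : V} (hx : x ∈ X) (h : ∀ j, ⟪B.vec j, x⟫ = 0) : x = 0 := by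
  rw [B.expand x hx]
  simp [h]

theorem exists_val_eq {s : ℝ} {w : V} (hw : Eigenpair J X s w) :
    ∃ j, B.val j = s ∧ ⟪B.vec j, w⟫ ≠ 0 := by
  by_contra! h
  refine hw.2.1 (B.eq_zero_of_inner_eq_zero hw.1 fun j => ?_)
  by_cases hj : B.val j = s
  · exact h j hj
  · exact (B.eig j).inner_eq_zero hw hj

theorem specSpan_eq (t : ℝ) :
    specSpan J X t = Submodule.span ℝ (Set.range fun j : {j // B.val j ≤ t} => B.vec j) := by
  apply le_antisymm
  · refine Submodule.span_le.2 ?_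
    rintro u ⟨s, hs, hu⟩
    rw [SetLike.mem_coe, B.expand u hu.1]
    refine Submodule.sum_mem _ fun j _ => ?_
    by_cases hj : B.val j = s
    · exact Submodule.smul_mem _ _ (Submodule.subset_span ⟨⟨j, hj.le.trans hs⟩, rfl⟩)
    · rw [(B.eig j).inner_eq_zero hu hj, zero_smul]
      exact Submodule.zero_mem _
  · refine Submodule.span_le.2 ?_
    rintro _ ⟨⟨j, hj⟩, rfl⟩
    exact Submodule.subset_span ⟨B.val j, hj, B.eig j⟩

theorem rank_specSpan (t : ℝ) :
    Module.rank ℝ (specSpan J X t) = (Fintype.card {j // B.val j ≤ t} : ℕ) := by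
  rw [B.specSpan_eq]
  have hli : LinearIndependent ℝ (fun j : {j // B.val j ≤ t} => B.vec j) :=
    B.orthonormal.linearIndependent.comp _ Subtype.val_injective
  have := FiniteDimensional.span_of_finite ℝ
    (Set.finite_range fun j : {j // B.val j ≤ t} => B.vec j)
  rw [← Module.finrank_eq_rank, finrank_span_eq_card hli]

theorem succ_le_rank_iff (k : Fin N) (t : ℝ) :
    ((k + 1 : ℕ) : Cardinal) ≤ Module.rank ℝ (specSpan J X t) ↔ B.val k ≤ t := by
  rw [B.rank_specSpan, Nat.cast_le]
  constructor
  · intro h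
    by_contra! hlt
    have h1 : Fintype.card {j // B.val j ≤ t} ≤ Fintype.card (Fin k) := by
      refine Fintype.card_le_of_injective (fun j => ⟨j.1, ?_⟩) ?_
      · by_contra! hk
        exact absurd ((B.mono (Fin.le_def.2 hk)).trans j.2) (not_le.2 hlt)
      · intro a b hab
        simpa [Fin.ext_iff, Subtype.ext_iff] using hab
    rw [Fintype.card_fin] at h1
    omega
  · intro h
    have h1 : Fintype.card (Fin (k + 1)) ≤ Fintype.card {j // B.val j ≤ t} := by
      refine Fintype.card_le_of_injective
        (fun j => ⟨⟨j.1, by omega⟩, (B.mono (Fin.le_def.2 ?_)).trans h⟩) ?_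
      · simpa using Nat.lt_succ_iff.1 j.2
      · intro a b hab
        simpa [Fin.ext_iff, Subtype.ext_iff] using hab
    rwa [Fintype.card_fin] at h1

theorem specVal_eq (k : Fin N) : specVal J X (k + 1) = B.val k := by
  rw [specVal]
  have : {t : ℝ | ((k + 1 : ℕ) : Cardinal) ≤ Module.rank ℝ (specSpan J X t)} =
      Set.Ici (B.val k) := by
    ext t
    exact B.succ_le_rank_iff k t
  rw [this, csInf_Ici]

theorem le_inv_val_of_finrank [FiniteDimensional ℝ X] {W : Submodule ℝ V} (hWX : W ≤ X) {κ : ℝ}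
    (hW : ∀ v ∈ W, κ * ‖v‖ ^ 2 ≤ ‖J v‖ ^ 2) (k : Fin N) (hk : k < finrank ℝ W) :
    κ ≤ (B.val k)⁻¹ := by
  let L : W →ₗ[ℝ] (Fin k → ℝ) :=
    LinearMap.pi fun j => (innerₛₗ ℝ (B.vec ⟨j, by omega⟩)) ∘ₗ W.subtype
  have : FiniteDimensional ℝ W := Submodule.finiteDimensional_of_le hWX
  have hker : L.ker ≠ ⊥ := LinearMap.ker_ne_bot_of_finrank_lt (by simpa using hk)
  obtain ⟨⟨v, hvW⟩, hv, hv0⟩ := (Submodule.ne_bot_iff _).1 hker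
  have hvX := hWX hvW
  have hv0' : v ≠ 0 := fun h => hv0 (by simp [h])
  have hz : ∀ j : Fin N, j < k → ⟪B.vec j, v⟫ = 0 := fun j hj => by
    have := congrFun (LinearMap.mem_ker.1 hv) ⟨j, hj⟩
    simpa [L] using this
  have h1 : ‖J v‖ ^ 2 ≤ (B.val k)⁻¹ * ‖v‖ ^ 2 := by
    rw [B.norm_J_sq hvX, B.norm_sq hvX, Finset.mul_sum]
    refine Finset.sum_le_sum fun j _ => ?_
    by_cases hj : j < k
    · simp [hz j hj]
    · exact mul_le_mul_of_nonneg_right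
        (inv_anti₀ (B.eig k).pos (B.mono (not_lt.1 hj))) (sq_nonneg _)
  have h2 := hW v hvW
  have h3 : 0 < ‖v‖ ^ 2 := by have := norm_pos_iff.2 hv0'; positivity
  exact le_of_mul_le_mul_right (h2.trans h1) h3

/-- The span of the first `k + 1` eigenvectors. -/
theorem exists_low_subspace (k : Fin N) :
    ∃ W : Submodule ℝ V, W ≤ X ∧ FiniteDimensional ℝ W ∧ finrank ℝ W = k + 1 ∧
      ∀ v ∈ W, ‖v‖ ^ 2 ≤ B.val k * ‖J v‖ ^ 2 := by
  let f : Fin (k + 1) → V := fun j => B.vec ⟨j, by omega⟩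
  have hf : Orthonormal ℝ f := B.orthonormal.comp _ fun a b h => by
    simpa [Fin.ext_iff] using h
  have hle : Submodule.span ℝ (Set.range f) ≤ X := by
    refine Submodule.span_le.2 ?_
    rintro _ ⟨j, rfl⟩
    exact (B.eig _).1
  refine ⟨Submodule.span ℝ (Set.range f), hle,
    FiniteDimensional.span_of_finite ℝ (Set.finite_range f), ?_, fun v hv => ?_⟩
  · rw [finrank_span_eq_card hf.linearIndependent, Fintype.card_fin]
  · have hz : ∀ j : Fin N, k < j → ⟪B.vec j, v⟫ = 0 := fun j hj => by
      induction hv using Submodule.span_induction with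
      | mem x hx =>
        obtain ⟨i, rfl⟩ := hx
        refine B.orthonormal.2 fun h => ?_
        rw [Fin.ext_iff] at h
        simp only [Fin.lt_def] at hj
        have := i.2
        simp only at h
        omega
      | zero => simp
      | add x y _ _ hx hy => rw [inner_add_right, hx, hy, add_zero]
      | smul c x _ hx => rw [inner_smul_right, hx, mul_zero]
    rw [B.norm_J_sq (hle hv), B.norm_sq (hle hv), Finset.mul_sum]
    refine Finset.sum_le_sum fun j _ => ?_
    by_cases hj : k < j
    · simp [hz j hj]
    · have h1 : 1 ≤ B.val k * (B.val j)⁻¹ := by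
        rw [← div_eq_mul_inv, le_div_iff₀ (B.eig j).pos, one_mul]
        exact B.mono (not_lt.1 hj)
      rw [← mul_assoc]
      exact le_mul_of_one_le_left (sq_nonneg _) h1

theorem val_le_of_le [FiniteDimensional ℝ X] {Y : Submodule ℝ V} {M : ℕ} (C : EigenBasis J Y M)
    (hYX : Y ≤ X) (k : Fin N) (j : Fin M) (hkj : (k : ℕ) ≤ j) : B.val k ≤ C.val j := by
  obtain ⟨W, hW, hWf, hWd, hWb⟩ := C.exists_low_subspace j
  have := B.le_inv_val_of_finrank (hW.trans hYX) (κ := (C.val j)⁻¹) (fun v hv => by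
    rw [inv_mul_le_iff₀ (C.eig j).pos]
    exact hWb v hv) k (by omega)
  exact (inv_le_inv₀ (C.eig j).pos (B.eig k).pos).1 this

end EigenBasis

section Compactness

variable {V H : Type*} [NormedAddCommGroup V] [InnerProductSpace ℝ V] [NormedAddCommGroup H]
  [InnerProductSpace ℝ H]

/-- `J` is small on subspaces of finite codimension. -/
def FiniteRankApprox (J : V →L[ℝ] H) : Prop :=
  ∀ ε : ℝ, 0 < ε → ∃ (n : ℕ) (L : V →L[ℝ] (Fin n → ℝ)), ∀ v, L v = 0 → ‖J v‖ ≤ ε * ‖v‖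

theorem FiniteRankApprox.isCompactOperator [CompleteSpace V] [CompleteSpace H] {J : V →L[ℝ] H}
    (hJ : FiniteRankApprox J) : IsCompactOperator J := by
  have hcl : IsClosed {f : V →L[ℝ] H | IsCompactOperator f} := isClosed_setOfPred_isCompactOperator
  refine hcl.closure_subset (Metric.mem_closure_iff.2 fun ε hε => ?_)
  obtain ⟨n, L, hL⟩ := hJ (ε / 2) (by positivity)
  let K : Submodule ℝ V := L.ker
  have hK : IsClosed (K : Set V) := L.isClosed_ker
  have : CompleteSpace K := hK.completeSpace_coe
  have hfin : FiniteDimensional ℝ Kᗮ := by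
    refine FiniteDimensional.of_injective ((L : V →ₗ[ℝ] (Fin n → ℝ)) ∘ₗ Kᗮ.subtype) ?_
    rw [← LinearMap.ker_eq_bot, LinearMap.ker_eq_bot']
    intro x hx
    have h1 : (x : V) ∈ K := hx
    have h2 := K.inner_right_of_mem_orthogonal h1 x.2
    exact Subtype.ext (inner_self_eq_zero.1 h2)
  let F : V →L[ℝ] H := (J ∘L Kᗮ.subtypeL) ∘L Kᗮ.orthogonalProjectionOnto
  refine ⟨F, ?_, ?_⟩
  · have h1 : IsCompactOperator (J ∘L Kᗮ.subtypeL) := by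
      have := FiniteDimensional.proper ℝ Kᗮ
      exact isCompactOperator_of_locallyCompactSpace_rng
        (J ∘L Kᗮ.subtypeL)
    exact h1.comp_clm _
  · rw [dist_eq_norm]
    refine lt_of_le_of_lt (ContinuousLinearMap.opNorm_le_bound _ (by positivity : 0 ≤ ε / 2)
      fun v => ?_) (by linarith)
    have h1 : v - Kᗮ.orthogonalProjectionOnto v ∈ K := by
      have := Kᗮ.sub_starProjection_mem_orthogonal v
      rwa [Submodule.orthogonal_orthogonal] at this
    have h2 : (J - F) v = J (v - Kᗮ.orthogonalProjectionOnto v) := by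
      simp [F]
    rw [h2]
    refine (hL _ h1).trans ?_
    gcongr
    have h3 : v - Kᗮ.starProjection v = K.starProjection v := by
      rw [Submodule.starProjection_orthogonal']
      simp
    rw [Submodule.coe_orthogonalProjectionOnto_apply, h3]
    exact K.norm_starProjection_apply_le v

end Compactness

section Exact

variable {V H : Type*} [NormedAddCommGroup V] [InnerProductSpace ℝ V] [CompleteSpace V]
  [NormedAddCommGroup H] [InnerProductSpace ℝ H] [CompleteSpace H] {J : V →L[ℝ] H}

theorem exists_eigenpair_of_invariant (hJ : FiniteRankApprox J) {U : Submodule ℝ V}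
    (hUc : IsClosed (U : Set V)) (hU : ∀ x ∈ U, ContinuousLinearMap.adjoint J (J x) ∈ U)
    {v : V} (hv : v ∈ U) (hv0 : v ≠ 0) {t : ℝ} (ht : 0 < t) (hvt : ‖v‖ ^ 2 ≤ t * ‖J v‖ ^ 2) :
    ∃ w ∈ U, ∃ s ≤ t, Eigenpair J ⊤ s w := by
  have : CompleteSpace U := hUc.completeSpace_coe
  let S : V →L[ℝ] V := ContinuousLinearMap.adjoint J ∘L J
  have hS : ∀ x y : V, ⟪S x, y⟫ = ⟪J x, J y⟫ := fun x y => by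
    simp only [S, ContinuousLinearMap.comp_apply]
    rw [ContinuousLinearMap.adjoint_inner_left]
  have hSc : IsCompactOperator S := hJ.isCompactOperator.clm_comp (ContinuousLinearMap.adjoint J)
  let T : U →L[ℝ] U := S.restrict hU
  have hTc : IsCompactOperator T := hSc.restrict' (f := (S : V →ₗ[ℝ] V)) hU
  have hT : ∀ x y : U, ⟪T x, y⟫ = ⟪J x, J y⟫ := fun x y => hS x y
  have hTs : (T : U →ₗ[ℝ] U).IsSymmetric := fun x y =>
    (hT x y).trans ((real_inner_comm _ _).trans ((hT y x).symm.trans (real_inner_comm _ _)))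
  have hray : ∀ x : U, T.rayleighQuotient x = ‖J x‖ ^ 2 / ‖x‖ ^ 2 := fun x => by
    rw [ContinuousLinearMap.rayleighQuotient, ContinuousLinearMap.reApplyInnerSelf_apply, hT,
      real_inner_self_eq_norm_sq]
    rfl
  have hne : Nontrivial U := ⟨⟨⟨v, hv⟩, 0, fun h => hv0 (congrArg Subtype.val h)⟩⟩
  have hspec : ‖T‖ ∈ spectrum ℝ T := by
    by_contra hcon
    obtain ⟨ε, hε, h⟩ := T.rayleighQuotient_le_of_norm_mem_resolventSet (𝕜 := ℝ)
      (by simpa [spectrum] using hcon)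
    have h1 : ‖T‖ ≤ ‖T‖ - ε := by
      conv_lhs => rw [T.norm_eq_iSup_rayleighQuotient hTs]
      refine ciSup_le fun x => ?_
      rw [abs_of_nonneg (by rw [hray]; positivity)]
      exact h x
    linarith
  have hvpos : 0 < ‖v‖ ^ 2 := by have := norm_pos_iff.2 hv0; positivity
  have hnorm : t⁻¹ ≤ ‖T‖ := by
    refine le_trans ?_ ((le_abs_self _).trans (T.rayleighQuotient_le_norm ⟨v, hv⟩))
    rw [hray, le_div_iff₀ (by exact hvpos)]
    rw [inv_mul_le_iff₀ ht]
    exact hvt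
  have hTpos : 0 < ‖T‖ := lt_of_lt_of_le (inv_pos.2 ht) hnorm
  obtain ⟨w, hw⟩ := ((hTc.hasEigenvalue_iff_mem_spectrum hTpos.ne').2 hspec).exists_hasEigenvector
  refine ⟨w, w.2, ‖T‖⁻¹, inv_le_of_inv_le₀ ht hnorm, Submodule.mem_top, fun h => hw.2 (Subtype.ext h),
    fun y _ => ?_⟩
  have h1 : S w = ‖T‖ • (w : V) := congrArg Subtype.val hw.apply_eq_smul
  rw [← hS, h1, real_inner_smul_left, ← mul_assoc, inv_mul_cancel₀ hTpos.ne', one_mul]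

theorem lt_of_mem_specSpan_orthogonal (hJ : FiniteRankApprox J) {t : ℝ} (ht : 0 < t) {v : V}
    (hv : v ∈ (specSpan J ⊤ t)ᗮ) (hv0 : v ≠ 0) : t * ‖J v‖ ^ 2 < ‖v‖ ^ 2 := by
  by_contra! hcon
  have hinv : ∀ x ∈ (specSpan J ⊤ t)ᗮ, ContinuousLinearMap.adjoint J (J x) ∈ (specSpan J ⊤ t)ᗮ := by
    intro x hx
    rw [Submodule.mem_orthogonal] at hx ⊢
    intro u hu
    induction hu using Submodule.span_induction with
    | mem u hu =>
      obtain ⟨s, hs, hus⟩ := hu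
      have h1 := hx u (Submodule.subset_span ⟨s, hs, hus⟩)
      rw [hus.2.2 x Submodule.mem_top] at h1
      rw [ContinuousLinearMap.adjoint_inner_right]
      exact (mul_eq_zero.1 h1).resolve_left hus.pos.ne'
    | zero => simp
    | add x y _ _ hx hy => rw [inner_add_left, hx, hy, add_zero]
    | smul c x _ hx => rw [real_inner_smul_left, hx, mul_zero]
  obtain ⟨w, hw, s, hs, hws⟩ := exists_eigenpair_of_invariant hJ
    (Submodule.isClosed_orthogonal _) hinv hv hv0 ht hcon
  have h1 : w ∈ specSpan J ⊤ t := Submodule.subset_span ⟨s, hs, hws⟩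
  exact hws.2.1 (inner_self_eq_zero.1 (Submodule.inner_right_of_mem_orthogonal h1 hw))

omit [CompleteSpace V] in
theorem norm_sq_le_of_mem_specSpan (hinj : Function.Injective J) {t : ℝ} {v : V}
    (hv : v ∈ specSpan J ⊤ t) : ‖v‖ ^ 2 ≤ t * ‖J v‖ ^ 2 := by
  obtain ⟨T, hT, hvT⟩ := Submodule.mem_span_finite_of_mem_span hv
  have : FiniteDimensional ℝ (Submodule.span ℝ (T : Set V)) :=
    FiniteDimensional.span_of_finite ℝ T.finite_toSet
  obtain ⟨B⟩ := exists_eigenBasis J hinj (Submodule.span ℝ (T : Set V))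
  have hval : ∀ j, B.val j ≤ t := fun j => by
    by_contra! hj
    have h0 : ∀ x ∈ Submodule.span ℝ (T : Set V), ⟪B.vec j, x⟫ = 0 := fun x hx => by
      induction hx using Submodule.span_induction with
      | mem x hx =>
        obtain ⟨s, hs, hxs⟩ := hT hx
        exact (B.eig j).inner_eq_zero (hxs.mono le_top (Submodule.subset_span hx))
          (by linarith : B.val j ≠ s)
      | zero => simp
      | add x y _ _ hx hy => rw [inner_add_right, hx, hy, add_zero]
      | smul c x _ hx => rw [inner_smul_right, hx, mul_zero]
    exact (B.eig j).2.1 (inner_self_eq_zero.1 (h0 _ (B.eig j).1))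
  rw [B.norm_J_sq hvT, B.norm_sq hvT, Finset.mul_sum]
  refine Finset.sum_le_sum fun j _ => ?_
  rw [← mul_assoc]
  refine le_mul_of_one_le_left (sq_nonneg _) ?_
  rw [← div_eq_mul_inv, le_div_iff₀ (B.eig j).pos, one_mul]
  exact hval j

omit [CompleteSpace V] in
theorem finiteDimensional_specSpan (hJ : FiniteRankApprox J) (hinj : Function.Injective J) (t : ℝ) :
    FiniteDimensional ℝ (specSpan J ⊤ t) := by
  set r := max t 1 with hr
  have hr1 : 1 ≤ r := le_max_right _ _
  have hle : specSpan J ⊤ t ≤ specSpan J ⊤ r :=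
    Submodule.span_mono fun u ⟨s, hs, hu⟩ => ⟨s, hs.trans (le_max_left _ _), hu⟩
  suffices FiniteDimensional ℝ (specSpan J ⊤ r) from Submodule.finiteDimensional_of_le hle
  obtain ⟨n, L, hL⟩ := hJ (1 / (1 + r)) (by positivity)
  refine FiniteDimensional.of_injective ((L : V →ₗ[ℝ] (Fin n → ℝ)) ∘ₗ
    (specSpan J ⊤ r).subtype) ?_
  rw [← LinearMap.ker_eq_bot, LinearMap.ker_eq_bot']
  intro x hx
  have h1 := hL x hx
  have h2 := norm_sq_le_of_mem_specSpan hinj x.2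
  have h3 : ‖J x‖ ^ 2 ≤ (1 / (1 + r) * ‖(x : V)‖) ^ 2 := by gcongr
  have h4 : r * ‖J x‖ ^ 2 ≤ r * (1 / (1 + r) * ‖(x : V)‖) ^ 2 := by gcongr
  have h5 : r * (1 / (1 + r) * ‖(x : V)‖) ^ 2 = r / (1 + r) ^ 2 * ‖(x : V)‖ ^ 2 := by
    field_simp
  have h6 : r / (1 + r) ^ 2 ≤ 1 / 2 := by
    rw [div_le_div_iff₀ (by positivity) (by norm_num)]
    nlinarith
  have h7 : ‖(x : V)‖ ^ 2 ≤ 0 := by nlinarith [sq_nonneg ‖(x : V)‖]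
  have h8 : ‖(x : V)‖ = 0 := by nlinarith [norm_nonneg (x : V)]
  exact Subtype.ext (norm_eq_zero.1 h8)

variable {X : Submodule ℝ V} {N : ℕ}

theorem EigenBasis.lt_finrank_specSpan (hJ : FiniteRankApprox J) (hinj : Function.Injective J)
    (B : EigenBasis J X N) (k : Fin N) :
    (k : ℕ) < finrank ℝ (specSpan J ⊤ (B.val k)) := by
  have := finiteDimensional_specSpan hJ hinj (B.val k)
  obtain ⟨W, -, hWf, hWd, hWb⟩ := B.exists_low_subspace k
  by_contra! hlt
  let L : W →ₗ[ℝ] specSpan J ⊤ (B.val k) :=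
    ((specSpan J ⊤ (B.val k)).orthogonalProjectionOnto : V →ₗ[ℝ] _) ∘ₗ W.subtype
  have hker : L.ker ≠ ⊥ := LinearMap.ker_ne_bot_of_finrank_lt (by omega)
  obtain ⟨⟨v, hvW⟩, hv, hv0⟩ := (Submodule.ne_bot_iff _).1 hker
  have h1 : v ∈ (specSpan J ⊤ (B.val k))ᗮ :=
    Submodule.orthogonalProjectionOnto_eq_zero_iff.1 (LinearMap.mem_ker.1 hv)
  have h2 := lt_of_mem_specSpan_orthogonal hJ (B.eig k).pos h1 (fun h => hv0 (by simp [h]))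
  exact absurd (hWb v hvW) (not_le.2 h2)

omit [CompleteSpace V] [CompleteSpace H] in
theorem bddBelow_specVal (j : ℕ) :
    BddBelow {t : ℝ | ((j + 1 : ℕ) : Cardinal) ≤ Module.rank ℝ (specSpan J X t)} := by
  refine ⟨0, fun t ht => ?_⟩
  by_contra! hneg
  have : specSpan J X t = ⊥ := by
    rw [specSpan, Submodule.span_eq_bot]
    rintro u ⟨s, hs, hu⟩
    exact absurd hu.pos (by linarith)
  simp only [Set.mem_ofPred_eq] at ht
  rw [this, rank_bot] at ht
  have h0 : ((j + 1 : ℕ) : Cardinal) = 0 := le_antisymm ht (by simp)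
  exact absurd h0 (by exact_mod_cast Nat.succ_ne_zero j)

theorem EigenBasis.specVal_top_le (hJ : FiniteRankApprox J) (hinj : Function.Injective J)
    (B : EigenBasis J X N) (k : Fin N) : specVal J ⊤ (k + 1) ≤ B.val k := by
  refine csInf_le (bddBelow_specVal _) ?_
  have := finiteDimensional_specSpan hJ hinj (B.val k)
  simp only [Set.mem_ofPred_eq]
  rw [← Module.finrank_eq_rank, Nat.cast_le]
  exact B.lt_finrank_specSpan hJ hinj k

omit [CompleteSpace V] [CompleteSpace H] in
theorem eigenpair_top_of_specSpan [hfin : FiniteDimensional ℝ X] {t : ℝ} (hX : X = specSpan J ⊤ t)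
    {s : ℝ} {u : V} (hu : Eigenpair J X s u) : Eigenpair J ⊤ s u := by
  refine ⟨Submodule.mem_top, hu.2.1, fun v _ => ?_⟩
  have hz : v - X.starProjection v ∈ Xᗮ := X.sub_starProjection_mem_orthogonal v
  have hp : X.starProjection v ∈ X := X.starProjection_apply_mem v
  set z := v - X.starProjection v with hzdef
  have hv : v = X.starProjection v + z := by rw [hzdef]; abel
  have h0 : ∀ y ∈ X, ⟪J y, J z⟫ = 0 := by
    intro y hy
    rw [hX] at hy
    induction hy using Submodule.span_induction with
    | mem y hy =>
      obtain ⟨r, hr, hyr⟩ := hy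
      have h1 := Submodule.inner_right_of_mem_orthogonal
        (show y ∈ X from hX ▸ Submodule.subset_span ⟨r, hr, hyr⟩) hz
      rw [hyr.2.2 z Submodule.mem_top] at h1
      exact (mul_eq_zero.1 h1).resolve_left hyr.pos.ne'
    | zero => simp
    | add x y _ _ hx hy => rw [map_add, inner_add_left, hx, hy, add_zero]
    | smul c x _ hx => rw [map_smul, real_inner_smul_left, hx, mul_zero]
  rw [hv, map_add, inner_add_right, inner_add_right, hu.2.2 _ hp, h0 u hu.1,
    Submodule.inner_right_of_mem_orthogonal hu.1 hz, add_zero, add_zero]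

/-- The exact spectrum below an eigenvalue of a Galerkin space is that of a finite-dimensional
space. -/
theorem EigenBasis.exists_exact (hJ : FiniteRankApprox J) (hinj : Function.Injective J)
    (B : EigenBasis J X N) (k : Fin N) :
    (∃ u, Eigenpair J ⊤ (specVal J ⊤ (k + 1)) u ∧ ‖u‖ = 1) ∧
    ∃ W : Submodule ℝ V, FiniteDimensional ℝ W ∧ finrank ℝ W = k + 1 ∧
      ∀ v ∈ W, ‖v‖ ^ 2 ≤ specVal J ⊤ (k + 1) * ‖J v‖ ^ 2 := by
  have hfin := finiteDimensional_specSpan hJ hinj (B.val k)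
  have hlt := B.lt_finrank_specSpan hJ hinj k
  set Y := specSpan J ⊤ (B.val k) with hY
  obtain ⟨C⟩ := exists_eigenBasis J hinj Y
  have hspan : ∀ t ≤ B.val k, specSpan J ⊤ t = specSpan J Y t := fun t ht => by
    apply le_antisymm
    · refine Submodule.span_mono ?_
      rintro u ⟨s, hs, hu⟩
      exact ⟨s, hs, hu.mono le_top (Submodule.subset_span ⟨s, hs.trans ht, hu⟩)⟩
    · refine Submodule.span_mono ?_
      rintro u ⟨s, hs, hu⟩
      exact ⟨s, hs, eigenpair_top_of_specSpan hY hu⟩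
  have hval : specVal J ⊤ (k + 1) = C.val ⟨k, hlt⟩ := by
    rw [← C.specVal_eq, specVal, specVal]
    congr 1
    ext t
    simp only [Set.mem_ofPred_eq]
    rcases le_total t (B.val k) with ht | ht
    · rw [hspan t ht]
    · have h1 : ((k + 1 : ℕ) : Cardinal) ≤ Module.rank ℝ (specSpan J ⊤ (B.val k)) := by
        rw [← Module.finrank_eq_rank, Nat.cast_le]
        exact hlt
      have hm : ∀ Z : Submodule ℝ V, specSpan J Z (B.val k) ≤ specSpan J Z t := fun Z =>
        Submodule.span_mono fun u ⟨s, hs, hu⟩ => ⟨s, hs.trans ht, hu⟩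
      refine iff_of_true (h1.trans (Submodule.rank_mono (hm _))) ?_
      rw [hspan _ le_rfl] at h1
      exact h1.trans (Submodule.rank_mono (hm _))
  refine ⟨⟨C.vec ⟨k, hlt⟩, ?_, C.orthonormal.1 _⟩, ?_⟩
  · rw [hval]
    exact eigenpair_top_of_specSpan hY (C.eig _)
  · obtain ⟨W, -, h1, h2, h3⟩ := C.exists_low_subspace ⟨k, hlt⟩
    exact ⟨W, h1, h2, fun v hv => by rw [hval]; exact h3 v hv⟩

theorem specVal_one_mul_le (hJ : FiniteRankApprox J) (v : V) :
    specVal J ⊤ 1 * ‖J v‖ ^ 2 ≤ ‖v‖ ^ 2 := by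
  by_contra! hcon
  have hJv : 0 < ‖J v‖ ^ 2 := by
    refine lt_of_le_of_ne (sq_nonneg _) fun h => ?_
    rw [← h, mul_zero] at hcon
    exact absurd hcon (not_lt.2 (sq_nonneg _))
  have hv0 : v ≠ 0 := fun h => by simp [h] at hJv
  have hv : 0 < ‖v‖ ^ 2 := by have := norm_pos_iff.2 hv0; positivity
  obtain ⟨w, -, s, hs, hw⟩ := exists_eigenpair_of_invariant hJ (U := ⊤) isClosed_univ
    (fun _ _ => Submodule.mem_top) Submodule.mem_top hv0 (t := ‖v‖ ^ 2 / ‖J v‖ ^ 2)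
    (by positivity) (by rw [div_mul_cancel₀ _ hJv.ne'])
  have h1 : specVal J ⊤ (0 + 1) ≤ ‖v‖ ^ 2 / ‖J v‖ ^ 2 := by
    refine csInf_le (bddBelow_specVal 0) ?_
    simp only [Set.mem_ofPred_eq, zero_add, Nat.cast_one, Cardinal.one_le_iff_ne_zero]
    intro h0
    have hbot := Submodule.rank_eq_zero.1 h0
    have : w ∈ specSpan J ⊤ (‖v‖ ^ 2 / ‖J v‖ ^ 2) := Submodule.subset_span ⟨s, hs, hw⟩
    rw [hbot] at this
    exact hw.2.1 this
  rw [le_div_iff₀ hJv] at h1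
  exact absurd h1 (not_le.2 hcon)

end Exact

section Estimates

variable {V H : Type*} [NormedAddCommGroup V] [InnerProductSpace ℝ V]
  [NormedAddCommGroup H] [InnerProductSpace ℝ H] {J : V →L[ℝ] H}

theorem norm_sq_le_of_inner_le {lam1 : ℝ} (hl : 0 < lam1)
    (hP : ∀ v, lam1 * ‖J v‖ ^ 2 ≤ ‖v‖ ^ 2) {f : H} {z : V} (h : ‖z‖ ^ 2 ≤ ⟪f, J z⟫) :
    lam1 * ‖z‖ ^ 2 ≤ ‖f‖ ^ 2 := by
  have h1 := h.trans (real_inner_le_norm f (J z))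
  have h2 := hP z
  rcases (norm_nonneg z).eq_or_lt' with h0 | h0
  · rw [h0]; nlinarith [sq_nonneg ‖f‖]
  · have h3 : (‖z‖ ^ 2) ^ 2 ≤ (‖f‖ * ‖J z‖) ^ 2 := by gcongr
    have h4 : lam1 * (‖z‖ ^ 2) ^ 2 ≤ ‖f‖ ^ 2 * ‖z‖ ^ 2 := by
      calc lam1 * (‖z‖ ^ 2) ^ 2 ≤ lam1 * (‖f‖ * ‖J z‖) ^ 2 := by gcongr
        _ = ‖f‖ ^ 2 * (lam1 * ‖J z‖ ^ 2) := by ring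
        _ ≤ ‖f‖ ^ 2 * ‖z‖ ^ 2 := by gcongr
    have h5 : 0 < ‖z‖ ^ 2 := by positivity
    refine le_of_mul_le_mul_right ?_ h5
    linarith [h4]

theorem Eigenpair.of_orthogonal {X : Submodule ℝ V} {l s : ℝ} {u w : V} (hu : Eigenpair J X l u)
    (hu1 : ‖u‖ = 1) (hw : Eigenpair J (X ⊓ (Submodule.span ℝ {u})ᗮ) s w) : Eigenpair J X s w := by
  have hwu : ⟪u, w⟫ = 0 := Submodule.mem_orthogonal_singleton_iff_inner_right.1 hw.1.2
  refine ⟨hw.1.1, hw.2.1, fun v hv => ?_⟩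
  have hJ : ⟪J u, J w⟫ = 0 := by
    have h1 := hu.2.2 w hw.1.1
    rw [hwu] at h1
    exact (mul_eq_zero.1 h1.symm).resolve_left hu.pos.ne'
  have hwu' : ⟪w, u⟫ = 0 := by rw [real_inner_comm]; exact hwu
  have hJ' : ⟪J w, J u⟫ = 0 := by rw [real_inner_comm]; exact hJ
  have hv' : v - ⟪u, v⟫ • u ∈ X ⊓ (Submodule.span ℝ {u})ᗮ := by
    refine ⟨X.sub_mem hv (X.smul_mem _ hu.1), ?_⟩
    rw [SetLike.mem_coe, Submodule.mem_orthogonal_singleton_iff_inner_right, inner_sub_right,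
      inner_smul_right, real_inner_self_eq_norm_sq, hu1]
    ring
  have h2 := hw.2.2 _ hv'
  rw [map_sub, map_smul, inner_sub_right, inner_sub_right, inner_smul_right, inner_smul_right,
    hwu', hJ'] at h2
  linarith [h2]

theorem eigen_projection_estimate [CompleteSpace H] (hinj : Function.Injective J) {lam1 : ℝ}
    (hl : 0 < lam1) (hP : ∀ v, lam1 * ‖J v‖ ^ 2 ≤ ‖v‖ ^ 2) {X Z : Submodule ℝ V}
    [FiniteDimensional ℝ X] {l : ℝ} {u : V} (hu : Eigenpair J X l u) (hu1 : ‖u‖ = 1) (hXZ : X ≤ Z)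
    {lb g : ℝ} {ub : V} (hub : Eigenpair J Z lb ub) (hg : 0 < g)
    (hgap : ∀ s w, Eigenpair J X s w → ⟪u, w⟫ = 0 → g ≤ |s⁻¹ - lb⁻¹|) :
    lam1 * g ^ 2 * ‖X.starProjection ub - ⟪u, ub⟫ • u‖ ^ 2 ≤
      ‖J (ub - X.starProjection ub)‖ ^ 2 ∧
    lam1 * g * ‖J (X.starProjection ub - ⟪u, ub⟫ • u)‖ ≤ ‖J (ub - X.starProjection ub)‖ := by
  set p := X.starProjection ub with hp
  have hpX : p ∈ X := X.starProjection_apply_mem ub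
  have hwX : ∀ v ∈ X, ⟪v, p⟫ = ⟪v, ub⟫ := fun v hv => by
    have := Submodule.inner_right_of_mem_orthogonal hv (X.sub_starProjection_mem_orthogonal ub)
    rw [inner_sub_right] at this
    linarith
  set w := ub - p with hw
  set y := p - ⟪u, ub⟫ • u with hy
  let X' := X ⊓ (Submodule.span ℝ {u})ᗮ
  have hX'X : X' ≤ X := inf_le_left
  have hfin : FiniteDimensional ℝ X' := Submodule.finiteDimensional_of_le hX'X
  obtain ⟨B⟩ := exists_eigenBasis J hinj X'
  have hyX' : y ∈ X' := by
    refine ⟨X.sub_mem hpX (X.smul_mem _ hu.1), ?_⟩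
    rw [SetLike.mem_coe, Submodule.mem_orthogonal_singleton_iff_inner_right, inner_sub_right,
      inner_smul_right, real_inner_self_eq_norm_sq, hu1, hwX u hu.1]
    ring
  have heX : ∀ j, Eigenpair J X (B.val j) (B.vec j) := fun j => hu.of_orthogonal hu1 (B.eig j)
  have heu : ∀ j, ⟪u, B.vec j⟫ = 0 := fun j =>
    Submodule.mem_orthogonal_singleton_iff_inner_right.1 (B.eig j).1.2
  set t : Fin (finrank ℝ X') → ℝ := fun j => ⟪J (B.vec j), J w⟫ with ht
  have htj : ∀ j, t j = (lb⁻¹ - (B.val j)⁻¹) * ⟪B.vec j, y⟫ := fun j => by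
    have h1 : ⟪B.vec j, y⟫ = ⟪B.vec j, ub⟫ := by
      have h0 : ⟪B.vec j, u⟫ = 0 := by rw [real_inner_comm]; exact heu j
      rw [hy, inner_sub_right, inner_smul_right, h0, hwX _ (heX j).1]
      ring
    have h2 : ⟪J (B.vec j), J p⟫ = (B.val j)⁻¹ * ⟪B.vec j, ub⟫ := by
      rw [← hwX _ (heX j).1, (heX j).2.2 p hpX, ← mul_assoc,
        inv_mul_cancel₀ (heX j).pos.ne', one_mul]
    have h3 : ⟪J (B.vec j), J ub⟫ = lb⁻¹ * ⟪B.vec j, ub⟫ := by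
      have := hub.2.2 _ (hXZ (heX j).1)
      rw [real_inner_comm, real_inner_comm (J (B.vec j))] at this
      rw [this, ← mul_assoc, inv_mul_cancel₀ hub.pos.ne', one_mul]
    simp only [ht]
    rw [hw, map_sub, inner_sub_right, h2, h3, h1]
    ring
  have hts : ∀ j, g ^ 2 * ⟪B.vec j, y⟫ ^ 2 ≤ t j ^ 2 := fun j => by
    rw [htj, mul_pow]
    refine mul_le_mul_of_nonneg_right ?_ (sq_nonneg _)
    rw [← sq_abs (lb⁻¹ - _), abs_sub_comm]
    gcongr
    exact hgap _ _ (heX j) (heu j)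
  set z : V := ∑ j, t j • B.vec j with hz
  have hzX' : z ∈ X' := Submodule.sum_mem _ fun j _ => Submodule.smul_mem _ _ (B.eig j).1
  have hzc : ∀ j, ⟪B.vec j, z⟫ = t j := fun j => B.orthonormal.inner_right_fintype t j
  set z' : V := ∑ j, ((B.val j)⁻¹ * t j) • B.vec j with hz'
  have hz'X' : z' ∈ X' := Submodule.sum_mem _ fun j _ => Submodule.smul_mem _ _ (B.eig j).1
  have hz'c : ∀ j, ⟪B.vec j, z'⟫ = (B.val j)⁻¹ * t j := fun j =>
    B.orthonormal.inner_right_fintype (fun j => (B.val j)⁻¹ * t j) j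
  have hvalge : ∀ j, (B.val j)⁻¹ ≤ lam1⁻¹ := fun j => by
    refine inv_anti₀ hl ?_
    have h1 := hP (B.vec j)
    rw [(B.eig j).norm_sq] at h1
    have h2 : 0 < ‖J (B.vec j)‖ ^ 2 := by
      have : J (B.vec j) ≠ 0 := fun h => (B.eig j).2.1 (hinj (by rw [h, map_zero]))
      have := norm_pos_iff.2 this
      positivity
    exact le_of_mul_le_mul_right h1 h2
  constructor
  · have h1 : lam1 * ‖z‖ ^ 2 ≤ ‖J w‖ ^ 2 := by
      refine norm_sq_le_of_inner_le hl hP (le_of_eq ?_)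
      rw [B.norm_sq hzX', hz, map_sum, inner_sum]
      refine Finset.sum_congr rfl fun j _ => ?_
      rw [hzc, map_smul, inner_smul_right, real_inner_comm]
      simp only [ht]; ring
    have h2 : g ^ 2 * ‖y‖ ^ 2 ≤ ‖z‖ ^ 2 := by
      rw [B.norm_sq hzX', B.norm_sq hyX', Finset.mul_sum]
      exact Finset.sum_le_sum fun j _ => by rw [hzc]; exact hts j
    calc lam1 * g ^ 2 * ‖y‖ ^ 2 = lam1 * (g ^ 2 * ‖y‖ ^ 2) := by ring
      _ ≤ lam1 * ‖z‖ ^ 2 := by gcongr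
      _ ≤ _ := h1
  · have h2 : g ^ 2 * ‖J y‖ ^ 2 ≤ ‖J z‖ ^ 2 := by
      rw [B.norm_J_sq hzX', B.norm_J_sq hyX', Finset.mul_sum]
      refine Finset.sum_le_sum fun j _ => ?_
      rw [hzc]
      have := (inv_pos.2 (B.eig j).pos).le
      calc g ^ 2 * ((B.val j)⁻¹ * ⟪B.vec j, y⟫ ^ 2) = (B.val j)⁻¹ * (g ^ 2 * ⟪B.vec j, y⟫ ^ 2) := by
            ring
        _ ≤ _ := mul_le_mul_of_nonneg_left (hts j) this
    have h3 : g * ‖J y‖ ≤ ‖J z‖ := by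
      refine le_of_sq_le_sq ?_ (norm_nonneg _)
      rw [mul_pow]; exact h2
    have h4 : ‖J z‖ ^ 2 = ⟪J w, J z'⟫ := by
      rw [B.norm_J_sq hzX', hz', map_sum, inner_sum]
      refine Finset.sum_congr rfl fun j _ => ?_
      rw [hzc, map_smul, inner_smul_right, real_inner_comm]
      simp only [ht]; ring
    have h5 : lam1 ^ 2 * ‖J z'‖ ^ 2 ≤ ‖J z‖ ^ 2 := by
      rw [B.norm_J_sq hzX', B.norm_J_sq hz'X', Finset.mul_sum]
      refine Finset.sum_le_sum fun j _ => ?_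
      rw [hzc, hz'c, mul_pow]
      have h6 := (inv_pos.2 (B.eig j).pos).le
      have h7 : (lam1 * (B.val j)⁻¹) ^ 2 ≤ 1 := by
        refine pow_le_one₀ (by positivity) ?_
        calc lam1 * (B.val j)⁻¹ ≤ lam1 * lam1⁻¹ := mul_le_mul_of_nonneg_left (hvalge j) hl.le
          _ = 1 := mul_inv_cancel₀ hl.ne'
      calc lam1 ^ 2 * ((B.val j)⁻¹ * ((B.val j)⁻¹ ^ 2 * t j ^ 2))
          = (lam1 * (B.val j)⁻¹) ^ 2 * ((B.val j)⁻¹ * t j ^ 2) := by ring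
        _ ≤ 1 * ((B.val j)⁻¹ * t j ^ 2) := by gcongr
        _ = _ := one_mul _
    have h5' : lam1 * ‖J z'‖ ≤ ‖J z‖ := by
      refine le_of_sq_le_sq ?_ (norm_nonneg _)
      rw [mul_pow]; exact h5
    have h6 : lam1 * ‖J z‖ ≤ ‖J w‖ := by
      have h7 := h4.le.trans (real_inner_le_norm _ _)
      rcases (norm_nonneg (J z)).eq_or_lt' with h0 | h0
      · rw [h0, mul_zero]; exact norm_nonneg _
      · refine le_of_mul_le_mul_right ?_ h0
        calc lam1 * ‖J z‖ * ‖J z‖ = lam1 * ‖J z‖ ^ 2 := by ring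
          _ ≤ lam1 * (‖J w‖ * ‖J z'‖) := by gcongr
          _ = ‖J w‖ * (lam1 * ‖J z'‖) := by ring
          _ ≤ _ := by gcongr
    calc lam1 * g * ‖J y‖ = lam1 * (g * ‖J y‖) := by ring
      _ ≤ lam1 * ‖J z‖ := by gcongr
      _ ≤ _ := h6

/-- The Aubin–Nitsche bound: `‖J w‖ ≤ η ‖w‖` on the orthogonal complement of `X`. -/
def EtaBound (J : V →L[ℝ] H) (X : Submodule ℝ V) (η : ℝ) : Prop :=
  ∀ w ∈ Xᗮ, ‖J w‖ ≤ η * ‖w‖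

theorem EtaBound.mono {X Y : Submodule ℝ V} {η : ℝ} (h : EtaBound J X η) (hXY : X ≤ Y) :
    EtaBound J Y η := fun w hw => h w (Submodule.orthogonal_le hXY hw)

/-- Smallness of `η` with respect to the eigenvalue `L` and the gap `g`. -/
structure SmallEta (lam1 L g η : ℝ) : Prop where
  pos : 0 < lam1
  le : lam1 ≤ L
  gap_pos : 0 < g
  nonneg : 0 ≤ η
  mul_le_one : 9 * L * η ^ 2 ≤ 1
  le_gap_sq : 4 * η ^ 2 ≤ lam1 * g ^ 2
  le_gap : 24 * η ^ 2 ≤ g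

/-- `(l, u)` is the normalized `k+1`-st eigenpair in `X`, it approximates `L` from above, and the
other eigenvalues stay away from `L`. -/
structure Isolated (J : V →L[ℝ] H) (L g η : ℝ) (k : ℕ) (X : Submodule ℝ V) (l : ℝ) (u : V) :
    Prop where
  eig : Eigenpair J X l u
  norm_eq : ‖u‖ = 1
  gap : ∀ s w, Eigenpair J X s w → ⟪u, w⟫ = 0 → g ≤ |s⁻¹ - L⁻¹|
  le : L ≤ l
  inv_ge : L⁻¹ - η ^ 2 ≤ l⁻¹
  index : k < finrank ℝ X
  val_eq : l = specVal J X (k + 1)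

theorem Eigenpair.neg {X : Submodule ℝ V} {l : ℝ} {u : V} (h : Eigenpair J X l u) :
    Eigenpair J X l (-u) := by
  refine ⟨X.neg_mem h.1, neg_ne_zero.2 h.2.1, fun v hv => ?_⟩
  rw [map_neg, inner_neg_left, inner_neg_left, h.2.2 v hv]
  ring

theorem Isolated.neg {L g η : ℝ} {k : ℕ} {X : Submodule ℝ V} {l : ℝ} {u : V}
    (h : Isolated J L g η k X l u) : Isolated J L g η k X l (-u) where
  eig := h.eig.neg
  norm_eq := by rw [norm_neg, h.norm_eq]
  gap s w hw hw0 := h.gap s w hw (by rwa [inner_neg_left, neg_eq_zero] at hw0)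
  le := h.le
  inv_ge := h.inv_ge
  index := h.index
  val_eq := h.val_eq

theorem eigen_identities {X Z : Submodule ℝ V} (hXZ : X ≤ Z) {l lb : ℝ} {u ub : V}
    (hu : Eigenpair J X l u) (hu1 : ‖u‖ = 1) (hub : Eigenpair J Z lb ub) (hub1 : ‖ub‖ = 1) :
    ‖lb • J ub - l • J u‖ ^ 2 = l * ‖ub - u‖ ^ 2 - (l - lb) ∧
    ‖J (ub - u)‖ ^ 2 = lb⁻¹ * ‖ub - u‖ ^ 2 - (lb⁻¹ - l⁻¹) ∧
    ‖ub - u‖ ^ 2 = 2 * (1 - ⟪u, ub⟫) ∧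
    ‖ub - ⟪u, ub⟫ • u‖ ^ 2 = 1 - ⟪u, ub⟫ ^ 2 ∧
    ‖J (ub - ⟪u, ub⟫ • u)‖ ^ 2 =
      lb⁻¹ * (1 - ⟪u, ub⟫ ^ 2) - ⟪u, ub⟫ ^ 2 * (lb⁻¹ - l⁻¹) := by
  have hl := hu.pos
  have hlb := hub.pos
  have e1 : ‖J u‖ ^ 2 = l⁻¹ := by
    have := hu.norm_sq
    rw [hu1] at this
    field_simp; linarith
  have e2 : ‖J ub‖ ^ 2 = lb⁻¹ := by
    have := hub.norm_sq
    rw [hub1] at this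
    field_simp; linarith
  have e3 : ⟪J ub, J u⟫ = lb⁻¹ * ⟪u, ub⟫ := by
    have := hub.2.2 u (hXZ hu.1)
    rw [real_inner_comm] at this
    rw [this]; field_simp
  have e4 : ⟪ub, u⟫ = ⟪u, ub⟫ := real_inner_comm _ _
  set c := ⟪u, ub⟫
  have e5 : ‖ub - u‖ ^ 2 = 2 * (1 - c) := by
    rw [norm_sub_sq_real, hu1, hub1, e4]; ring
  refine ⟨?_, ?_, e5, ?_, ?_⟩
  · rw [norm_sub_sq_real, norm_smul, norm_smul, mul_pow, mul_pow, real_inner_smul_left,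
      inner_smul_right, e1, e2, e3, e5, Real.norm_eq_abs, Real.norm_eq_abs, sq_abs, sq_abs]
    field_simp; ring
  · rw [map_sub, norm_sub_sq_real, e1, e2, e3, e5]
    ring
  · rw [norm_sub_sq_real, norm_smul, mul_pow, inner_smul_right, e4, hu1, hub1, Real.norm_eq_abs,
      sq_abs]
    ring
  · rw [map_sub, map_smul, norm_sub_sq_real, norm_smul, mul_pow, inner_smul_right, e1, e2, e3,
      Real.norm_eq_abs, sq_abs]
    ring

theorem sub_smul_split {X : Submodule ℝ V} [X.HasOrthogonalProjection] {u ub : V} (hu : u ∈ X)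
    (c : ℝ) : ‖ub - c • u‖ ^ 2 =
      ‖ub - X.starProjection ub‖ ^ 2 + ‖X.starProjection ub - c • u‖ ^ 2 := by
  have h : ⟪ub - X.starProjection ub, X.starProjection ub - c • u⟫ = 0 :=
    Submodule.inner_left_of_mem_orthogonal
      (X.sub_mem (X.starProjection_apply_mem ub) (X.smul_mem c hu))
      (X.sub_starProjection_mem_orthogonal ub)
  have e : ub - c • u = (ub - X.starProjection ub) + (X.starProjection ub - c • u) := by abel
  rw [e, norm_add_sq_real, h]
  ring

end Estimates

section Comparison

variable {V H : Type*} [NormedAddCommGroup V] [InnerProductSpace ℝ V]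
  [NormedAddCommGroup H] [InnerProductSpace ℝ H] {J : V →L[ℝ] H}

theorem SmallEta.le_nine_eighths {lam1 L g η lb : ℝ} (hS : SmallEta lam1 L g η) (hlb : 0 < lb)
    (h : L⁻¹ - η ^ 2 ≤ lb⁻¹) : lb ≤ 9 / 8 * L := by
  have hL : 0 < L := hS.pos.trans_le hS.le
  have h1 : 9 * η ^ 2 ≤ L⁻¹ := by
    rw [← one_div, le_div_iff₀ hL]; linarith [hS.mul_le_one]
  have h2 : 8 / 9 * L⁻¹ ≤ lb⁻¹ := by linarith
  have h3 := mul_le_mul_of_nonneg_right h2 (mul_pos hlb hL).le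
  have h4 : 8 / 9 * L⁻¹ * (lb * L) = 8 / 9 * lb := by field_simp
  have h5 : lb⁻¹ * (lb * L) = L := by field_simp
  rw [h4, h5] at h3
  linarith

theorem norm_sub_starProjection_sq_le {X Z : Submodule ℝ V} [FiniteDimensional ℝ X]
    (hXZ : X ≤ Z) {lb η : ℝ} {ub : V} (hub : Eigenpair J Z lb ub) (hub1 : ‖ub‖ = 1)
    (hη : EtaBound J X η) : ‖ub - X.starProjection ub‖ ^ 2 ≤ lb * η ^ 2 := by
  set w := ub - X.starProjection ub with hw
  have hlb := hub.pos
  have hwo : w ∈ Xᗮ := X.sub_starProjection_mem_orthogonal ub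
  have hwZ : w ∈ Z := Z.sub_mem hub.1 (hXZ (X.starProjection_apply_mem ub))
  have h1 : ‖w‖ ^ 2 = ⟪ub, w⟫ := by
    have h2 := Submodule.inner_right_of_mem_orthogonal (X.starProjection_apply_mem ub) hwo
    have h3 : ub = w + X.starProjection ub := by rw [hw]; abel
    conv_rhs => rw [h3, inner_add_left, h2, real_inner_self_eq_norm_sq, add_zero]
  rw [hub.2.2 w hwZ] at h1
  have h2 := hub.norm_sq
  rw [hub1] at h2
  have h3 := hη w hwo
  have h4 : ‖w‖ ^ 2 ≤ lb * (‖J ub‖ * (η * ‖w‖)) := by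
    rw [h1]
    refine mul_le_mul_of_nonneg_left ((real_inner_le_norm _ _).trans ?_) hlb.le
    gcongr
  rcases (norm_nonneg w).eq_or_lt' with h0 | h0
  · rw [h0]; nlinarith [mul_nonneg hlb.le (sq_nonneg η)]
  · have h5 : ‖w‖ ≤ lb * ‖J ub‖ * η := by
      refine le_of_mul_le_mul_right ?_ h0
      linarith
    calc ‖w‖ ^ 2 ≤ (lb * ‖J ub‖ * η) ^ 2 := by gcongr
      _ = lb * η ^ 2 * (lb * ‖J ub‖ ^ 2) := by ring
      _ = lb * η ^ 2 := by rw [← h2]; ring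

variable [CompleteSpace H] (hinj : Function.Injective J) {lam1 L g η : ℝ}
  (hS : SmallEta lam1 L g η) (hP : ∀ v, lam1 * ‖J v‖ ^ 2 ≤ ‖v‖ ^ 2) {k : ℕ}
include hinj hS hP

theorem Isolated.compare {X Z : Submodule ℝ V} [FiniteDimensional ℝ X] (hη : EtaBound J X η)
    (hXZ : X ≤ Z) {l lb : ℝ} {u ub : V} (hu : Isolated J L g η k X l u)
    (hub : Eigenpair J Z lb ub) (hub1 : ‖ub‖ = 1) (hlb : L ≤ lb) (hlb' : L⁻¹ - η ^ 2 ≤ lb⁻¹) :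
    ‖X.starProjection ub - ⟪u, ub⟫ • u‖ ^ 2 ≤ 3 / 10 * ‖ub - X.starProjection ub‖ ^ 2 ∧
    (∀ ηX, EtaBound J X ηX → ‖J (ub - ⟪u, ub⟫ • u)‖ ≤
      24 / 23 * (1 + 1 / (lam1 * g)) * (ηX * ‖ub - X.starProjection ub‖)) ∧
    (9 / 10) ^ 2 ≤ ⟪u, ub⟫ ^ 2 := by
  have hL : 0 < L := hS.pos.trans_le hS.le
  have hg := hS.gap_pos
  have hl1 := hS.pos
  have hg' : 23 / 24 * g ≤ g - η ^ 2 := by linarith [hS.le_gap]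
  have hg'0 : 0 < g - η ^ 2 := by linarith
  have hinv : lb⁻¹ ≤ L⁻¹ := inv_anti₀ hL hlb
  obtain ⟨hA, hB⟩ := eigen_projection_estimate hinj hS.pos hP hu.eig hu.norm_eq hXZ hub hg'0
    (fun s w hw hw0 => by
      have h1 := hu.gap s w hw hw0
      have h2 := abs_sub_le s⁻¹ lb⁻¹ L⁻¹
      have h3 : |lb⁻¹ - L⁻¹| ≤ η ^ 2 := abs_le.2 ⟨by linarith, by linarith [sq_nonneg η]⟩
      linarith)
  have hsplit := sub_smul_split (ub := ub) hu.eig.1 ⟪u, ub⟫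
  have hid := eigen_identities hXZ hu.eig hu.norm_eq hub hub1
  have hw8 := norm_sub_starProjection_sq_le hXZ hub hub1 hη
  set w := ub - X.starProjection ub with hw
  set y := X.starProjection ub - ⟪u, ub⟫ • u with hy
  have hwo : w ∈ Xᗮ := X.sub_starProjection_mem_orthogonal ub
  have hy1 : ‖y‖ ^ 2 ≤ 3 / 10 * ‖w‖ ^ 2 := by
    have h1 : ‖J w‖ ^ 2 ≤ (η * ‖w‖) ^ 2 := by gcongr; exact hη w hwo
    have h2 : (23 / 24 * g) ^ 2 ≤ (g - η ^ 2) ^ 2 := by gcongr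
    have h3 : lam1 * (23 / 24 * g) ^ 2 * ‖y‖ ^ 2 ≤ lam1 * (g - η ^ 2) ^ 2 * ‖y‖ ^ 2 := by gcongr
    have h4 : 4 * η ^ 2 * ‖w‖ ^ 2 ≤ lam1 * g ^ 2 * ‖w‖ ^ 2 :=
      mul_le_mul_of_nonneg_right hS.le_gap_sq (sq_nonneg _)
    have h5 : 0 < lam1 * g ^ 2 := by positivity
    refine le_of_mul_le_mul_left ?_ h5
    nlinarith [mul_nonneg h5.le (sq_nonneg ‖w‖)]
  refine ⟨hy1, fun ηX hηX => ?_, ?_⟩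
  · have h1 : ub - ⟪u, ub⟫ • u = w + y := by rw [hw, hy]; abel
    have h2 : ‖J w‖ ≤ ηX * ‖w‖ := hηX w hwo
    have h3 : ‖J y‖ ≤ 24 / 23 * (1 / (lam1 * g)) * ‖J w‖ := by
      have h4 : lam1 * (23 / 24 * g) * ‖J y‖ ≤ lam1 * (g - η ^ 2) * ‖J y‖ := by gcongr
      have h5 : 0 < lam1 * g := by positivity
      rw [mul_one_div, div_mul_eq_mul_div, le_div_iff₀ h5]
      linarith
    rw [h1, map_add]
    have h6 : 0 ≤ 24 / 23 * (1 + 1 / (lam1 * g)) := by positivity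
    calc ‖J w + J y‖ ≤ ‖J w‖ + ‖J y‖ := norm_add_le _ _
      _ ≤ 24 / 23 * (1 + 1 / (lam1 * g)) * ‖J w‖ := by
        have := norm_nonneg (J w)
        linarith
      _ ≤ _ := mul_le_mul_of_nonneg_left h2 h6
  · have h1 : lb * η ^ 2 ≤ 1 / 8 := by
      have h2 := hS.le_nine_eighths hub.pos hlb'
      have h3 := mul_le_mul_of_nonneg_right h2 (sq_nonneg η)
      have := hS.mul_le_one
      linarith
    have h4 := hid.2.2.2.1
    rw [hsplit] at h4
    linarith

theorem Isolated.compare_pos {X Z : Submodule ℝ V} [FiniteDimensional ℝ X] (hη : EtaBound J X η)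
    (hXZ : X ≤ Z) {l lb : ℝ} {u ub : V} (hu : Isolated J L g η k X l u)
    (hub : Eigenpair J Z lb ub) (hub1 : ‖ub‖ = 1) (hlb : L ≤ lb) (hlb' : L⁻¹ - η ^ 2 ≤ lb⁻¹)
    (hll : lb ≤ l) (hc : 0 ≤ ⟪u, ub⟫) {ηX : ℝ} (hηX0 : 0 ≤ ηX) (hηX : EtaBound J X ηX) :
    ‖lb • J ub - l • J u‖ ≤ 2 * L * (1 + 1 / (lam1 * g)) * ηX * ‖ub - u‖ ∧
    ‖J (ub - u)‖ ≤ 2 * (1 + 1 / (lam1 * g)) * ηX * ‖ub - u‖ := by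
  obtain ⟨-, hJr, hc2⟩ := hu.compare hinj hS hP hη hXZ hub hub1 hlb hlb'
  specialize hJr ηX hηX
  obtain ⟨i1, i2, i3, i4, i5⟩ := eigen_identities hXZ hu.eig hu.norm_eq hub hub1
  have hsplit := sub_smul_split (ub := ub) hu.eig.1 ⟪u, ub⟫
  have hL : 0 < L := hS.pos.trans_le hS.le
  have hg := hS.gap_pos
  have hl1 := hS.pos
  have hl := hu.eig.pos
  have hlbp := hub.pos
  set c := ⟪u, ub⟫ with hcdef
  set r := ub - c • u with hr
  set w := ub - X.starProjection ub with hw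
  have hc9 : 9 / 10 ≤ c := le_of_sq_le_sq hc2 hc
  have hc1 : c ≤ 1 := by nlinarith [sq_nonneg ‖r‖]
  have hwe : ‖w‖ ≤ ‖ub - u‖ := by
    refine le_of_sq_le_sq ?_ (norm_nonneg _)
    nlinarith [sq_nonneg ‖X.starProjection ub - c • u‖]
  have hK : 0 ≤ 24 / 23 * (1 + 1 / (lam1 * g)) := by positivity
  have hK1 : 0 ≤ 1 + 1 / (lam1 * g) := by positivity
  have hr' : ‖J r‖ ≤ 24 / 23 * (1 + 1 / (lam1 * g)) * (ηX * ‖ub - u‖) :=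
    hJr.trans (mul_le_mul_of_nonneg_left (by gcongr) hK)
  have hcc : 2 * c ^ 2 * (1 - c) ≤ 1 - c ^ 2 := by nlinarith [mul_nonneg hc (sub_nonneg.2 hc1)]
  have hnn : 0 ≤ (1 + 1 / (lam1 * g)) * (ηX * ‖ub - u‖) := by positivity
  set K := 1 + 1 / (lam1 * g)
  have hr2 : ‖J r‖ ≤ 24 / 23 * (K * (ηX * ‖ub - u‖)) := by linarith
  clear hJr hr' hsplit hwe
  constructor
  · have h1 : c ^ 2 * ‖lb • J ub - l • J u‖ ^ 2 ≤ lb * l * ‖J r‖ ^ 2 := by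
      have e : lb * l * ‖J r‖ ^ 2 = l * (1 - c ^ 2) - c ^ 2 * (l - lb) := by
        rw [i5]; field_simp
      have := mul_le_mul_of_nonneg_left hcc hl.le
      rw [e, i1, i3]
      linarith
    have h2 : lb * l ≤ (9 / 8 * L) ^ 2 := by
      have h3 := hS.le_nine_eighths hl hu.inv_ge
      have h4 := hll.trans h3
      rw [sq]
      gcongr
    have h5 : (c * ‖lb • J ub - l • J u‖) ^ 2 ≤ (9 / 8 * L * ‖J r‖) ^ 2 := by
      rw [mul_pow, mul_pow]
      exact h1.trans (by gcongr)
    have h6 := le_of_sq_le_sq h5 (by positivity)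
    have h7 : 9 / 10 * ‖lb • J ub - l • J u‖ ≤ c * ‖lb • J ub - l • J u‖ := by gcongr
    have h8 := mul_le_mul_of_nonneg_left hr2 hL.le
    have h9 := mul_nonneg hL.le hnn
    calc ‖lb • J ub - l • J u‖ ≤ 2 * (L * (K * (ηX * ‖ub - u‖))) := by linarith
      _ = _ := by ring
  · have h1 : c ^ 2 * ‖J (ub - u)‖ ^ 2 ≤ ‖J r‖ ^ 2 := by
      have := mul_le_mul_of_nonneg_left hcc (inv_pos.2 hlbp).le
      rw [i5, i2, i3]
      linarith
    have h5 : c * ‖J (ub - u)‖ ≤ ‖J r‖ := by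
      refine le_of_sq_le_sq ?_ (norm_nonneg _)
      rw [mul_pow]; exact h1
    have h7 : 9 / 10 * ‖J (ub - u)‖ ≤ c * ‖J (ub - u)‖ := by gcongr
    calc ‖J (ub - u)‖ ≤ 2 * (K * (ηX * ‖ub - u‖)) := by linarith
      _ = _ := by ring

theorem Isolated.norm_sub_exact_le {X : Submodule ℝ V} [FiniteDimensional ℝ X] {ηX : ℝ}
    (hηX : EtaBound J X ηX) {l : ℝ} {u u0 : V} (hu : Isolated J L g η k X l u)
    (hu0 : Eigenpair J ⊤ L u0) (hu01 : ‖u0‖ = 1) (hc : 0 ≤ ⟪u, u0⟫) :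
    ‖u0 - u‖ ^ 2 ≤ 2 * (1 + 1 / (lam1 * g ^ 2) * ηX ^ 2) * ‖u0 - X.starProjection u0‖ ^ 2 := by
  obtain ⟨hA, -⟩ := eigen_projection_estimate hinj hS.pos hP hu.eig hu.norm_eq le_top hu0
    hS.gap_pos hu.gap
  obtain ⟨-, -, i3, i4, -⟩ := eigen_identities le_top hu.eig hu.norm_eq hu0 hu01
  have hsplit := sub_smul_split (ub := u0) hu.eig.1 ⟪u, u0⟫
  have hg := hS.gap_pos
  have hl1 := hS.pos
  set w := u0 - X.starProjection u0 with hw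
  set y := X.starProjection u0 - ⟪u, u0⟫ • u with hy
  have hwo : w ∈ Xᗮ := X.sub_starProjection_mem_orthogonal u0
  have h1 : ‖J w‖ ^ 2 ≤ (ηX * ‖w‖) ^ 2 := by gcongr; exact hηX w hwo
  have h2 : ‖y‖ ^ 2 ≤ 1 / (lam1 * g ^ 2) * ηX ^ 2 * ‖w‖ ^ 2 := by
    rw [mul_assoc, ← mul_pow, one_div_mul_eq_div, le_div_iff₀ (by positivity)]
    linarith
  set c := ⟪u, u0⟫
  have hc1 : c ≤ 1 := by nlinarith [sq_nonneg ‖u0 - c • u‖]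
  nlinarith [mul_nonneg hc (sub_nonneg.2 hc1)]

theorem Isolated.norm_sub_succ_le {X Y : Submodule ℝ V} [FiniteDimensional ℝ X]
    [FiniteDimensional ℝ Y] (hη : EtaBound J X η) (hXY : X ≤ Y) {l lb : ℝ} {u ub u0 : V}
    (hu : Isolated J L g η k X l u) (hub : Isolated J L g η k Y lb ub)
    (hu0 : Eigenpair J ⊤ L u0) (hu01 : ‖u0‖ = 1) (hc : 0 ≤ ⟪u, ub⟫) :
    ‖ub - u‖ ≤ 2 * ‖u0 - X.starProjection u0‖ := by
  have hg := hS.gap_pos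
  have hl1 := hS.pos
  obtain ⟨hA, -⟩ := eigen_projection_estimate hinj hS.pos hP hub.eig hub.norm_eq le_top hu0
    hS.gap_pos hub.gap
  obtain ⟨-, -, hcY⟩ := hub.compare hinj hS hP (hη.mono hXY) le_top hu0 hu01 le_rfl
    (by linarith [sq_nonneg η])
  obtain ⟨hyb, -, hc2⟩ := hu.compare hinj hS hP hη hXY hub.eig hub.norm_eq hub.le hub.inv_ge
  obtain ⟨-, -, i3, i4, -⟩ := eigen_identities hXY hu.eig hu.norm_eq hub.eig hub.norm_eq
  have hsplit := sub_smul_split (ub := ub) hu.eig.1 ⟪u, ub⟫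
  set w := u0 - X.starProjection u0 with hw
  set wY := u0 - Y.starProjection u0 with hwY
  set y := Y.starProjection u0 - ⟪ub, u0⟫ • ub with hy
  set wb := ub - X.starProjection ub with hwb
  have hcomp : ∀ v, X.starProjection (Y.starProjection v) = X.starProjection v := fun v => by
    have h1 : v - Y.starProjection v ∈ Xᗮ :=
      Submodule.orthogonal_le hXY (Y.sub_starProjection_mem_orthogonal v)
    have h2 := (X.starProjection_apply_eq_zero_iff).2 h1
    rw [map_sub, sub_eq_zero] at h2
    exact h2.symm
  have hYX : ∀ v, Y.starProjection (X.starProjection v) = X.starProjection v := fun v =>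
    Y.starProjection_eq_self_iff.2 (hXY (X.starProjection_apply_mem v))
  have hwYw : ‖wY‖ ≤ ‖w‖ := by
    have h1 : wY = Yᗮ.starProjection w := by
      rw [Submodule.starProjection_orthogonal', hw]
      simp [hYX, hwY]
    rw [h1]
    exact Yᗮ.norm_starProjection_apply_le _
  have hylew : ‖y‖ ≤ 1 / 2 * ‖w‖ := by
    have h1 : ‖J wY‖ ^ 2 ≤ (η * ‖wY‖) ^ 2 := by
      gcongr
      exact hη.mono hXY wY (Y.sub_starProjection_mem_orthogonal u0)
    have h2 : 4 * η ^ 2 * ‖wY‖ ^ 2 ≤ lam1 * g ^ 2 * ‖wY‖ ^ 2 :=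
      mul_le_mul_of_nonneg_right hS.le_gap_sq (sq_nonneg _)
    have h3 : ‖wY‖ ^ 2 ≤ ‖w‖ ^ 2 := by gcongr
    refine le_of_sq_le_sq ?_ (by positivity)
    have h5 : 0 < lam1 * g ^ 2 := by positivity
    refine le_of_mul_le_mul_left ?_ h5
    nlinarith [mul_le_mul_of_nonneg_left h3 h5.le]
  have hPX : ‖Y.starProjection u0 - X.starProjection u0‖ ≤ ‖w‖ := by
    have h1 : Y.starProjection u0 - X.starProjection u0 = Y.starProjection w := by
      rw [hw, map_sub, hYX]
    rw [h1]
    exact Y.norm_starProjection_apply_le _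
  have hwb1 : |⟪ub, u0⟫| * ‖wb‖ ≤ 3 / 2 * ‖w‖ := by
    have h1 : ⟪ub, u0⟫ • wb = (Y.starProjection u0 - X.starProjection u0) - Xᗮ.starProjection y := by
      rw [Submodule.starProjection_orthogonal', hwb, hy]
      simp [hcomp, smul_sub]
      abel
    rw [← Real.norm_eq_abs, ← norm_smul, h1]
    have h2 := Xᗮ.norm_starProjection_apply_le y
    have h3 := norm_sub_le (Y.starProjection u0 - X.starProjection u0) (Xᗮ.starProjection y)
    linarith
  have hcY' : 9 / 10 ≤ |⟪ub, u0⟫| := by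
    refine le_of_sq_le_sq ?_ (abs_nonneg _)
    rw [sq_abs]; exact hcY
  have hwb2 : 9 / 10 * ‖wb‖ ≤ 3 / 2 * ‖w‖ := by
    have : 9 / 10 * ‖wb‖ ≤ |⟪ub, u0⟫| * ‖wb‖ := by gcongr
    linarith
  have hwb3 : ‖wb‖ ^ 2 ≤ (5 / 3 * ‖w‖) ^ 2 := by gcongr; linarith
  set c := ⟪u, ub⟫
  have hc9 : 9 / 10 ≤ c := le_of_sq_le_sq hc2 hc
  have hc1 : c ≤ 1 := by nlinarith [sq_nonneg ‖ub - c • u‖]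
  refine le_of_sq_le_sq ?_ (by positivity)
  have h1 : 19 / 10 * (1 - c) ≤ 1 - c ^ 2 := by nlinarith
  nlinarith [sq_nonneg ‖w‖]

end Comparison

section Weyl

variable {V H : Type*} [NormedAddCommGroup V] [InnerProductSpace ℝ V] [CompleteSpace V]
  [NormedAddCommGroup H] [InnerProductSpace ℝ H] [CompleteSpace H] {J : V →L[ℝ] H}

theorem EtaBound.norm_adjoint_sub_le {X : Submodule ℝ V} [FiniteDimensional ℝ X] {η : ℝ}
    (hη0 : 0 ≤ η) (hη : EtaBound J X η) (f : H) :
    ‖J.adjoint f - X.starProjection (J.adjoint f)‖ ≤ η * ‖f‖ := by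
  set v := J.adjoint f with hv
  set w := v - X.starProjection v with hw
  have hwo : w ∈ Xᗮ := X.sub_starProjection_mem_orthogonal v
  have h1 : ‖w‖ ^ 2 = ⟪f, J w⟫ := by
    have h2 := Submodule.inner_right_of_mem_orthogonal (X.starProjection_apply_mem v) hwo
    rw [← ContinuousLinearMap.adjoint_inner_left, ← hv]
    have h3 : v = w + X.starProjection v := by rw [hw]; abel
    conv_rhs => rw [h3, inner_add_left, h2, real_inner_self_eq_norm_sq, add_zero]
  have h2 : ‖w‖ ^ 2 ≤ ‖f‖ * (η * ‖w‖) := by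
    rw [h1]
    exact (real_inner_le_norm _ _).trans (by gcongr; exact hη w hwo)
  rcases (norm_nonneg w).eq_or_lt' with h0 | h0
  · rw [h0]; positivity
  · refine le_of_mul_le_mul_right ?_ h0
    linarith

/-- A Weyl-type inequality for the eigenvalues in `X`. -/
theorem exists_subspace_of_etaBound (hinj : Function.Injective J) {X W : Submodule ℝ V}
    [FiniteDimensional ℝ X] {η L : ℝ} (hη0 : 0 ≤ η) (hη : EtaBound J X η) (hL : 0 < L)
    (hsm : η ^ 2 < L⁻¹) (hW : ∀ v ∈ W, ‖v‖ ^ 2 ≤ L * ‖J v‖ ^ 2) :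
    ∃ W' ≤ X, finrank ℝ W' = finrank ℝ W ∧
      ∀ v ∈ W', (L⁻¹ - η ^ 2) * ‖v‖ ^ 2 ≤ ‖J v‖ ^ 2 := by
  set κ := L⁻¹ - η ^ 2 with hκ
  have hκ0 : 0 < κ := by rw [hκ]; linarith
  let R : V →ₗ[ℝ] V := (X.starProjection ∘L J.adjoint ∘L J : V →L[ℝ] V)
  have hR : ∀ v, R v = X.starProjection (J.adjoint (J v)) := fun v => rfl
  have key : ∀ v ∈ W, κ * ‖J v‖ ^ 2 ≤ ‖R v‖ ^ 2 := fun v hv => by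
    rw [hR]
    set q := J.adjoint (J v) with hq
    have h1 : ‖q‖ ^ 2 = ‖X.starProjection q‖ ^ 2 + ‖q - X.starProjection q‖ ^ 2 := by
      have h2 := Submodule.inner_right_of_mem_orthogonal (X.starProjection_apply_mem q)
        (X.sub_starProjection_mem_orthogonal q)
      have h3 := norm_add_sq_real (X.starProjection q) (q - X.starProjection q)
      rw [h2, add_sub_cancel] at h3
      linarith
    have h2 : ‖q - X.starProjection q‖ ^ 2 ≤ (η * ‖J v‖) ^ 2 := by
      gcongr
      exact hη.norm_adjoint_sub_le hη0 (J v)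
    have h3 : L⁻¹ * ‖J v‖ ^ 2 ≤ ‖q‖ ^ 2 := by
      have h4 : ‖J v‖ ^ 2 = ⟪q, v⟫ := by
        rw [hq, ContinuousLinearMap.adjoint_inner_left, real_inner_self_eq_norm_sq]
      have h5 := h4.le.trans (real_inner_le_norm q v)
      have h6 := hW v hv
      rw [inv_mul_le_iff₀ hL]
      rcases (norm_nonneg (J v)).eq_or_lt' with h0 | h0
      · rw [h0, zero_pow two_ne_zero]; positivity
      · have h7 : 0 < ‖J v‖ ^ 2 := by positivity
        refine le_of_mul_le_mul_right ?_ h7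
        calc ‖J v‖ ^ 2 * ‖J v‖ ^ 2 ≤ (‖q‖ * ‖v‖) * (‖q‖ * ‖v‖) := by gcongr
          _ = ‖q‖ ^ 2 * ‖v‖ ^ 2 := by ring
          _ ≤ ‖q‖ ^ 2 * (L * ‖J v‖ ^ 2) := by gcongr
          _ = _ := by ring
    rw [hκ]
    linarith
  refine ⟨W.map R, ?_, ?_, ?_⟩
  · rintro _ ⟨v, -, rfl⟩
    exact X.starProjection_apply_mem _
  · have hRinj : Function.Injective (R.domRestrict W) := by
      rw [← LinearMap.ker_eq_bot, LinearMap.ker_eq_bot']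
      intro v hv
      have h1 := key v v.2
      rw [show R v = 0 from hv] at h1
      have h2 : ‖J v‖ ^ 2 ≤ 0 := by
        by_contra! h3
        have := mul_pos hκ0 h3
        simp at h1
        linarith
      have h3 : J v = 0 := by
        rw [← norm_eq_zero]; nlinarith [norm_nonneg (J v)]
      exact Subtype.ext (hinj (by rw [h3]; simp))
    rw [← LinearMap.range_domRestrict]
    exact LinearMap.finrank_range_of_inj hRinj
  · rintro _ ⟨v, hv, rfl⟩
    have h1 := key v hv
    have h2 : ‖R v‖ ^ 2 = ⟪J v, J (R v)⟫ := by
      have h3 := Submodule.inner_right_of_mem_orthogonal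
        (X.starProjection_apply_mem (J.adjoint (J v)))
        (X.sub_starProjection_mem_orthogonal (J.adjoint (J v)))
      rw [inner_sub_right, ← hR, real_inner_self_eq_norm_sq, sub_eq_zero,
        ContinuousLinearMap.adjoint_inner_right] at h3
      rw [← h3, real_inner_comm]
    have h5 := h2.le.trans (real_inner_le_norm _ _)
    rcases (norm_nonneg (R v)).eq_or_lt' with h0 | h0
    · change κ * ‖R v‖ ^ 2 ≤ _
      rw [h0]; simp
    · have h7 : 0 < ‖R v‖ ^ 2 := by positivity
      refine le_of_mul_le_mul_right ?_ h7
      calc κ * ‖R v‖ ^ 2 * ‖R v‖ ^ 2 = κ * (‖R v‖ ^ 2 * ‖R v‖ ^ 2) := by ring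
        _ ≤ κ * ((‖J v‖ * ‖J (R v)‖) * (‖J v‖ * ‖J (R v)‖)) := by gcongr
        _ = (κ * ‖J v‖ ^ 2) * ‖J (R v)‖ ^ 2 := by ring
        _ ≤ ‖R v‖ ^ 2 * ‖J (R v)‖ ^ 2 := by gcongr
        _ = _ := by ring

omit [CompleteSpace V] in
theorem specVal_anti (hinj : Function.Injective J) {X Y : Submodule ℝ V} [FiniteDimensional ℝ Y]
    (hXY : X ≤ Y) {k : ℕ} (hk : k < finrank ℝ X) :
    specVal J Y (k + 1) ≤ specVal J X (k + 1) := by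
  have := Submodule.finiteDimensional_of_le hXY
  obtain ⟨B⟩ := exists_eigenBasis J hinj X
  obtain ⟨C⟩ := exists_eigenBasis J hinj Y
  have hk' : k < finrank ℝ Y := hk.trans_le (Submodule.finrank_mono hXY)
  have hB : specVal J X (k + 1) = _ := B.specVal_eq ⟨k, hk⟩
  have hC : specVal J Y (k + 1) = _ := C.specVal_eq ⟨k, hk'⟩
  rw [hB, hC]
  exact C.val_le_of_le B hXY _ _ le_rfl

/-- The gap condition on eigenvalues other than the `k+1`-st one. -/
def GapBound (J : V →L[ℝ] H) (X : Submodule ℝ V) (L g : ℝ) (k : ℕ) : Prop :=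
  ∀ j, j < finrank ℝ X → j ≠ k → g ≤ |(specVal J X (j + 1))⁻¹ - L⁻¹|

theorem isolated_of_between (hinj : Function.Injective J) {VH X Y W : Submodule ℝ V}
    [FiniteDimensional ℝ Y] (hHX : VH ≤ X) (hXY : X ≤ Y) {lam1 L g η : ℝ}
    (hS : SmallEta lam1 L g η) (hη : EtaBound J VH η) {k : ℕ} (hWd : finrank ℝ W = k + 1)
    (hW : ∀ v ∈ W, ‖v‖ ^ 2 ≤ L * ‖J v‖ ^ 2) (hgH : GapBound J VH L g k)
    (hgY : GapBound J Y L g k) (hLY : k < finrank ℝ Y → L ≤ specVal J Y (k + 1)) :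
    k < finrank ℝ VH ∧
    ∀ l u, Eigenpair J X l u → ‖u‖ = 1 →
      (l = specVal J X (k + 1) ∨ ∀ s w, Eigenpair J X s w → |l⁻¹ - L⁻¹| ≤ |s⁻¹ - L⁻¹|) →
      Isolated J L g η k X l u := by
  have hL : 0 < L := hS.pos.trans_le hS.le
  have hfX := Submodule.finiteDimensional_of_le hXY
  have hfH := Submodule.finiteDimensional_of_le hHX
  have hηL : 9 * η ^ 2 ≤ L⁻¹ := by
    rw [← one_div, le_div_iff₀ hL]; linarith [hS.mul_le_one]
  have hLi := inv_pos.2 hL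
  obtain ⟨W', hW'H, hW'd, hW'⟩ := exists_subspace_of_etaBound hinj hS.nonneg hη hL
    (by linarith [sq_nonneg η]) hW
  have hkH : k < finrank ℝ VH := by
    have := Submodule.finrank_mono hW'H
    omega
  refine ⟨hkH, fun l u hu hu1 hlu => ?_⟩
  have hnX : finrank ℝ VH ≤ finrank ℝ X := Submodule.finrank_mono hHX
  have hnY : finrank ℝ X ≤ finrank ℝ Y := Submodule.finrank_mono hXY
  obtain ⟨A⟩ := exists_eigenBasis J hinj VH
  obtain ⟨B⟩ := exists_eigenBasis J hinj X
  obtain ⟨C⟩ := exists_eigenBasis J hinj Y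
  set kX : Fin (finrank ℝ X) := ⟨k, by omega⟩ with hkX
  have hA := A.le_inv_val_of_finrank hW'H hW' ⟨k, hkH⟩ (by simp only; omega)
  have hg := hS.gap_pos
  have hgη := hS.le_gap
  have hAB : ∀ j (hj : j < finrank ℝ VH),
      (A.val ⟨j, hj⟩)⁻¹ ≤ (B.val ⟨j, by omega⟩)⁻¹ := fun j hj =>
    inv_anti₀ (B.eig _).pos (B.val_le_of_le A hHX _ _ le_rfl)
  have hBC : ∀ j (hj : j < finrank ℝ X), (B.val ⟨j, hj⟩)⁻¹ ≤ (C.val ⟨j, by omega⟩)⁻¹ := fun j hj =>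
    inv_anti₀ (C.eig _).pos (C.val_le_of_le B hXY _ _ le_rfl)
  have hCk : (C.val ⟨k, by omega⟩)⁻¹ ≤ L⁻¹ := by
    have := hLY (by omega)
    rw [C.specVal_eq ⟨k, by omega⟩] at this
    exact inv_anti₀ hL this
  have hBk1 : L⁻¹ - η ^ 2 ≤ (B.val kX)⁻¹ := hA.trans (hAB k hkH)
  have hBk2 : (B.val kX)⁻¹ ≤ L⁻¹ := (hBC k _).trans hCk
  have hBk : |(B.val kX)⁻¹ - L⁻¹| ≤ η ^ 2 := abs_le.2 ⟨by linarith, by linarith [sq_nonneg η]⟩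
  have hgap : ∀ j, j ≠ kX → g ≤ |(B.val j)⁻¹ - L⁻¹| := fun j hj => by
    have hjk : (j : ℕ) ≠ k := fun h => hj (Fin.ext h)
    rcases lt_or_gt_of_ne hjk with h | h
    · have h1 := hgH j (by omega) hjk
      rw [A.specVal_eq ⟨j, by omega⟩] at h1
      have h2 : (A.val ⟨k, hkH⟩)⁻¹ ≤ (A.val ⟨j, by omega⟩)⁻¹ :=
        inv_anti₀ (A.eig _).pos (A.mono (Fin.le_def.2 h.le))
      have h3 := hAB j (by omega)
      have h4 : L⁻¹ + g ≤ (A.val ⟨j, by omega⟩)⁻¹ := by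
        rcases le_abs.1 h1 with h5 | h5 <;> linarith
      exact le_abs.2 (Or.inl (by linarith))
    · have h1 := hgY j (by omega) hjk
      rw [C.specVal_eq ⟨j, by omega⟩] at h1
      have h2 : (C.val ⟨j, by omega⟩)⁻¹ ≤ (C.val ⟨k, by omega⟩)⁻¹ :=
        inv_anti₀ (C.eig _).pos (C.mono (Fin.le_def.2 h.le))
      have h3 := hBC j j.2
      have h4 : (C.val ⟨j, by omega⟩)⁻¹ ≤ L⁻¹ - g := by
        rcases le_abs.1 h1 with h5 | h5 <;> linarith
      exact le_abs.2 (Or.inr (by linarith))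
  have hsep : ∀ s w, Eigenpair J X s w → |s⁻¹ - L⁻¹| < g →
      s = B.val kX ∧ w = ⟪B.vec kX, w⟫ • B.vec kX ∧ ⟪B.vec kX, w⟫ ≠ 0 := fun s w hw hs => by
    obtain ⟨j, hj, hjw⟩ := B.exists_val_eq hw
    have hjk : j = kX := by
      by_contra hne
      have := hgap j hne
      rw [hj] at this
      linarith
    subst hjk
    refine ⟨hj.symm, ?_, hjw⟩
    conv_lhs => rw [B.expand w hw.1]
    refine Finset.sum_eq_single _ (fun i _ hi => ?_) (by simp)
    have hne : B.val i ≠ s := fun h => by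
      have := hgap i hi
      rw [h] at this
      linarith
    rw [(B.eig i).inner_eq_zero hw hne, zero_smul]
  have hls : |l⁻¹ - L⁻¹| < g := by
    rcases hlu with h | h
    · rw [h, show k = (kX : ℕ) from rfl, B.specVal_eq]
      linarith [sq_nonneg η]
    · have := h _ _ (B.eig kX)
      linarith [sq_nonneg η]
  obtain ⟨hl, huv, hu0⟩ := hsep l u hu hls
  refine ⟨hu, hu1, fun s w hw hwu => ?_, ?_, ?_, by omega, ?_⟩
  · by_contra! hs
    obtain ⟨-, hwv, hw0⟩ := hsep s w hw hs
    rw [huv, hwv, real_inner_smul_left, inner_smul_right, real_inner_self_eq_norm_sq,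
      B.orthonormal.1] at hwu
    simp [hu0, hw0] at hwu
  · rw [hl]
    exact (inv_le_inv₀ (B.eig kX).pos hL).1 hBk2
  · rw [hl]; exact hBk1
  · rw [hl, ← B.specVal_eq]

end Weyl

section ProjDist

variable {V : Type*} [NormedAddCommGroup V] [InnerProductSpace ℝ V]

/-- The distance of two vectors up to sign. -/
noncomputable def signDist (u v : V) : ℝ := min ‖u - v‖ ‖u + v‖

omit [InnerProductSpace ℝ V] in
theorem signDist_nonneg (u v : V) : 0 ≤ signDist u v := le_min (norm_nonneg _) (norm_nonneg _)

omit [InnerProductSpace ℝ V] in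
theorem signDist_neg_left (u v : V) : signDist (-u) v = signDist u v := by
  rw [signDist, signDist, min_comm, ← norm_neg (-u + v), ← norm_neg (-u - v)]
  congr 2 <;> abel

omit [InnerProductSpace ℝ V] in
theorem signDist_triangle (u v w : V) : signDist u w ≤ signDist u v + signDist v w := by
  have h1 := norm_sub_le_norm_sub_add_norm_sub u v w
  have h2 : ‖u + w‖ ≤ ‖u - v‖ + ‖v + w‖ := by
    rw [show u + w = (u - v) + (v + w) by abel]; exact norm_add_le _ _
  have h3 : ‖u + w‖ ≤ ‖u + v‖ + ‖v - w‖ := by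
    rw [show u + w = (u + v) - (v - w) by abel]; exact norm_sub_le _ _
  have h4 : ‖u - w‖ ≤ ‖u + v‖ + ‖v + w‖ := by
    rw [show u - w = (u + v) - (v + w) by abel]; exact norm_sub_le _ _
  simp only [signDist]
  rcases min_choice ‖u - v‖ ‖u + v‖ with h | h <;> rcases min_choice ‖v - w‖ ‖v + w‖ with h' | h' <;>
    rw [h, h']
  · exact (min_le_left _ _).trans h1
  · exact (min_le_right _ _).trans h2
  · exact (min_le_right _ _).trans h3
  · exact (min_le_left _ _).trans h4

theorem signDist_of_nonneg {u v : V} (h : 0 ≤ ⟪v, u⟫) : signDist u v = ‖u - v‖ := by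
  refine min_eq_left (le_of_sq_le_sq ?_ (norm_nonneg _))
  rw [norm_sub_sq_real, norm_add_sq_real, real_inner_comm]
  linarith

theorem exists_sign (u v : V) : ∃ u', (u' = u ∨ u' = -u) ∧ 0 ≤ ⟪v, u'⟫ ∧
    signDist u v = ‖u' - v‖ := by
  rcases le_total 0 ⟪v, u⟫ with h | h
  · exact ⟨u, Or.inl rfl, h, signDist_of_nonneg h⟩
  · have h' : 0 ≤ ⟪v, -u⟫ := by rw [inner_neg_right]; linarith
    exact ⟨-u, Or.inr rfl, h', by rw [← signDist_neg_left, signDist_of_nonneg h']⟩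

end ProjDist

section Scheme

variable {V H : Type*} [NormedAddCommGroup V] [InnerProductSpace ℝ V] [CompleteSpace V]
  [NormedAddCommGroup H] [InnerProductSpace ℝ H] [CompleteSpace H] {J : V →L[ℝ] H}

omit [CompleteSpace V] [CompleteSpace H] in
theorem Isolated.of_sign {L g η : ℝ} {k : ℕ} {X : Submodule ℝ V} {l : ℝ} {u u' : V}
    (h : Isolated J L g η k X l u) (hu : u' = u ∨ u' = -u) : Isolated J L g η k X l u' := by
  rcases hu with rfl | rfl
  · exact h
  · exact h.neg

omit [CompleteSpace V] in
theorem correction_contraction (hinj : Function.Injective J) {lam1 L g η : ℝ}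
    (hS : SmallEta lam1 L g η) (hP : ∀ v, lam1 * ‖J v‖ ^ 2 ≤ ‖v‖ ^ 2) {k : ℕ}
    {VH X0 X1 Y : Submodule ℝ V} [FiniteDimensional ℝ Y] (hη : EtaBound J VH η)
    (hH0 : VH ≤ X0) (hH1 : VH ≤ X1) (h0Y : X0 ≤ Y) (h1Y : X1 ≤ Y) {l0 l1 lb : ℝ} {u0 u1 ub : V}
    (hu0 : Isolated J L g η k X0 l0 u0) (hu1 : Isolated J L g η k X1 l1 u1)
    (hub : Isolated J L g η k Y lb ub) {D θ : ℝ} (hθ : 0 ≤ θ)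
    (hD : 2 * L * (1 + 1 / (lam1 * g)) ≤ √lam1 * D)
    {uhat ut : V} (huhat : uhat ∈ Y) (hut : ut ∈ X1)
    (hsol : ∀ v ∈ Y, ⟪uhat, v⟫ = l0 * ⟪J u0, J v⟫) (happ : ‖uhat - ut‖ ≤ θ * ‖uhat - u0‖) :
    (1 - D * η) * signDist ub u1 ≤ (θ + (1 + θ) * (D * η)) * signDist ub u0 := by
  have hf0 := Submodule.finiteDimensional_of_le h0Y
  have hf1 := Submodule.finiteDimensional_of_le h1Y
  have hsq : 0 < √lam1 := Real.sqrt_pos.2 hS.pos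
  have hη0 := hS.nonneg
  have main : ∀ {X : Submodule ℝ V} {l : ℝ} {u b z : V}, VH ≤ X → X ≤ Y → Isolated J L g η k X l u →
      Isolated J L g η k Y lb b → 0 ≤ ⟪u, b⟫ → ‖z‖ ^ 2 ≤ ⟪lb • J b - l • J u, J z⟫ →
      ‖z‖ ≤ D * η * ‖b - u‖ := by
    intro X l u b z hHX hXY hu hb hc hz
    have hfX := Submodule.finiteDimensional_of_le hXY
    have hll : lb ≤ l := by
      rw [hb.val_eq, hu.val_eq]
      exact specVal_anti hinj hXY hu.index
    have h1 := (hu.compare_pos hinj hS hP (hη.mono hHX) hXY hb.eig hb.norm_eq hb.le hb.inv_ge hll hc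
      hS.nonneg (hη.mono hHX)).1
    have h2 := norm_sq_le_of_inner_le hS.pos hP hz
    have h3 : √lam1 * ‖z‖ ≤ ‖lb • J b - l • J u‖ := by
      refine le_of_sq_le_sq ?_ (norm_nonneg _)
      rw [mul_pow, Real.sq_sqrt hS.pos.le]
      exact h2
    refine le_of_mul_le_mul_left ?_ hsq
    calc √lam1 * ‖z‖ ≤ 2 * L * (1 + 1 / (lam1 * g)) * (η * ‖b - u‖) := by linarith
      _ ≤ √lam1 * D * (η * ‖b - u‖) := by gcongr
      _ = _ := by ring
  obtain ⟨b0, hb0, hc0, hd0⟩ := exists_sign ub u0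
  obtain ⟨b1, hb1, hc1, hd1⟩ := exists_sign ub u1
  have hI0 := hub.of_sign hb0
  have hI1 := hub.of_sign hb1
  have hhat : ‖b0 - uhat‖ ≤ D * η * ‖b0 - u0‖ := by
    refine main hH0 h0Y hu0 hI0 hc0 (le_of_eq ?_)
    have hz : b0 - uhat ∈ Y := Y.sub_mem hI0.eig.1 huhat
    rw [← real_inner_self_eq_norm_sq, inner_sub_left, inner_sub_left, hI0.eig.2.2 _ hz, hsol _ hz,
      real_inner_smul_left, real_inner_smul_left]
  have htil : ‖b0 - ut‖ ≤ (θ + (1 + θ) * (D * η)) * ‖b0 - u0‖ := by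
    have h1 := norm_sub_le_norm_sub_add_norm_sub b0 uhat ut
    have h2 : ‖uhat - u0‖ ≤ ‖b0 - uhat‖ + ‖b0 - u0‖ := by
      rw [← norm_neg (b0 - uhat), neg_sub]
      exact norm_sub_le_norm_sub_add_norm_sub _ _ _
    have h3 : θ * ‖uhat - u0‖ ≤ θ * (‖b0 - uhat‖ + ‖b0 - u0‖) := by gcongr
    have h4 : (1 + θ) * ‖b0 - uhat‖ ≤ (1 + θ) * (D * η * ‖b0 - u0‖) := by gcongr
    linarith
  have hproj : ‖b1 - X1.starProjection b1‖ ≤ ‖b0 - ut‖ := by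
    have h1 : ‖b0 - X1.starProjection b0‖ ≤ ‖b0 - ut‖ := by
      have h2 := sub_smul_split (ub := b0) hut 1
      rw [one_smul] at h2
      refine le_of_sq_le_sq ?_ (norm_nonneg _)
      rw [h2]
      linarith [sq_nonneg ‖X1.starProjection b0 - ut‖]
    have h2 : b1 = b0 ∨ b1 = -b0 := by
      rcases hb0 with rfl | rfl <;> rcases hb1 with rfl | rfl <;> simp
    rcases h2 with rfl | rfl
    · exact h1
    · rwa [map_neg, ← neg_sub', norm_neg]
  have hgal : ‖X1.starProjection b1 - u1‖ ≤ D * η * ‖b1 - u1‖ := by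
    refine main hH1 h1Y hu1 hI1 hc1 (le_of_eq ?_)
    have hp := X1.starProjection_apply_mem b1
    have hz : X1.starProjection b1 - u1 ∈ X1 := X1.sub_mem hp hu1.eig.1
    have h1 := Submodule.inner_left_of_mem_orthogonal hz (X1.sub_starProjection_mem_orthogonal b1)
    rw [inner_sub_left, sub_eq_zero] at h1
    rw [← real_inner_self_eq_norm_sq, inner_sub_left, ← h1, hI1.eig.2.2 _ (h1Y hz),
      hu1.eig.2.2 _ hz, inner_sub_left, real_inner_smul_left, real_inner_smul_left]
  have h5 := norm_sub_le_norm_sub_add_norm_sub b1 (X1.starProjection b1) u1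
  rw [hd0, hd1]
  linarith

/-- One correction step of the augmented subspace scheme. -/
def Correction (J : V →L[ℝ] H) (θ L : ℝ) (VH Y : Submodule ℝ V) (p q : ℝ × V) : Prop :=
  ∃ uhat ∈ Y, ∃ ut ∈ Y, (∀ v ∈ Y, ⟪uhat, v⟫ = p.1 * ⟪J p.2, J v⟫) ∧
    ‖uhat - ut‖ ≤ θ * ‖uhat - p.2‖ ∧
    Eigenpair J (VH ⊔ Submodule.span ℝ {ut}) q.1 q.2 ∧ ‖q.2‖ = 1 ∧
    ∀ s w, Eigenpair J (VH ⊔ Submodule.span ℝ {ut}) s w → |q.1⁻¹ - L⁻¹| ≤ |s⁻¹ - L⁻¹|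

/-- `p` is an isolated eigenpair of some space between `VH` and `Y`. -/
def IsolatedBetween (J : V →L[ℝ] H) (L g η : ℝ) (k : ℕ) (VH Y : Submodule ℝ V) (p : ℝ × V) : Prop :=
  ∃ X, VH ≤ X ∧ X ≤ Y ∧ Isolated J L g η k X p.1 p.2

theorem correction_step (hinj : Function.Injective J) {lam1 L g η : ℝ}
    (hS : SmallEta lam1 L g η) (hP : ∀ v, lam1 * ‖J v‖ ^ 2 ≤ ‖v‖ ^ 2) {k : ℕ}
    {VH Y : Submodule ℝ V} [FiniteDimensional ℝ Y] (hη : EtaBound J VH η) (hHY : VH ≤ Y)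
    (hiso : ∀ X, VH ≤ X → X ≤ Y → ∀ l u, Eigenpair J X l u → ‖u‖ = 1 →
      (l = specVal J X (k + 1) ∨ ∀ s w, Eigenpair J X s w → |l⁻¹ - L⁻¹| ≤ |s⁻¹ - L⁻¹|) →
      Isolated J L g η k X l u)
    {lb : ℝ} {ub : V} (hub : Isolated J L g η k Y lb ub) {D θ γ : ℝ} (hθ : 0 ≤ θ)
    (hD : 2 * L * (1 + 1 / (lam1 * g)) ≤ √lam1 * D) (hDη : D * η < 1)
    (hγ : θ + (1 + θ) * (D * η) ≤ γ * (1 - D * η)) {p q : ℝ × V}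
    (hp : IsolatedBetween J L g η k VH Y p) (hpq : Correction J θ L VH Y p q) :
    IsolatedBetween J L g η k VH Y q ∧ signDist ub q.2 ≤ γ * signDist ub p.2 := by
  obtain ⟨uhat, huhat, ut, hut, hsol, happ, hq, hq1, hclose⟩ := hpq
  obtain ⟨X0, hH0, h0Y, hp⟩ := hp
  have h1Y : VH ⊔ Submodule.span ℝ {ut} ≤ Y :=
    sup_le hHY ((Submodule.span_singleton_le_iff_mem _ _).2 hut)
  have hqI := hiso _ le_sup_left h1Y q.1 q.2 hq hq1 (Or.inr hclose)
  refine ⟨⟨_, le_sup_left, h1Y, hqI⟩, ?_⟩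
  have h1 := correction_contraction hinj hS hP hη hH0 le_sup_left h0Y h1Y hp hqI hub hθ hD huhat
    (Submodule.mem_sup_right (Submodule.mem_span_singleton_self ut)) hsol happ
  have h2 : 0 < 1 - D * η := by linarith
  refine le_of_mul_le_mul_left ?_ h2
  calc _ ≤ _ := h1
    _ ≤ γ * (1 - D * η) * signDist ub p.2 :=
      mul_le_mul_of_nonneg_right hγ (signDist_nonneg _ _)
    _ = _ := by ring

theorem correction_iterate (hinj : Function.Injective J) {lam1 L g η : ℝ}
    (hS : SmallEta lam1 L g η) (hP : ∀ v, lam1 * ‖J v‖ ^ 2 ≤ ‖v‖ ^ 2) {k : ℕ}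
    {VH Y : Submodule ℝ V} [FiniteDimensional ℝ Y] (hη : EtaBound J VH η) (hHY : VH ≤ Y)
    (hiso : ∀ X, VH ≤ X → X ≤ Y → ∀ l u, Eigenpair J X l u → ‖u‖ = 1 →
      (l = specVal J X (k + 1) ∨ ∀ s w, Eigenpair J X s w → |l⁻¹ - L⁻¹| ≤ |s⁻¹ - L⁻¹|) →
      Isolated J L g η k X l u)
    {lb : ℝ} {ub : V} (hub : Isolated J L g η k Y lb ub) {D θ γ : ℝ} (hθ : 0 ≤ θ) (hγ0 : 0 ≤ γ)
    (hD : 2 * L * (1 + 1 / (lam1 * g)) ≤ √lam1 * D) (hDη : D * η < 1)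
    (hγ : θ + (1 + θ) * (D * η) ≤ γ * (1 - D * η)) {m : ℕ} {it : ℕ → ℝ × V}
    (h0 : IsolatedBetween J L g η k VH Y (it 0))
    (hstep : ∀ l, l < m → Correction J θ L VH Y (it l) (it (l + 1))) :
    ∀ l ≤ m, IsolatedBetween J L g η k VH Y (it l) ∧
      signDist ub (it l).2 ≤ γ ^ l * signDist ub (it 0).2 := by
  intro l
  induction l with
  | zero => exact fun _ => ⟨h0, by simp⟩
  | succ l ih =>
    intro hl
    obtain ⟨h1, h2⟩ := ih (by omega)
    obtain ⟨h3, h4⟩ := correction_step hinj hS hP hη hHY hiso hub hθ hD hDη hγ h1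
      (hstep l (by omega))
    refine ⟨h3, h4.trans ?_⟩
    rw [pow_succ']
    calc γ * signDist ub (it l).2 ≤ γ * (γ ^ l * signDist ub (it 0).2) := by gcongr
      _ = _ := by ring

end Scheme

section Main

variable {V H : Type*} [NormedAddCommGroup V] [InnerProductSpace ℝ V] [CompleteSpace V]
  [NormedAddCommGroup H] [InnerProductSpace ℝ H] [CompleteSpace H] {J : V →L[ℝ] H}

/-- The result of a multilevel run of the augmented subspace scheme is an isolated eigenpair of an
intermediate space which is close to the finest Galerkin eigenvector. -/
theorem multilevel_estimate (hinj : Function.Injective J) {lam1 L g η : ℝ}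
    (hS : SmallEta lam1 L g η) (hP : ∀ v, lam1 * ‖J v‖ ^ 2 ≤ ‖v‖ ^ 2) {k : ℕ}
    {VH : Submodule ℝ V} {Vh : ℕ → Submodule ℝ V} (hfin : ∀ j, FiniteDimensional ℝ (Vh j))
    (hη : EtaBound J VH η) {n : ℕ} (hn : 2 ≤ n) (hH1 : VH ≤ Vh 1)
    (hmono : ∀ j, 2 ≤ j → j ≤ n → Vh (j - 1) ≤ Vh j)
    (hiso : ∀ j, 1 ≤ j → j ≤ n → ∀ X, VH ≤ X → X ≤ Vh j → ∀ l u, Eigenpair J X l u → ‖u‖ = 1 →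
      (l = specVal J X (k + 1) ∨ ∀ s w, Eigenpair J X s w → |l⁻¹ - L⁻¹| ≤ |s⁻¹ - L⁻¹|) →
      Isolated J L g η k X l u)
    (hk : k < finrank ℝ VH)
    {u0 : V} (hu0 : Eigenpair J ⊤ L u0) (hu01 : ‖u0‖ = 1)
    {δ : ℕ → ℝ} (hδ : ∀ j, 1 ≤ j → j ≤ n → ‖u0 - (Vh j).starProjection u0‖ ≤ δ j) {β : ℝ}
    (hβ : 0 ≤ β) (hδβ : ∀ j, 2 ≤ j → j ≤ n → δ (j - 1) ≤ β * δ j)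
    {D θ γ : ℝ} (hθ : 0 ≤ θ) (hγ0 : 0 ≤ γ)
    (hD : 2 * L * (1 + 1 / (lam1 * g)) ≤ √lam1 * D) (hDη : D * η < 1)
    (hγ : θ + (1 + θ) * (D * η) ≤ γ * (1 - D * η)) {ϖ ϖn : ℕ} (hconv : γ ^ ϖ * β < 1)
    {out : ℕ → ℝ × V} {iter : ℕ → ℕ → ℝ × V}
    (hinit : (out 1).1 = specVal J (Vh 1) (k + 1)) (hinit' : Eigenpair J (Vh 1) (out 1).1 (out 1).2)
    (hinit1 : ‖(out 1).2‖ = 1)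
    (hms : ∀ j, 1 ≤ j → j + 2 ≤ n → iter (j + 1) 0 = out j)
    (hmstep : ∀ j, 1 ≤ j → j + 2 ≤ n → ∀ l, l < ϖ →
      Correction J θ L VH (Vh (j + 1)) (iter (j + 1) l) (iter (j + 1) (l + 1)))
    (hmo : ∀ j, 1 ≤ j → j + 2 ≤ n → out (j + 1) = iter (j + 1) ϖ)
    (hfs : iter n 0 = out (n - 1))
    (hfstep : ∀ l, l < ϖn → Correction J θ L VH (Vh n) (iter n l) (iter n (l + 1)))
    (hfo : out n = iter n ϖn) :
    IsolatedBetween J L g η k VH (Vh n) (out n) ∧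
    ∃ lb ub, Isolated J L g η k (Vh n) lb ub ∧ signDist ub (out n).2 ≤
      2 * β * γ ^ ϖn * (1 + 2 * γ ^ ϖ * β / (1 - γ ^ ϖ * β)) * δ n := by
  have hHj : ∀ j, 1 ≤ j → j ≤ n → VH ≤ Vh j := by
    intro j hj
    induction j, hj using Nat.le_induction with
    | base => exact fun _ => hH1
    | succ j hj ih => exact fun h => (ih (by omega)).trans (hmono (j + 1) (by omega) h)
  have hex : ∀ j, ∃ (l : ℝ) (u : V), 1 ≤ j → j ≤ n →
      Isolated J L g η k (Vh j) l u ∧ (j = 1 → u = (out 1).2) := by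
    intro j
    by_cases hj : 1 ≤ j ∧ j ≤ n
    · rcases eq_or_ne j 1 with rfl | hj1
      · exact ⟨(out 1).1, (out 1).2, fun h1 h2 =>
          ⟨hiso 1 h1 h2 _ hH1 le_rfl _ _ hinit' hinit1 (Or.inl hinit), fun _ => rfl⟩⟩
      · have hf := hfin j
        obtain ⟨B⟩ := exists_eigenBasis J hinj (Vh j)
        have hkj : k < finrank ℝ (Vh j) :=
          hk.trans_le (Submodule.finrank_mono (hHj j hj.1 hj.2))
        refine ⟨B.val ⟨k, hkj⟩, B.vec ⟨k, hkj⟩, fun h1 h2 => ⟨hiso j h1 h2 _ (hHj j h1 h2) le_rfl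
          _ _ (B.eig _) (B.orthonormal.1 _) (Or.inl ?_), fun h => absurd h hj1⟩⟩
        exact (B.specVal_eq ⟨k, hkj⟩).symm
    · exact ⟨0, 0, fun h1 h2 => absurd ⟨h1, h2⟩ hj⟩
  choose lb ub hub using hex
  have hδ0 : ∀ j, 1 ≤ j → j ≤ n → 0 ≤ δ j := fun j h1 h2 => (norm_nonneg _).trans (hδ j h1 h2)
  have hjump : ∀ j, 2 ≤ j → j ≤ n → signDist (ub j) (ub (j - 1)) ≤ 2 * (β * δ j) := by
    intro j hj hjn
    have hf := hfin j
    have hf' := hfin (j - 1)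
    obtain ⟨b, hb, hbc, hbd⟩ := exists_sign (ub j) (ub (j - 1))
    have h1 := (hub (j - 1) (by omega) (by omega)).1
    have h2 := ((hub j (by omega) hjn).1).of_sign hb
    rw [hbd]
    refine (h1.norm_sub_succ_le hinj hS hP (hη.mono (hHj _ (by omega) (by omega)))
      (hmono j hj hjn) h2 hu0 hu01 hbc).trans ?_
    have h3 := hδ (j - 1) (by omega) (by omega)
    have h4 := hδβ j hj hjn
    linarith
  set q := γ ^ ϖ * β with hq
  have hq0 : 0 ≤ q := by positivity
  have hq1 : 0 < 1 - q := by linarith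
  have hlevel : ∀ j, 1 ≤ j → j + 1 ≤ n → IsolatedBetween J L g η k VH (Vh j) (out j) ∧
      signDist (ub j) (out j).2 ≤ 2 * q / (1 - q) * δ j := by
    intro j hj
    induction j, hj using Nat.le_induction with
    | base =>
      intro h
      obtain ⟨h1, h2⟩ := hub 1 le_rfl (by omega)
      rw [h2 rfl]
      refine ⟨⟨Vh 1, hH1, le_rfl, hiso 1 le_rfl (by omega) _ hH1 le_rfl _ _ hinit' hinit1
        (Or.inl hinit)⟩, ?_⟩
      have h3 : signDist (out 1).2 (out 1).2 ≤ 0 := by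
        refine (min_le_left _ _).trans ?_
        simp
      have h4 := hδ0 1 le_rfl (by omega)
      exact h3.trans (by positivity)
    | succ j hj ih =>
      intro h
      have hf := hfin (j + 1)
      obtain ⟨⟨X, hX1, hX2, hX3⟩, ih2⟩ := ih (by omega)
      have hm := hmono (j + 1) (by omega) (by omega)
      rw [Nat.add_sub_cancel] at hm
      have hstart := hms j hj (by omega)
      obtain ⟨h1, h2⟩ := correction_iterate hinj hS hP hη (hHj (j + 1) (by omega) (by omega))
        (hiso (j + 1) (by omega) (by omega)) (hub (j + 1) (by omega) (by omega)).1 hθ hγ0 hD hDη hγ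
        (it := iter (j + 1)) (by rw [hstart]; exact ⟨X, hX1, hX2.trans hm, hX3⟩)
        (hmstep j hj (by omega)) ϖ le_rfl
      rw [← hmo j hj (by omega)] at h1 h2
      refine ⟨h1, h2.trans ?_⟩
      rw [hstart]
      have h3 := signDist_triangle (ub (j + 1)) (ub j) (out j).2
      have h4 := hjump (j + 1) (by omega) (by omega)
      rw [Nat.add_sub_cancel] at h4
      have h5 := hδβ (j + 1) (by omega) (by omega)
      rw [Nat.add_sub_cancel] at h5
      have h6 : 2 * q / (1 - q) * δ j ≤ 2 * q / (1 - q) * (β * δ (j + 1)) := by gcongr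
      calc γ ^ ϖ * signDist (ub (j + 1)) (out j).2
          ≤ γ ^ ϖ * (2 * (β * δ (j + 1)) + 2 * q / (1 - q) * (β * δ (j + 1))) := by
            gcongr; linarith
        _ = (q * (2 + 2 * q / (1 - q))) * δ (j + 1) := by rw [hq]; ring
        _ = 2 * q / (1 - q) * δ (j + 1) := by
            congr 1
            field_simp
            ring
  have hf := hfin n
  obtain ⟨⟨X, hX1, hX2, hX3⟩, hlast⟩ := hlevel (n - 1) (by omega) (by omega)
  obtain ⟨h1, h2⟩ := correction_iterate hinj hS hP hη (hHj n (by omega) le_rfl)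
    (hiso n (by omega) le_rfl) (hub n (by omega) le_rfl).1 hθ hγ0 hD hDη hγ
    (it := iter n) (by rw [hfs]; exact ⟨X, hX1, hX2.trans (hmono n hn le_rfl), hX3⟩)
    hfstep ϖn le_rfl
  rw [← hfo] at h1 h2
  refine ⟨h1, lb n, ub n, (hub n (by omega) le_rfl).1, h2.trans ?_⟩
  rw [hfs]
  have h3 := signDist_triangle (ub n) (ub (n - 1)) (out (n - 1)).2
  have h4 := hjump n hn le_rfl
  have h5 := hδβ n hn le_rfl
  have hδn := hδ0 n (by omega) le_rfl
  have h6 : 2 * q / (1 - q) * δ (n - 1) ≤ 2 * q / (1 - q) * (β * δ n) := by gcongr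
  have h7 : 0 ≤ 2 * q / (1 - q) * (β * δ n) := by positivity
  calc γ ^ ϖn * signDist (ub n) (out (n - 1)).2
      ≤ γ ^ ϖn * (2 * (β * δ n) + 2 * (2 * q / (1 - q) * (β * δ n))) := by
        gcongr; linarith
    _ = _ := by rw [hq]; ring

omit [CompleteSpace V] in
theorem final_estimate (hinj : Function.Injective J) {lam1 L g η : ℝ}
    (hS : SmallEta lam1 L g η) (hP : ∀ v, lam1 * ‖J v‖ ^ 2 ≤ ‖v‖ ^ 2) {k : ℕ}
    {VH Y : Submodule ℝ V} [FiniteDimensional ℝ Y] (hη : EtaBound J VH η) (hHY : VH ≤ Y)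
    {ηY : ℝ} (hηY0 : 0 ≤ ηY) (hηY : EtaBound J Y ηY) {p : ℝ × V}
    (hp : IsolatedBetween J L g η k VH Y p) {lb : ℝ} {ub : V}
    (hub : Isolated J L g η k Y lb ub) {u0 : V} (hu0 : Eigenpair J ⊤ L u0) (hu01 : ‖u0‖ = 1)
    {δ e : ℝ} (hδ : ‖u0 - Y.starProjection u0‖ ≤ δ) (he : signDist ub p.2 ≤ e * δ) :
    ∃ u, Eigenpair J ⊤ L u ∧ ‖u‖ = 1 ∧
      ‖u - p.2‖ ≤ (√(2 * (1 + 1 / (lam1 * g ^ 2) * ηY ^ 2)) + e) * δ ∧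
      ‖J (u - p.2)‖ ≤ 2 * (1 + 1 / (lam1 * g)) *
        (ηY * √(2 * (1 + 1 / (lam1 * g ^ 2) * ηY ^ 2)) + η * e) * δ ∧
      |L - p.1| ≤ p.1 * (√(2 * (1 + 1 / (lam1 * g ^ 2) * ηY ^ 2)) + e) ^ 2 * δ ^ 2 := by
  obtain ⟨X, hHX, hXY, hX⟩ := hp
  have hfX := Submodule.finiteDimensional_of_le hXY
  have hg := hS.gap_pos
  have hl1 := hS.pos
  have hδ0 : 0 ≤ δ := (norm_nonneg _).trans hδ
  obtain ⟨b, hb, hbc, hbd⟩ := exists_sign ub p.2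
  obtain ⟨u, hu, huc, -⟩ := exists_sign u0 b
  have hbI := hub.of_sign hb
  have huE : Eigenpair J ⊤ L u := by
    rcases hu with rfl | rfl
    exacts [hu0, hu0.neg]
  have hu1 : ‖u‖ = 1 := by
    rcases hu with rfl | rfl
    exacts [hu01, by rw [norm_neg, hu01]]
  have huδ : ‖u - Y.starProjection u‖ ≤ δ := by
    rcases hu with rfl | rfl
    · exact hδ
    · rwa [map_neg, ← neg_sub', norm_neg]
  set A := 2 * (1 + 1 / (lam1 * g ^ 2) * ηY ^ 2) with hA
  have hA0 : 0 ≤ A := by positivity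
  have h1 : ‖u - b‖ ≤ √A * δ := by
    refine le_of_sq_le_sq ?_ (by positivity)
    rw [mul_pow, Real.sq_sqrt hA0]
    refine (hbI.norm_sub_exact_le hinj hS hP hηY huE hu1 huc).trans ?_
    gcongr
  have h2 : ‖b - p.2‖ ≤ e * δ := hbd ▸ he
  have h3 : ‖u - p.2‖ ≤ (√A + e) * δ := by
    have := norm_sub_le_norm_sub_add_norm_sub u b p.2
    linarith
  refine ⟨u, huE, hu1, h3, ?_, ?_⟩
  · have h4 := (hbI.compare_pos hinj hS hP (hη.mono hHY) le_top huE hu1 le_rfl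
      (by linarith [sq_nonneg η]) hbI.le huc hηY0 hηY).2
    have hll : lb ≤ p.1 := by
      rw [hub.val_eq, hX.val_eq]
      exact specVal_anti hinj hXY hX.index
    have h5 := (hX.compare_pos hinj hS hP (hη.mono hHX) hXY hbI.eig hbI.norm_eq hbI.le hbI.inv_ge
      hll hbc hS.nonneg (hη.mono hHX)).2
    have h6 : J (u - p.2) = J (u - b) + J (b - p.2) := by rw [← map_add, sub_add_sub_cancel]
    have hη0 := hS.nonneg
    rw [h6]
    calc ‖J (u - b) + J (b - p.2)‖ ≤ ‖J (u - b)‖ + ‖J (b - p.2)‖ := norm_add_le _ _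
      _ ≤ 2 * (1 + 1 / (lam1 * g)) * ηY * (√A * δ) + 2 * (1 + 1 / (lam1 * g)) * η * (e * δ) := by
        refine add_le_add (h4.trans ?_) (h5.trans ?_) <;> gcongr
      _ = _ := by ring
  · obtain ⟨i1, -⟩ := eigen_identities le_top hX.eig hX.norm_eq huE hu1
    have hp0 := hX.eig.pos
    rw [abs_sub_comm, abs_of_nonneg (sub_nonneg.2 hX.le), mul_assoc, ← mul_pow]
    calc p.1 - L ≤ p.1 * ‖u - p.2‖ ^ 2 := by
          linarith [sq_nonneg ‖L • J u - p.1 • J p.2‖]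
      _ ≤ _ := by gcongr

end Main
end Galerkin

section Poincare

open scoped ENNReal

variable {d : ℕ}

theorem lintegral_lineMap_le {Q : Set (E d)} (hQ : MeasurableSet Q) (hc : Convex ℝ Q)
    {G : E d → ℝ≥0∞} (hG : Measurable G) {x : E d} (hx : x ∈ Q) {t : ℝ} (ht : 1 / 2 ≤ t)
    (ht1 : t ≤ 1) :
    ∫⁻ y in Q, G (AffineMap.lineMap x y t) ≤ 2 ^ d * ∫⁻ y in Q, G y := by
  have ht0 : 0 < t := by linarith
  set F := Q.indicator G with hF
  have hFm : Measurable F := hG.indicator hQ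
  have h1 : ∫⁻ y in Q, G (AffineMap.lineMap x y t) ≤ ∫⁻ y, F ((1 - t) • x + t • y) := by
    rw [← lintegral_indicator hQ]
    refine lintegral_mono fun y => ?_
    by_cases hy : y ∈ Q
    · rw [Set.indicator_of_mem hy, AffineMap.lineMap_apply_module, hF,
        Set.indicator_of_mem (hc hx hy (by linarith) ht0.le (by ring))]
    · rw [Set.indicator_of_notMem hy]; exact bot_le
  have h2 : ∫⁻ y, F ((1 - t) • x + t • y) =
      ENNReal.ofReal |(t ^ Module.finrank ℝ (E d))⁻¹| * ∫⁻ y in Q, G y := by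
    have h3 : ∫⁻ y, F ((1 - t) • x + t • y) =
        ∫⁻ z, F ((1 - t) • x + z) ∂(Measure.map (t • ·) (volume : Measure (E d))) :=
      (lintegral_map (hFm.comp (measurable_const_add _)) (measurable_const_smul t)).symm
    rw [h3, Measure.map_addHaar_smul _ ht0.ne', lintegral_smul_measure, smul_eq_mul,
      lintegral_add_left_eq_self, hF, lintegral_indicator hQ]
  rw [h2] at h1
  refine h1.trans (mul_le_mul_left ?_ _)
  rw [finrank_euclideanSpace_fin, abs_of_pos (by positivity)]
  have h4 : (t ^ d)⁻¹ ≤ 2 ^ d := by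
    rw [← inv_pow]
    gcongr
    rw [inv_le_comm₀ ht0 (by norm_num)]
    linarith
  refine (ENNReal.ofReal_le_ofReal h4).trans ?_
  rw [ENNReal.ofReal_pow (by norm_num)]
  simp

theorem lintegral_lintegral_lineMap_le {Q : Set (E d)} (hQ : MeasurableSet Q) (hc : Convex ℝ Q)
    {G : E d → ℝ≥0∞} (hG : Continuous G) {t : ℝ} (ht0 : 0 ≤ t) (ht1 : t ≤ 1) :
    ∫⁻ x in Q, ∫⁻ y in Q, G (AffineMap.lineMap x y t) ≤ 2 ^ d * volume Q * ∫⁻ y in Q, G y := by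
  have key : ∀ s : ℝ, 1 / 2 ≤ s → s ≤ 1 →
      ∫⁻ x in Q, ∫⁻ y in Q, G (AffineMap.lineMap x y s) ≤ 2 ^ d * volume Q * ∫⁻ y in Q, G y := by
    intro s hs hs1
    calc ∫⁻ x in Q, ∫⁻ y in Q, G (AffineMap.lineMap x y s)
        ≤ ∫⁻ x in Q, 2 ^ d * ∫⁻ y in Q, G y :=
          setLIntegral_mono' hQ fun x hx => lintegral_lineMap_le hQ hc hG.measurable hx hs hs1
      _ = _ := by rw [setLIntegral_const]; ring
  rcases le_total (1 / 2) t with h | h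
  · exact key t h ht1
  · rw [lintegral_lintegral_swap]
    · refine le_trans (le_of_eq ?_) (key (1 - t) (by linarith) (by linarith))
      simp_rw [AffineMap.lineMap_apply_one_sub]
    · have : Continuous fun p : E d × E d => G (AffineMap.lineMap p.1 p.2 t) := by
        simp only [AffineMap.lineMap_apply_module]
        fun_prop
      exact this.measurable.aemeasurable

theorem enorm_sub_sq_le {φ : E d → ℝ} (hφ : ContDiff ℝ 1 φ) (x y : E d) :
    ‖φ y - φ x‖ₑ ^ 2 ≤ ‖y - x‖ₑ ^ 2 *
      ∫⁻ t in Set.Ioc (0 : ℝ) 1, ‖fderiv ℝ φ (AffineMap.lineMap x y t)‖ₑ ^ 2 := by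
  have hcont : Continuous fun t : ℝ => fderiv ℝ φ (AffineMap.lineMap x y t) :=
    (hφ.continuous_fderiv (by norm_num)).comp AffineMap.lineMap_continuous
  have hd : ∀ t : ℝ, HasDerivAt (fun t : ℝ => φ (AffineMap.lineMap x y t))
      (fderiv ℝ φ (AffineMap.lineMap x y t) (y - x)) t := fun t =>
    ((hφ.differentiable (by norm_num)) _).hasFDerivAt.comp_hasDerivAt t AffineMap.hasDerivAt_lineMap
  have hftc : φ y - φ x = ∫ t in (0 : ℝ)..1, fderiv ℝ φ (AffineMap.lineMap x y t) (y - x) := by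
    rw [intervalIntegral.integral_eq_sub_of_hasDerivAt (fun t _ => hd t)
      ((hcont.clm_apply continuous_const).intervalIntegrable _ _)]
    simp
  have h1 : ‖φ y - φ x‖ₑ ≤ ‖y - x‖ₑ *
      ∫⁻ t in Set.Ioc (0 : ℝ) 1, ‖fderiv ℝ φ (AffineMap.lineMap x y t)‖ₑ := by
    rw [hftc, intervalIntegral.integral_of_le zero_le_one]
    refine (enorm_integral_le_lintegral_enorm _).trans ?_
    rw [← lintegral_const_mul _ hcont.enorm.measurable]
    refine lintegral_mono fun t => ?_
    rw [mul_comm]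
    exact ContinuousLinearMap.le_opENorm _ _
  have h2 : (∫⁻ t in Set.Ioc (0 : ℝ) 1, ‖fderiv ℝ φ (AffineMap.lineMap x y t)‖ₑ) ^ 2 ≤
      ∫⁻ t in Set.Ioc (0 : ℝ) 1, ‖fderiv ℝ φ (AffineMap.lineMap x y t)‖ₑ ^ 2 := by
    have h3 := ENNReal.lintegral_mul_le_Lp_mul_Lq (volume.restrict (Set.Ioc (0 : ℝ) 1))
      Real.HolderConjugate.two_two (f := fun t => ‖fderiv ℝ φ (AffineMap.lineMap x y t)‖ₑ)
      (g := fun _ => 1) hcont.enorm.measurable.aemeasurable aemeasurable_const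
    simp only [Pi.mul_apply, mul_one, ENNReal.one_rpow, lintegral_const, MeasurableSet.univ,
      Measure.restrict_apply, Set.univ_inter, Real.volume_Ioc, sub_zero, ENNReal.ofReal_one] at h3
    calc _ ≤ ((∫⁻ t in Set.Ioc (0 : ℝ) 1,
          ‖fderiv ℝ φ (AffineMap.lineMap x y t)‖ₑ ^ (2 : ℝ)) ^ (1 / 2 : ℝ)) ^ 2 := by gcongr
      _ = _ := by
        rw [← ENNReal.rpow_natCast, ← ENNReal.rpow_mul]
        simp
  calc ‖φ y - φ x‖ₑ ^ 2 ≤ (‖y - x‖ₑ *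
      ∫⁻ t in Set.Ioc (0 : ℝ) 1, ‖fderiv ℝ φ (AffineMap.lineMap x y t)‖ₑ) ^ 2 := by gcongr
    _ = _ := mul_pow _ _ _
    _ ≤ _ := by gcongr

theorem lintegral_lintegral_sub_sq_le {Q : Set (E d)} (hQ : MeasurableSet Q) (hc : Convex ℝ Q)
    {R : ℝ≥0∞} (hR : ∀ x ∈ Q, ∀ y ∈ Q, ‖y - x‖ₑ ^ 2 ≤ R) {φ : E d → ℝ} (hφ : ContDiff ℝ 1 φ) :
    ∫⁻ x in Q, ∫⁻ y in Q, ‖φ y - φ x‖ₑ ^ 2 ≤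
      R * (2 ^ d * volume Q * ∫⁻ x in Q, ‖fderiv ℝ φ x‖ₑ ^ 2) := by
  set G : E d → ℝ≥0∞ := fun x => ‖fderiv ℝ φ x‖ₑ ^ 2 with hG
  have hGc : Continuous G := (ENNReal.continuous_pow 2).comp
    (hφ.continuous_fderiv (by norm_num)).enorm
  have hline : Continuous fun p : (E d × E d) × ℝ => G (AffineMap.lineMap p.1.1 p.1.2 p.2) := by
    simp only [AffineMap.lineMap_apply_module]
    fun_prop
  have hline2 : ∀ x : E d, Continuous fun p : E d × ℝ => G (AffineMap.lineMap x p.1 p.2) :=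
    fun x => hline.comp (f := fun p : E d × ℝ => ((x, p.1), p.2)) (by fun_prop)
  have hline3 : Continuous fun p : (E d × ℝ) × E d => G (AffineMap.lineMap p.1.1 p.2 p.1.2) :=
    hline.comp (f := fun p : (E d × ℝ) × E d => ((p.1.1, p.2), p.1.2)) (by fun_prop)
  have hm3 : Measurable fun p : E d × ℝ => ∫⁻ y in Q, G (AffineMap.lineMap p.1 y p.2) :=
    hline3.measurable.lintegral_prod_right'
  calc ∫⁻ x in Q, ∫⁻ y in Q, ‖φ y - φ x‖ₑ ^ 2
      ≤ ∫⁻ x in Q, ∫⁻ y in Q, R * ∫⁻ t in Set.Ioc (0 : ℝ) 1, G (AffineMap.lineMap x y t) := by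
        refine setLIntegral_mono' hQ fun x hx => setLIntegral_mono' hQ fun y hy => ?_
        exact (enorm_sub_sq_le hφ x y).trans (by gcongr; exact hR x hx y hy)
    _ = ∫⁻ x in Q, R * ∫⁻ t in Set.Ioc (0 : ℝ) 1, ∫⁻ y in Q, G (AffineMap.lineMap x y t) := by
        refine lintegral_congr fun x => ?_
        rw [lintegral_const_mul _ (hline2 x).measurable.lintegral_prod_right',
          lintegral_lintegral_swap (hline2 x).measurable.aemeasurable]
    _ = R * ∫⁻ t in Set.Ioc (0 : ℝ) 1, ∫⁻ x in Q, ∫⁻ y in Q, G (AffineMap.lineMap x y t) := by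
        rw [lintegral_const_mul _ hm3.lintegral_prod_right',
          lintegral_lintegral_swap hm3.aemeasurable]
    _ ≤ R * ∫⁻ t in Set.Ioc (0 : ℝ) 1, 2 ^ d * volume Q * ∫⁻ x in Q, G x := by
        gcongr R * ?_
        exact setLIntegral_mono' measurableSet_Ioc fun t ht =>
          lintegral_lintegral_lineMap_le hQ hc hGc ht.1.le ht.2
    _ = _ := by rw [setLIntegral_const]; simp

theorem enorm_sq_eq_ofReal (s : ℝ) : ‖s‖ₑ ^ 2 = ENNReal.ofReal (s ^ 2) := by
  rw [← ofReal_norm, ← ENNReal.ofReal_pow (norm_nonneg _), Real.norm_eq_abs, sq_abs]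

theorem integral_integral_sub_sq {α : Type*} [MeasurableSpace α] {μ : Measure α}
    [IsFiniteMeasure μ] {φ : α → ℝ} (hi1 : Integrable φ μ) (hi2 : Integrable (fun x => φ x ^ 2) μ) :
    (∀ x, Integrable (fun y => (φ y - φ x) ^ 2) μ) ∧
    Integrable (fun x => ∫ y, (φ y - φ x) ^ 2 ∂μ) μ ∧
    ∫ x, ∫ y, (φ y - φ x) ^ 2 ∂μ ∂μ =
      2 * (μ.real Set.univ * ∫ x, φ x ^ 2 ∂μ) - 2 * (∫ x, φ x ∂μ) ^ 2 := by
  have hsq : ∀ x, (fun y => (φ y - φ x) ^ 2) = fun y => φ y ^ 2 - 2 * φ x * φ y + φ x ^ 2 := by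
    intro x; ext y; ring
  have hin : ∀ x, ∫ y, (φ y - φ x) ^ 2 ∂μ =
      ∫ y, φ y ^ 2 ∂μ - 2 * φ x * ∫ y, φ y ∂μ + μ.real Set.univ * φ x ^ 2 := by
    intro x
    have h0 : Integrable (fun y => φ y ^ 2 - 2 * φ x * φ y) μ := hi2.sub (hi1.const_mul _)
    rw [hsq, integral_add h0 (integrable_const _), integral_sub hi2 (hi1.const_mul _),
      integral_const_mul, integral_const, smul_eq_mul]
  have h1 : Integrable (fun x => ∫ y, φ y ^ 2 ∂μ - 2 * φ x * ∫ y, φ y ∂μ) μ :=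
    (integrable_const _).sub ((hi1.const_mul 2).mul_const _)
  refine ⟨fun x => ?_, ?_, ?_⟩
  · rw [hsq]
    exact (hi2.sub (hi1.const_mul _)).add (integrable_const _)
  · simp_rw [hin]
    exact h1.add (hi2.const_mul _)
  · simp_rw [hin]
    rw [integral_add h1 (hi2.const_mul _), integral_sub (integrable_const _)
      ((hi1.const_mul 2).mul_const _), integral_mul_const, integral_const_mul, integral_const_mul,
      integral_const, smul_eq_mul]
    ring

theorem ofReal_integral_integral_sub_sq {α : Type*} [MeasurableSpace α] {μ : Measure α}
    [IsFiniteMeasure μ] {φ : α → ℝ} (hi1 : Integrable φ μ) (hi2 : Integrable (fun x => φ x ^ 2) μ) :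
    ENNReal.ofReal (2 * (μ.real Set.univ * ∫ x, φ x ^ 2 ∂μ) - 2 * (∫ x, φ x ∂μ) ^ 2) =
      ∫⁻ x, ∫⁻ y, ‖φ y - φ x‖ₑ ^ 2 ∂μ ∂μ := by
  obtain ⟨h1, h2, h3⟩ := integral_integral_sub_sq hi1 hi2
  rw [← h3, ofReal_integral_eq_lintegral_ofReal h2
    (Filter.Eventually.of_forall fun x => integral_nonneg fun y => sq_nonneg _)]
  refine lintegral_congr fun x => ?_
  rw [ofReal_integral_eq_lintegral_ofReal (h1 x) (Filter.Eventually.of_forall fun y => sq_nonneg _)]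
  exact lintegral_congr fun y => (enorm_sq_eq_ofReal _).symm

/-- The Poincaré inequality on a bounded convex set. -/
theorem poincare_convex {Q : Set (E d)} (hQ : MeasurableSet Q) (hc : Convex ℝ Q)
    (hb : Bornology.IsBounded Q) {r : ℝ} (hr : ∀ x ∈ Q, ∀ y ∈ Q, ‖y - x‖ ^ 2 ≤ r)
    {φ : E d → ℝ} (hφ : ContDiff ℝ 1 φ) (hφc : HasCompactSupport φ) :
    2 * (volume.real Q * ∫ x in Q, φ x ^ 2) - 2 * (∫ x in Q, φ x) ^ 2 ≤
      r * (2 ^ d * volume.real Q * ∫ x in Q, ‖fderiv ℝ φ x‖ ^ 2) := by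
  rcases Q.eq_empty_or_nonempty with rfl | ⟨x0, hx0⟩
  · simp
  have hr0 : 0 ≤ r := (sq_nonneg _).trans (hr x0 hx0 x0 hx0)
  have hfin : volume Q ≠ ⊤ := hb.measure_lt_top.ne
  have hmu : IsFiniteMeasure (volume.restrict Q) := ⟨by simpa using hfin.lt_top⟩
  have hφcont := hφ.continuous
  have hi1 : IntegrableOn φ Q := (hφcont.integrable_of_hasCompactSupport hφc).integrableOn
  have hi2 : IntegrableOn (fun x => φ x ^ 2) Q :=
    ((hφcont.pow 2).integrable_of_hasCompactSupport
      (hφc.mono fun x hx h0 => hx (by simp [h0]))).integrableOn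
  have hdc : Continuous fun x => ‖fderiv ℝ φ x‖ ^ 2 :=
    (hφ.continuous_fderiv (by norm_num)).norm.pow 2
  have hi3 : IntegrableOn (fun x => ‖fderiv ℝ φ x‖ ^ 2) Q :=
    (hdc.integrable_of_hasCompactSupport ((hφc.fderiv (𝕜 := ℝ)).mono
      fun x hx h0 => hx (by simp [h0]))).integrableOn
  have hlhs := ofReal_integral_integral_sub_sq hi1 hi2
  rw [measureReal_restrict_apply_univ] at hlhs
  have hrhs : ENNReal.ofReal (r * (2 ^ d * volume.real Q * ∫ x in Q, ‖fderiv ℝ φ x‖ ^ 2)) =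
      ENNReal.ofReal r * (2 ^ d * volume Q * ∫⁻ x in Q, ‖fderiv ℝ φ x‖ₑ ^ 2) := by
    have h1 : ENNReal.ofReal (∫ x in Q, ‖fderiv ℝ φ x‖ ^ 2) =
        ∫⁻ x in Q, ‖fderiv ℝ φ x‖ₑ ^ 2 := by
      rw [ofReal_integral_eq_lintegral_ofReal hi3
        (Filter.Eventually.of_forall fun y => sq_nonneg _)]
      refine lintegral_congr fun x => ?_
      rw [ENNReal.ofReal_pow (norm_nonneg _), ofReal_norm]
    have h2 : (2 : ENNReal) ^ d = ENNReal.ofReal (2 ^ d) := by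
      rw [ENNReal.ofReal_pow zero_le_two, ENNReal.ofReal_ofNat]
    have h3 : volume Q = ENNReal.ofReal (volume.real Q) := (ENNReal.ofReal_toReal hfin).symm
    have h4 : (0 : ℝ) ≤ 2 ^ d := pow_nonneg zero_le_two d
    rw [← h1, h2, h3, ENNReal.ofReal_mul hr0, ENNReal.ofReal_mul (mul_nonneg h4 measureReal_nonneg),
      ENNReal.ofReal_mul h4, ← h3]
  have hI3 : 0 ≤ ∫ x in Q, ‖fderiv ℝ φ x‖ ^ 2 := integral_nonneg fun y => sq_nonneg _
  have hmain := lintegral_lintegral_sub_sq_le hQ hc (R := ENNReal.ofReal r) (fun x hx y hy => by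
    rw [← ofReal_norm, ← ENNReal.ofReal_pow (norm_nonneg _)]
    exact ENNReal.ofReal_le_ofReal (hr x hx y hy)) hφ
  rw [← hlhs, ← hrhs] at hmain
  exact (ENNReal.ofReal_le_ofReal_iff (mul_nonneg hr0 (mul_nonneg (mul_nonneg
    (pow_nonneg zero_le_two d) measureReal_nonneg) hI3))).1 hmain

end Poincare

section Compactness

variable {d : ℕ} {Ω : Set (E d)}

theorem norm_sq_eq_setIntegral {F : Type*} [NormedAddCommGroup F] [InnerProductSpace ℝ F]
    (f : Lp F 2 (volume.restrict Ω)) : ‖f‖ ^ 2 = ∫ x in Ω, ‖f x‖ ^ 2 := by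
  rw [← real_inner_self_eq_norm_sq, L2.inner_def]
  simp_rw [real_inner_self_eq_norm_sq]

theorem norm_gradient (φ : E d → ℝ) (x : E d) : ‖gradient φ x‖ = ‖fderiv ℝ φ x‖ := by
  rw [gradient, LinearIsometryEquiv.norm_map]

theorem fderiv_eq_zero_of_notMem {φ : E d → ℝ} (hφ : tsupport φ ⊆ Ω) {x : E d} (hx : x ∉ Ω) :
    fderiv ℝ φ x = 0 :=
  image_eq_zero_of_notMem_tsupport fun h => hx (hφ (tsupport_fderiv_subset ℝ h))

theorem eq_zero_of_notMem {φ : E d → ℝ} (hφ : tsupport φ ⊆ Ω) {x : E d} (hx : x ∉ Ω) :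
    φ x = 0 := image_eq_zero_of_notMem_tsupport fun h => hx (hφ h)

theorem norm_fst_sq_of_test {f : L2 Ω} {φ : E d → ℝ}
    (hφ : tsupport φ ⊆ Ω) (hf : f =ᵐ[volume.restrict Ω] φ) : ‖f‖ ^ 2 = ∫ x, φ x ^ 2 := by
  rw [norm_sq_eq_setIntegral, ← setIntegral_eq_integral_of_forall_compl_eq_zero (s := Ω)
    (f := fun x => φ x ^ 2) fun x hx => by rw [eq_zero_of_notMem hφ hx]; simp]
  refine integral_congr_ae (hf.mono fun x hx => ?_)
  simp only [hx, Real.norm_eq_abs, sq_abs]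

theorem norm_snd_sq_of_test {f : Lp (E d) 2 (volume.restrict Ω)} {φ : E d → ℝ}
    (hφ : tsupport φ ⊆ Ω) (hf : f =ᵐ[volume.restrict Ω] gradient φ) :
    ‖f‖ ^ 2 = ∫ x, ‖fderiv ℝ φ x‖ ^ 2 := by
  rw [norm_sq_eq_setIntegral, ← setIntegral_eq_integral_of_forall_compl_eq_zero (s := Ω)
    (f := fun x => ‖fderiv ℝ φ x‖ ^ 2) fun x hx => by rw [fderiv_eq_zero_of_notMem hφ hx]; simp]
  refine integral_congr_ae (hf.mono fun x hx => ?_)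
  simp only [hx, norm_gradient]

theorem le_on_H10 {F G : L2Pair Ω → ℝ} (hF : Continuous F) (hG : Continuous G)
    (h : ∀ p ∈ testPairs Ω, F p ≤ G p) (v : H10 Ω) : F v.1 ≤ G v.1 := by
  have h1 : closure (testPairs Ω : Set (L2Pair Ω)) ⊆ {p | F p ≤ G p} :=
    closure_minimal h (isClosed_le hF hG)
  exact h1 v.2

theorem eq_on_H10 {F G : L2Pair Ω → ℝ} (hF : Continuous F) (hG : Continuous G)
    (h : ∀ p ∈ testPairs Ω, F p = G p) (v : H10 Ω) : F v.1 = G v.1 :=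
  le_antisymm (le_on_H10 hF hG (fun p hp => (h p hp).le) v)
    (le_on_H10 hG hF (fun p hp => (h p hp).ge) v)

theorem integrable_sq_of_hasCompactSupport {φ : E d → ℝ} (hφ : Continuous φ)
    (hφc : HasCompactSupport φ) : Integrable fun x => φ x ^ 2 :=
  (hφ.pow 2).integrable_of_hasCompactSupport (hφc.mono fun x hx h0 => hx (by simp [h0]))

theorem integrable_norm_fderiv_sq {φ : E d → ℝ} (hφ : ContDiff ℝ 1 φ)
    (hφc : HasCompactSupport φ) : Integrable fun x => ‖fderiv ℝ φ x‖ ^ 2 :=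
  ((hφ.continuous_fderiv (by norm_num)).norm.pow 2).integrable_of_hasCompactSupport
    ((hφc.fderiv (𝕜 := ℝ)).mono fun x hx h0 => hx (by simp [h0]))

theorem sq_integral_le {α : Type*} [MeasurableSpace α] {μ : Measure α}
    [IsFiniteMeasure μ] {φ : α → ℝ} (hi1 : Integrable φ μ) (hi2 : Integrable (fun x => φ x ^ 2) μ) :
    (∫ x, φ x ∂μ) ^ 2 ≤ μ.real Set.univ * ∫ x, φ x ^ 2 ∂μ := by
  have h := (integral_integral_sub_sq hi1 hi2).2.2
  have h0 : 0 ≤ ∫ x, ∫ y, (φ y - φ x) ^ 2 ∂μ ∂μ :=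
    integral_nonneg fun x => integral_nonneg fun y => sq_nonneg _
  linarith

/-- The Friedrichs inequality. -/
theorem exists_norm_fn_le (hd : 0 < d) (hΩ : Bornology.IsBounded Ω) :
    ∃ C : ℝ, 0 ≤ C ∧ ∀ v : H10 Ω, ‖fn v‖ ^ 2 ≤ C * ‖grad v‖ ^ 2 := by
  have : Nonempty (Fin d) := ⟨⟨0, hd⟩⟩
  obtain ⟨R, hR0, hR⟩ := hΩ.subset_ball_lt 0 0
  set Q : Set (E d) := Metric.ball 0 (2 * R) with hQ
  have hBQ : Metric.ball (0 : E d) R ⊆ Q := Metric.ball_subset_ball (by linarith)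
  have hΩQ : Ω ⊆ Q := hR.trans hBQ
  set P : Set (E d) := Metric.ball 0 R with hP
  have hPfin : volume P ≠ ⊤ := Metric.isBounded_ball.measure_lt_top.ne
  have hP0 : 0 < volume.real P :=
    ENNReal.toReal_pos (Metric.measure_ball_pos _ _ hR0).ne' hPfin
  have hQP : 2 * volume.real P ≤ volume.real Q := by
    have h1 : volume Q = ENNReal.ofReal (2 ^ d) * volume P := by
      rw [hQ, Measure.addHaar_ball_mul _ _ zero_le_two, finrank_euclideanSpace_fin]
    rw [Measure.real, Measure.real, h1, ENNReal.toReal_mul, ENNReal.toReal_ofReal (by positivity)]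
    have h2 : (2 : ℝ) ≤ 2 ^ d := le_self_pow₀ one_le_two hd.ne'
    exact mul_le_mul_of_nonneg_right h2 hP0.le
  have hQ0 : 0 < volume.real Q := by linarith
  set r : ℝ := (4 * R) ^ 2 with hr
  refine ⟨r * 2 ^ d, by positivity, fun v => ?_⟩
  refine le_on_H10 (F := fun p => ‖p.fst‖ ^ 2) (G := fun p => r * 2 ^ d * ‖p.snd‖ ^ 2)
    (by fun_prop) (by fun_prop) ?_ v
  rintro p ⟨φ, h1, h2, h3, h4, h5⟩
  have hφ1 : ContDiff ℝ 1 φ := h1.of_le (by exact_mod_cast le_top)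
  simp only [norm_fst_sq_of_test h3 h4, norm_snd_sq_of_test h3 h5]
  have hmain := poincare_convex (Q := Q) Metric.isOpen_ball.measurableSet (convex_ball _ _)
    Metric.isBounded_ball (r := r) (fun x hx y hy => by
      have := dist_triangle_right y x 0
      rw [Metric.mem_ball] at hx hy
      rw [← dist_eq_norm, hr]
      gcongr
      linarith) hφ1 h2
  have e1 : ∫ x in Q, φ x ^ 2 = ∫ x, φ x ^ 2 :=
    setIntegral_eq_integral_of_forall_compl_eq_zero fun x hx => by
      rw [eq_zero_of_notMem h3 fun h => hx (hΩQ h)]; simp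
  have e2 : ∫ x in Q, ‖fderiv ℝ φ x‖ ^ 2 = ∫ x, ‖fderiv ℝ φ x‖ ^ 2 :=
    setIntegral_eq_integral_of_forall_compl_eq_zero fun x hx => by
      rw [fderiv_eq_zero_of_notMem h3 fun h => hx (hΩQ h)]; simp
  have e3 : ∫ x in Q, φ x = ∫ x in P, φ x := by
    rw [setIntegral_eq_integral_of_forall_compl_eq_zero fun x hx =>
      eq_zero_of_notMem h3 fun h => hx (hΩQ h),
      setIntegral_eq_integral_of_forall_compl_eq_zero fun x hx =>
      eq_zero_of_notMem h3 fun h => hx (hR h)]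
  have e4 : ∫ x in P, φ x ^ 2 = ∫ x, φ x ^ 2 :=
    setIntegral_eq_integral_of_forall_compl_eq_zero fun x hx => by
      rw [eq_zero_of_notMem h3 fun h => hx (hR h)]; simp
  have hmuP : IsFiniteMeasure (volume.restrict P) := ⟨by simpa using hPfin.lt_top⟩
  have hcs := sq_integral_le (μ := volume.restrict P)
    (hφ1.continuous.integrable_of_hasCompactSupport h2).integrableOn
    (integrable_sq_of_hasCompactSupport hφ1.continuous h2).integrableOn
  rw [measureReal_restrict_apply_univ, e4] at hcs
  rw [e1, e2, e3] at hmain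
  have hI : 0 ≤ ∫ x, φ x ^ 2 := integral_nonneg fun _ => sq_nonneg _
  have h6 : volume.real Q * ∫ x, φ x ^ 2 ≤
      volume.real Q * (r * 2 ^ d * ∫ x, ‖fderiv ℝ φ x‖ ^ 2) := by
    nlinarith
  exact le_of_mul_le_mul_left h6 hQ0

/-- The half-open cube of side length `h` with index `κ`. -/
def cube (h : ℝ) (κ : Fin d → ℤ) : Set (E d) := {x | ∀ i, h * κ i ≤ x i ∧ x i < h * (κ i + 1)}

theorem measurableSet_cube (h : ℝ) (κ : Fin d → ℤ) : MeasurableSet (cube h κ) := by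
  simp only [cube, Set.ofPred_forall]
  refine MeasurableSet.iInter fun i => ?_
  have : Continuous fun x : E d => x i := by fun_prop
  exact (measurableSet_le measurable_const this.measurable).inter
    (measurableSet_lt this.measurable measurable_const)

theorem convex_cube (h : ℝ) (κ : Fin d → ℤ) : Convex ℝ (cube h κ) := by
  intro x hx y hy a b ha hb hab i
  obtain ⟨h1, h2⟩ := hx i
  obtain ⟨h3, h4⟩ := hy i
  simp only [PiLp.add_apply, PiLp.smul_apply, smul_eq_mul]
  have h5 := convex_Ico (𝕜 := ℝ) (h * κ i) (h * (κ i + 1)) ⟨h1, h2⟩ ⟨h3, h4⟩ ha hb hab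
  exact h5

theorem norm_sub_sq_le_of_mem_cube {h : ℝ} {κ : Fin d → ℤ} {x y : E d} (hx : x ∈ cube h κ)
    (hy : y ∈ cube h κ) : ‖y - x‖ ^ 2 ≤ d * h ^ 2 := by
  rw [EuclideanSpace.norm_sq_eq]
  calc ∑ i, ‖(y - x) i‖ ^ 2 ≤ ∑ _i : Fin d, h ^ 2 := by
        refine Finset.sum_le_sum fun i _ => ?_
        obtain ⟨h1, h2⟩ := hx i
        obtain ⟨h3, h4⟩ := hy i
        rw [Real.norm_eq_abs, sq_abs]
        simp only [PiLp.sub_apply]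
        refine sq_le_sq' ?_ ?_ <;> linarith
    _ = d * h ^ 2 := by simp

theorem isBounded_cube (h : ℝ) (κ : Fin d → ℤ) : Bornology.IsBounded (cube h κ) :=
  Metric.isBounded_iff.2 ⟨√(d * h ^ 2), fun x hx y hy => by
    rw [dist_eq_norm]
    exact Real.le_sqrt_of_sq_le (norm_sub_sq_le_of_mem_cube hy hx)⟩

theorem mem_cube_iff {h : ℝ} (hh : 0 < h) {κ : Fin d → ℤ} {x : E d} :
    x ∈ cube h κ ↔ ∀ i, ⌊x i / h⌋ = κ i := by
  refine forall_congr' fun i => ?_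
  rw [Int.floor_eq_iff, le_div_iff₀ hh, div_lt_iff₀ hh, mul_comm h, mul_comm h]

theorem disjoint_cube {h : ℝ} (hh : 0 < h) {κ κ' : Fin d → ℤ} (hne : κ ≠ κ') :
    Disjoint (cube h κ) (cube h κ') :=
  Set.disjoint_left.2 fun x hx hx' => hne <| funext fun i => by
    rw [← (mem_cube_iff hh).1 hx i, (mem_cube_iff hh).1 hx' i]

theorem exists_finset_cube (hΩ : Bornology.IsBounded Ω) {h : ℝ} (hh : 0 < h) :
    ∃ S : Finset (Fin d → ℤ), Ω ⊆ ⋃ κ ∈ S, cube h κ := by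
  obtain ⟨R, hR⟩ := hΩ.subset_closedBall 0
  refine ⟨Fintype.piFinset fun _ => Finset.Icc ⌊-R / h⌋ ⌊R / h⌋, fun x hx => ?_⟩
  simp only [Set.mem_iUnion]
  refine ⟨fun i => ⌊x i / h⌋, ?_, (mem_cube_iff hh).2 fun i => rfl⟩
  rw [Fintype.mem_piFinset]
  intro i
  have h1 : |x i| ≤ R := by
    have h2 := hR hx
    rw [mem_closedBall_zero_iff] at h2
    exact (PiLp.norm_apply_le x i).trans h2
  obtain ⟨h2, h3⟩ := abs_le.1 h1
  rw [Finset.mem_Icc]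
  constructor <;> gcongr

theorem setIntegral_sq_cube_le (h : ℝ) (κ : Fin d → ℤ) {φ : E d → ℝ} (hφ : ContDiff ℝ 1 φ)
    (hφc : HasCompactSupport φ) :
    ∫ x in cube h κ, φ x ^ 2 ≤ (volume.real (cube h κ))⁻¹ * (∫ x in cube h κ, φ x) ^ 2 +
      d * h ^ 2 * 2 ^ d * ∫ x in cube h κ, ‖fderiv ℝ φ x‖ ^ 2 := by
  have hI : 0 ≤ ∫ x in cube h κ, ‖fderiv ℝ φ x‖ ^ 2 := integral_nonneg fun _ => sq_nonneg _
  have hmain := poincare_convex (measurableSet_cube h κ) (convex_cube h κ) (isBounded_cube h κ)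
    (fun x hx y hy => norm_sub_sq_le_of_mem_cube hx hy) hφ hφc
  rcases (measureReal_nonneg (μ := volume) (s := cube h κ)).eq_or_lt' with h0 | h0
  · have h1 : volume (cube h κ) = 0 :=
      (measureReal_eq_zero_iff (isBounded_cube h κ).measure_lt_top.ne).1 h0
    simp [Measure.restrict_eq_zero.2 h1]
  · set M := volume.real (cube h κ)
    set I := ∫ x in cube h κ, ‖fderiv ℝ φ x‖ ^ 2
    have h2 : 0 ≤ (d : ℝ) * h ^ 2 * 2 ^ d * I := by positivity
    refine le_of_mul_le_mul_left ?_ h0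
    rw [mul_add, mul_inv_cancel_left₀ h0.ne']
    nlinarith [mul_nonneg h0.le h2]

/-- Averages over a finite family of small cubes control the `L²` norm on `H₀¹(Ω)` up to a small
multiple of the gradient. -/
theorem exists_finite_functionals (hΩ : Bornology.IsBounded Ω) {ε : ℝ}
    (hε : 0 < ε) : ∃ (n : ℕ) (L : L2 Ω →L[ℝ] (Fin n → ℝ)), ∀ v : H10 Ω, L (fn v) = 0 →
      ‖fn v‖ ^ 2 ≤ ε * ‖grad v‖ ^ 2 := by
  set h : ℝ := √(ε / ((d + 1) * 2 ^ d)) with hh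
  have hh0 : 0 < h := Real.sqrt_pos.2 (by positivity)
  have hhε : (d : ℝ) * h ^ 2 * 2 ^ d ≤ ε := by
    rw [hh, Real.sq_sqrt (by positivity)]
    calc (d : ℝ) * (ε / ((d + 1) * 2 ^ d)) * 2 ^ d = ε * (d / (d + 1)) := by field_simp
      _ ≤ ε * 1 := by
        gcongr
        rw [div_le_one (by positivity)]
        linarith
      _ = ε := mul_one ε
  obtain ⟨S, hS⟩ := exists_finset_cube hΩ hh0
  have hfin : ∀ κ : Fin d → ℤ, volume.restrict Ω (cube h κ) ≠ ⊤ := fun κ =>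
    ((Measure.restrict_le_self _).trans_lt (isBounded_cube h κ).measure_lt_top).ne
  let l : (Fin d → ℤ) → L2 Ω →L[ℝ] ℝ := fun κ =>
    innerSL ℝ (indicatorConstLp 2 (measurableSet_cube h κ) (hfin κ) (1 : ℝ))
  have hl : ∀ κ f, l κ f = ∫ x in cube h κ, f x ∂(volume.restrict Ω) := fun κ f => by
    simp only [l, innerSL_apply_apply]
    exact L2.inner_indicatorConstLp_one _ _ _
  have key : ∀ v : H10 Ω, ‖fn v‖ ^ 2 ≤
      ∑ κ ∈ S, (volume.real (cube h κ))⁻¹ * (l κ (fn v)) ^ 2 + ε * ‖grad v‖ ^ 2 := by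
    refine le_on_H10 (F := fun p => ‖p.fst‖ ^ 2) (G := fun p =>
      ∑ κ ∈ S, (volume.real (cube h κ))⁻¹ * (l κ p.fst) ^ 2 + ε * ‖p.snd‖ ^ 2)
      (by fun_prop) (by fun_prop) ?_
    rintro p ⟨φ, h1, h2, h3, h4, h5⟩
    have hφ1 : ContDiff ℝ 1 φ := h1.of_le (by exact_mod_cast le_top)
    simp only [norm_fst_sq_of_test h3 h4, norm_snd_sq_of_test h3 h5]
    have hlφ : ∀ κ, l κ p.fst = ∫ x in cube h κ, φ x := fun κ => by
      rw [hl, integral_congr_ae (ae_restrict_of_ae h4),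
        Measure.restrict_restrict (measurableSet_cube h κ)]
      exact (setIntegral_eq_of_subset_of_forall_sdiff_eq_zero (measurableSet_cube h κ)
        Set.inter_subset_left fun x hx => eq_zero_of_notMem h3 fun h => hx.2 ⟨hx.1, h⟩).symm
    have hsum : ∀ {F : E d → ℝ}, Integrable F → ∫ x in ⋃ κ ∈ S, cube h κ, F x =
        ∑ κ ∈ S, ∫ x in cube h κ, F x := fun {F} hF =>
      integral_biUnion_finset S (fun κ _ => measurableSet_cube h κ)
        (fun κ _ κ' _ hne => disjoint_cube hh0 hne) fun κ _ => hF.integrableOn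
    have hg := integrable_norm_fderiv_sq hφ1 h2
    have e1 : ∫ x, φ x ^ 2 = ∑ κ ∈ S, ∫ x in cube h κ, φ x ^ 2 := by
      rw [← hsum (integrable_sq_of_hasCompactSupport hφ1.continuous h2)]
      exact (setIntegral_eq_integral_of_forall_compl_eq_zero fun x hx => by
        rw [eq_zero_of_notMem h3 fun h => hx (hS h)]; simp).symm
    have e2 : ∑ κ ∈ S, ∫ x in cube h κ, ‖fderiv ℝ φ x‖ ^ 2 ≤ ∫ x, ‖fderiv ℝ φ x‖ ^ 2 := by
      rw [← hsum hg]
      exact setIntegral_le_integral hg (Filter.Eventually.of_forall fun x => sq_nonneg _)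
    have hI : 0 ≤ ∫ x, ‖fderiv ℝ φ x‖ ^ 2 := integral_nonneg fun _ => sq_nonneg _
    calc ∫ x, φ x ^ 2 = ∑ κ ∈ S, ∫ x in cube h κ, φ x ^ 2 := e1
      _ ≤ ∑ κ ∈ S, ((volume.real (cube h κ))⁻¹ * (l κ p.fst) ^ 2 +
          d * h ^ 2 * 2 ^ d * ∫ x in cube h κ, ‖fderiv ℝ φ x‖ ^ 2) := by
        refine Finset.sum_le_sum fun κ _ => ?_
        rw [hlφ]
        exact setIntegral_sq_cube_le h κ hφ1 h2
      _ = ∑ κ ∈ S, (volume.real (cube h κ))⁻¹ * (l κ p.fst) ^ 2 +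
          d * h ^ 2 * 2 ^ d * ∑ κ ∈ S, ∫ x in cube h κ, ‖fderiv ℝ φ x‖ ^ 2 := by
        rw [Finset.sum_add_distrib, Finset.mul_sum]
      _ ≤ _ := by gcongr
  refine ⟨S.card, ContinuousLinearMap.pi fun j => l (S.equivFin.symm j), fun v hv => ?_⟩
  refine (key v).trans_eq ?_
  rw [Finset.sum_eq_zero, zero_add]
  intro κ hκ
  have h1 := congrFun hv (S.equivFin ⟨κ, hκ⟩)
  simp only [ContinuousLinearMap.coe_pi', Equiv.symm_apply_apply, Pi.zero_apply] at h1
  rw [h1]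
  simp

end Compactness

section WeakGradient

variable {d : ℕ} {Ω : Set (E d)}

theorem integral_weak_gradient {ψ : E d → ℝ} (hψ : ContDiff ℝ ∞ ψ) (hψc : HasCompactSupport ψ)
    (hψΩ : tsupport ψ ⊆ Ω) (e : E d) (v : H10 Ω) :
    ∫ x in Ω, ψ x * inner ℝ e (grad v x) = -∫ x in Ω, fderiv ℝ ψ x e * fn v x := by
  have hψ1 : ContDiff ℝ 1 ψ := hψ.of_le (by exact_mod_cast le_top)
  have hdψ : Continuous fun x => fderiv ℝ ψ x e :=
    (hψ1.continuous_fderiv (by norm_num)).clm_apply continuous_const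
  have hdψc : HasCompactSupport fun x => fderiv ℝ ψ x e :=
    (hψc.fderiv (𝕜 := ℝ)).mono fun x hx h0 => hx (by simp [h0])
  have hm1 : MemLp (fun x => ψ x • e) 2 (volume.restrict Ω) :=
    ((hψ1.continuous.smul continuous_const).memLp_of_hasCompactSupport
      (hψc.mono fun x hx h0 => hx (by simp [h0]))).restrict Ω
  have hm2 : MemLp (fun x => fderiv ℝ ψ x e) 2 (volume.restrict Ω) :=
    (hdψ.memLp_of_hasCompactSupport hdψc).restrict Ω
  have e1 : ∀ g : Lp (E d) 2 (volume.restrict Ω), inner ℝ (hm1.toLp _) g =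
      ∫ x in Ω, ψ x * inner ℝ e (g x) := fun g => by
    rw [L2.inner_def]
    refine integral_congr_ae (hm1.coeFn_toLp.mono fun x hx => ?_)
    simp only [hx, real_inner_smul_left]
  have e2 : ∀ g : L2 Ω, inner ℝ (hm2.toLp _) g = ∫ x in Ω, fderiv ℝ ψ x e * g x := fun g => by
    rw [L2.inner_def]
    refine integral_congr_ae (hm2.coeFn_toLp.mono fun x hx => ?_)
    simp only [hx]
    exact mul_comm _ _
  rw [← e1, ← e2]
  refine eq_on_H10 (F := fun p => inner ℝ (hm1.toLp _) p.snd)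
    (G := fun p => -inner ℝ (hm2.toLp _) p.fst) (by fun_prop) (by fun_prop) ?_ v
  rintro p ⟨φ, h1, h2, h3, h4, h5⟩
  have hφ1 : ContDiff ℝ 1 φ := h1.of_le (by exact_mod_cast le_top)
  have hdφ : Continuous fun x => fderiv ℝ φ x e :=
    (hφ1.continuous_fderiv (by norm_num)).clm_apply continuous_const
  have e3 : ∫ x in Ω, ψ x * inner ℝ e (p.snd x) = ∫ x, ψ x * fderiv ℝ φ x e := by
    rw [← setIntegral_eq_integral_of_forall_compl_eq_zero (s := Ω)
      (f := fun x => ψ x * fderiv ℝ φ x e) fun x hx => by rw [eq_zero_of_notMem hψΩ hx, zero_mul]]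
    refine integral_congr_ae (h5.mono fun x hx => ?_)
    simp only [hx, gradient]
    rw [real_inner_comm, InnerProductSpace.toDual_symm_apply]
  have e4 : ∫ x in Ω, fderiv ℝ ψ x e * p.fst x = ∫ x, fderiv ℝ ψ x e * φ x := by
    rw [← setIntegral_eq_integral_of_forall_compl_eq_zero (s := Ω)
      (f := fun x => fderiv ℝ ψ x e * φ x) fun x hx => by rw [eq_zero_of_notMem h3 hx, mul_zero]]
    refine integral_congr_ae (h4.mono fun x hx => ?_)
    simp only [hx]
  simp only [e1, e2, e3, e4]
  exact integral_mul_fderiv_eq_neg_fderiv_mul_of_integrable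
    ((hdψ.mul hφ1.continuous).integrable_of_hasCompactSupport (hdψc.mul_right))
    ((hψ1.continuous.mul hdφ).integrable_of_hasCompactSupport (hψc.mul_right))
    ((hψ1.continuous.mul hφ1.continuous).integrable_of_hasCompactSupport (hψc.mul_right))
    (fun x _ => hψ1.differentiable (by norm_num) x) (fun x _ => hφ1.differentiable (by norm_num) x)

theorem eq_zero_of_fn_eq_zero (hΩ : IsOpen Ω) (hb : Bornology.IsBounded Ω) {v : H10 Ω}
    (hv : fn v = 0) : v = 0 := by
  have hfinΩ : IsFiniteMeasure (volume.restrict Ω) :=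
    ⟨by simpa using hb.measure_lt_top⟩
  have hv0 : fn v =ᵐ[volume.restrict Ω] 0 := hv ▸ Lp.coeFn_zero _ _ _
  have hgrad : grad v = 0 := by
    have h1 : ∀ i : Fin d, ∀ᵐ x ∂(volume.restrict Ω),
        inner ℝ (EuclideanSpace.single i (1 : ℝ)) (grad v x) = 0 := by
      intro i
      rw [ae_restrict_iff' hΩ.measurableSet]
      refine hΩ.ae_eq_zero_of_integral_contDiff_smul_eq_zero ?_ fun ψ h1 h2 h3 => ?_
      · have h2 : MemLp (fun x => inner ℝ (EuclideanSpace.single i (1 : ℝ)) (grad v x)) 2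
            (volume.restrict Ω) := (Lp.memLp (grad v)).const_inner _
        exact IntegrableOn.locallyIntegrableOn (h2.integrable one_le_two)
      · have h4 := integral_weak_gradient h1 h2 h3 (EuclideanSpace.single i (1 : ℝ)) v
        have h5 : ∫ x in Ω, fderiv ℝ ψ x (EuclideanSpace.single i (1 : ℝ)) * fn v x = 0 :=
          integral_eq_zero_of_ae (hv0.mono fun x hx => by simp [hx])
        rw [h5, neg_zero] at h4
        rw [← setIntegral_eq_integral_of_forall_compl_eq_zero (s := Ω) fun x hx => by
          rw [eq_zero_of_notMem h3 hx, zero_smul]]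
        simpa using h4
    rw [Lp.eq_zero_iff_ae_eq_zero]
    filter_upwards [ae_all_iff.2 h1] with x hx
    ext i
    simpa [EuclideanSpace.inner_single_left] using hx i
  ext1
  have h2 : v.1.fst = 0 := hv
  have h3 : v.1.snd = 0 := hgrad
  exact WithLp.ofLp_injective 2 (Prod.ext h2 h3)

end WeakGradient

section EnergyForm

variable {d : ℕ} {Ω : Set (E d)} {A : E d → Matrix (Fin d) (Fin d) ℝ}

theorem mulVec_dotProduct_eq_sum (M : Matrix (Fin d) (Fin d) ℝ) (g h : Fin d → ℝ) :
    M.mulVec g ⬝ᵥ h = ∑ p, ∑ q, M p q * (g q * h p) := by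
  simp only [dotProduct, Matrix.mulVec, Finset.sum_mul, mul_assoc]

theorem IsDiffusion.integrable (hΩ : IsOpen Ω) (hA : IsDiffusion Ω A)
    (g h : Lp (E d) 2 (volume.restrict Ω)) :
    Integrable (fun x => (A x).mulVec (WithLp.ofLp (g x)) ⬝ᵥ WithLp.ofLp (h x))
      (volume.restrict Ω) := by
  obtain ⟨M, hM⟩ := hA.bounded
  simp only [mulVec_dotProduct_eq_sum]
  refine integrable_finsetSum _ fun p _ => integrable_finsetSum _ fun q _ => ?_
  exact (MemLp.integrable_mul ((Lp.memLp g).eval_piLp q) ((Lp.memLp h).eval_piLp p)).bdd_mul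
    (hA.measurable p q) ((ae_restrict_iff' hΩ.measurableSet).2
      (Filter.Eventually.of_forall fun x hx => hM x hx p q))

theorem grad_add_ae (u v : H10 Ω) :
    grad (u + v) =ᵐ[volume.restrict Ω] fun x => grad u x + grad v x :=
  Lp.coeFn_add (grad u) (grad v)

theorem grad_smul_ae (c : ℝ) (u : H10 Ω) :
    grad (c • u) =ᵐ[volume.restrict Ω] fun x => c • grad u x :=
  Lp.coeFn_smul c (grad u)

theorem aForm_add_left (hΩ : IsOpen Ω) (hA : IsDiffusion Ω A) (u v w : H10 Ω) :
    aForm A (u + v) w = aForm A u w + aForm A v w := by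
  rw [aForm, aForm, aForm, ← integral_add (hA.integrable hΩ _ _) (hA.integrable hΩ _ _)]
  refine integral_congr_ae ((grad_add_ae u v).mono fun x hx => ?_)
  simp only [hx, WithLp.ofLp_add, Matrix.mulVec_add, add_dotProduct]

theorem aForm_smul_left (c : ℝ) (u v : H10 Ω) : aForm A (c • u) v = c * aForm A u v := by
  rw [aForm, aForm, ← integral_const_mul]
  refine integral_congr_ae ((grad_smul_ae c u).mono fun x hx => ?_)
  simp only [hx, WithLp.ofLp_smul, Matrix.mulVec_smul, smul_dotProduct, smul_eq_mul]

theorem aForm_comm (hΩ : IsOpen Ω) (hA : IsDiffusion Ω A) (u v : H10 Ω) :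
    aForm A u v = aForm A v u := by
  refine setIntegral_congr_fun hΩ.measurableSet fun x hx => ?_
  rw [dotProduct_comm, Matrix.dotProduct_mulVec, ← Matrix.mulVec_transpose, (hA.symm x hx).eq]

theorem IsDiffusion.coercive (hΩ : IsOpen Ω) (hA : IsDiffusion Ω A) :
    ∃ c : ℝ, 0 < c ∧ ∀ v : H10 Ω, c * ‖grad v‖ ^ 2 ≤ aForm A v v := by
  obtain ⟨c, hc, h⟩ := hA.elliptic
  refine ⟨c, hc, fun v => ?_⟩
  have hi : Integrable (fun x => ‖grad v x‖ ^ 2) (volume.restrict Ω) :=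
    (Lp.memLp (grad v)).integrable_norm_pow (by norm_num)
  rw [norm_sq_eq_setIntegral, ← integral_const_mul, aForm]
  refine setIntegral_mono_on (hi.const_mul c) (hA.integrable hΩ _ _) hΩ.measurableSet
    fun x hx => ?_
  have h1 := h x hx (WithLp.ofLp (grad v x))
  rw [dotProduct_comm _ ((A x).mulVec _)] at h1
  refine le_trans (le_of_eq ?_) h1
  rw [EuclideanSpace.norm_sq_eq, dotProduct]
  simp only [Real.norm_eq_abs, sq_abs, ← sq]

theorem IsDiffusion.continuous (hΩ : IsOpen Ω) (hA : IsDiffusion Ω A) :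
    ∃ K : ℝ, 0 ≤ K ∧ ∀ v : H10 Ω, aForm A v v ≤ K * ‖grad v‖ ^ 2 := by
  obtain ⟨M, hM⟩ := hA.bounded
  refine ⟨|M| * (d * d), by positivity, fun v => ?_⟩
  have hi : Integrable (fun x => ‖grad v x‖ ^ 2) (volume.restrict Ω) :=
    (Lp.memLp (grad v)).integrable_norm_pow (by norm_num)
  rw [norm_sq_eq_setIntegral, ← integral_const_mul, aForm]
  refine setIntegral_mono_on (hA.integrable hΩ _ _) (hi.const_mul _) hΩ.measurableSet
    fun x hx => ?_
  rw [mulVec_dotProduct_eq_sum]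
  calc ∑ p, ∑ q, A x p q * (grad v x q * grad v x p)
      ≤ ∑ _p : Fin d, ∑ _q : Fin d, |M| * ‖grad v x‖ ^ 2 := by
        refine Finset.sum_le_sum fun p _ => Finset.sum_le_sum fun q _ => ?_
        refine (le_abs_self _).trans ?_
        rw [abs_mul, abs_mul, sq]
        have h1 : |A x p q| ≤ |M| := (hM x hx p q).trans (le_abs_self M)
        have h2 := PiLp.norm_apply_le (grad v x) q
        have h3 := PiLp.norm_apply_le (grad v x) p
        rw [Real.norm_eq_abs] at h2 h3
        gcongr
    _ = |M| * (d * d) * ‖grad v x‖ ^ 2 := by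
        simp only [Finset.sum_const, Finset.card_univ, Fintype.card_fin, nsmul_eq_mul]
        ring

theorem norm_sq_H10 (v : H10 Ω) : ‖v‖ ^ 2 = ‖fn v‖ ^ 2 + ‖grad v‖ ^ 2 :=
  WithLp.prod_norm_sq_eq_of_L2 v.1

theorem exists_norm_le (hd : 0 < d) (hΩ : IsBoundedDomain Ω) (hA : IsDiffusion Ω A) :
    ∃ C : ℝ, 0 ≤ C ∧ ∀ v : H10 Ω, ‖v‖ ^ 2 ≤ C * aForm A v v := by
  obtain ⟨C, hC, h1⟩ := exists_norm_fn_le hd hΩ.isBounded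
  obtain ⟨c, hc, h2⟩ := hA.coercive hΩ.isOpen
  refine ⟨(C + 1) / c, by positivity, fun v => ?_⟩
  rw [norm_sq_H10]
  calc ‖fn v‖ ^ 2 + ‖grad v‖ ^ 2 ≤ (C + 1) * ‖grad v‖ ^ 2 := by linarith [h1 v]
    _ = (C + 1) / c * (c * ‖grad v‖ ^ 2) := by field_simp
    _ ≤ _ := by gcongr; exact h2 v

theorem l2Form_eq_inner (f g : L2 Ω) : l2Form f g = inner ℝ f g := by
  rw [L2.inner_def, l2Form]
  exact integral_congr_ae (Filter.Eventually.of_forall fun x => mul_comm _ _)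

theorem bForm_eq_inner (u v : H10 Ω) : bForm u v = inner ℝ (fn u) (fn v) := l2Form_eq_inner _ _

theorem bNorm_eq_norm (u : H10 Ω) : bNorm u = ‖fn u‖ := by
  rw [bNorm, bForm_eq_inner, real_inner_self_eq_norm_sq, Real.sqrt_sq (norm_nonneg _)]

end EnergyForm

section EnergySpace

variable {d : ℕ} {Ω : Set (E d)} {A : E d → Matrix (Fin d) (Fin d) ℝ}

/-- The space `H₀¹(Ω)` with the inner product `a(·, ·)`. -/
def EnergySpace (_hd : 0 < d) (_hΩ : IsBoundedDomain Ω) (_hA : IsDiffusion Ω A) : Type := H10 Ω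

namespace EnergySpace

variable (hd : 0 < d) (hΩ : IsBoundedDomain Ω) (hA : IsDiffusion Ω A)

/-- The energy inner product. -/
@[reducible] noncomputable def core : InnerProductSpace.Core ℝ (H10 Ω) where
  inner := aForm A
  conj_inner_symm u v := aForm_comm hΩ.isOpen hA v u
  re_inner_nonneg v := by
    obtain ⟨c, hc, h⟩ := hA.coercive hΩ.isOpen
    exact (mul_nonneg hc.le (sq_nonneg _)).trans (h v)
  add_left := aForm_add_left hΩ.isOpen hA
  smul_left u v c := aForm_smul_left c u v
  definite v hv := by
    obtain ⟨C, hC, h⟩ := exists_norm_le hd hΩ hA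
    have h1 := h v
    rw [hv, mul_zero] at h1
    exact norm_eq_zero.1 (pow_eq_zero_iff two_ne_zero |>.1 (le_antisymm h1 (sq_nonneg _)))

noncomputable instance : NormedAddCommGroup (EnergySpace hd hΩ hA) :=
  (core hd hΩ hA).toNormedAddCommGroup

noncomputable instance : InnerProductSpace ℝ (EnergySpace hd hΩ hA) :=
  InnerProductSpace.ofCore (core hd hΩ hA).toCore

/-- The identity from `H₀¹(Ω)` to the energy space. -/
def equiv : H10 Ω ≃ₗ[ℝ] EnergySpace hd hΩ hA where
  toFun v := v
  invFun v := v
  map_add' _ _ := rfl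
  map_smul' _ _ := rfl
  left_inv _ := rfl
  right_inv _ := rfl

theorem inner_equiv (u v : H10 Ω) :
    inner ℝ (equiv hd hΩ hA u) (equiv hd hΩ hA v) = aForm A u v := rfl

theorem norm_equiv_sq (v : H10 Ω) : ‖equiv hd hΩ hA v‖ ^ 2 = aForm A v v := by
  rw [← real_inner_self_eq_norm_sq, inner_equiv]

theorem norm_equiv (v : H10 Ω) : ‖equiv hd hΩ hA v‖ = aNorm A v := by
  rw [aNorm, ← norm_equiv_sq hd hΩ hA, Real.sqrt_sq (norm_nonneg _)]

theorem exists_bounds : ∃ K C : ℝ, (∀ v : H10 Ω, ‖equiv hd hΩ hA v‖ ≤ K * ‖v‖) ∧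
    ∀ v : EnergySpace hd hΩ hA, ‖(equiv hd hΩ hA).symm v‖ ≤ C * ‖v‖ := by
  obtain ⟨K, hK, h1⟩ := hA.continuous hΩ.isOpen
  obtain ⟨C, hC, h2⟩ := exists_norm_le hd hΩ hA
  refine ⟨√K, √C, fun v => ?_, fun v => ?_⟩
  · refine le_of_sq_le_sq ?_ (by positivity)
    rw [norm_equiv_sq, mul_pow, Real.sq_sqrt hK, norm_sq_H10]
    refine (h1 v).trans ?_
    gcongr
    linarith [sq_nonneg ‖fn v‖]
  · obtain ⟨w, rfl⟩ := (equiv hd hΩ hA).surjective v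
    refine le_of_sq_le_sq ?_ (by positivity)
    rw [LinearEquiv.symm_apply_apply, mul_pow, Real.sq_sqrt hC, norm_equiv_sq]
    exact h2 w

/-- The identity from `H₀¹(Ω)` to the energy space, as an isomorphism of topological vector
spaces. -/
noncomputable def equivL : H10 Ω ≃L[ℝ] EnergySpace hd hΩ hA :=
  (equiv hd hΩ hA).toContinuousLinearEquivOfBounds _ _
    (exists_bounds hd hΩ hA).choose_spec.choose_spec.1
    (exists_bounds hd hΩ hA).choose_spec.choose_spec.2

instance : CompleteSpace (EnergySpace hd hΩ hA) := by
  have h1 : CompleteSpace (H10 Ω) :=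
    (testPairs Ω).isClosed_topologicalClosure.completeSpace_coe
  exact (completeSpace_congr (e := (equiv hd hΩ hA).toEquiv)
    (equivL hd hΩ hA).isUniformEmbedding).1 h1

/-- The embedding of the energy space in `L²(Ω)`. -/
noncomputable def toL2 : EnergySpace hd hΩ hA →L[ℝ] L2 Ω :=
  (WithLp.fstL 2 ℝ (Lp ℝ 2 (volume.restrict Ω)) (Lp (E d) 2 (volume.restrict Ω))).comp
    ((H10 Ω).subtypeL.comp (equivL hd hΩ hA).symm.toContinuousLinearMap)

theorem toL2_equiv (v : H10 Ω) : toL2 hd hΩ hA (equiv hd hΩ hA v) = fn v := rfl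

theorem toL2_injective : Function.Injective (toL2 hd hΩ hA) := by
  refine (injective_iff_map_eq_zero _).2 fun v hv => ?_
  obtain ⟨w, rfl⟩ := (equiv hd hΩ hA).surjective v
  rw [toL2_equiv] at hv
  rw [eq_zero_of_fn_eq_zero hΩ.isOpen hΩ.isBounded hv, map_zero]

theorem finiteRankApprox : Galerkin.FiniteRankApprox (toL2 hd hΩ hA) := by
  intro ε hε
  obtain ⟨c, hc, h⟩ := hA.coercive hΩ.isOpen
  obtain ⟨n, L, hL⟩ := exists_finite_functionals hΩ.isBounded (ε := ε ^ 2 * c) (by positivity)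
  refine ⟨n, L.comp (toL2 hd hΩ hA), fun v hv => ?_⟩
  obtain ⟨w, rfl⟩ := (equiv hd hΩ hA).surjective v
  refine le_of_sq_le_sq ?_ (by positivity)
  rw [mul_pow, norm_equiv_sq, toL2_equiv]
  refine (hL w hv).trans ?_
  rw [mul_assoc]
  gcongr
  exact h w

end EnergySpace

end EnergySpace

section FiniteElements

variable {d : ℕ} {Ω : Set (E d)}

theorem Mesh.Refines.feSpace_le {T T' : Mesh Ω} (h : T'.Refines T) : feSpace T ≤ feSpace T' := by
  rintro v ⟨φ, h1, h2, h3⟩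
  refine ⟨φ, h1, h2, fun K' hK' => ?_⟩
  obtain ⟨K, hK, hKK⟩ := h K' hK'
  obtain ⟨g, hg⟩ := h3 K hK
  exact ⟨g, hg.mono (Set.inter_subset_inter_left _ hKK)⟩

theorem feSpace_finiteDimensional (hΩ : IsBoundedDomain Ω) (T : Mesh Ω) :
    FiniteDimensional ℝ (feSpace T) := by
  classical
  have hfin : Finite T.cells := T.finite.to_subtype
  have hcell : ∀ x : Ω, ∃ K : T.cells, x.1 ∈ K.1 := fun x => by
    have h1 : x.1 ∈ ⋃₀ T.cells := T.cover ▸ subset_closure x.2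
    obtain ⟨K, hK, hx⟩ := h1
    exact ⟨⟨K, hK⟩, hx⟩
  choose c hc using hcell
  let G := T.cells → (E d →ᵃ[ℝ] ℝ)
  let Ψ : G → E d → ℝ := fun g x => if hx : x ∈ Ω then g (c ⟨x, hx⟩) x else 0
  have hΨ : ∀ (g : G) (x : E d) (hx : x ∈ Ω), Ψ g x = g (c ⟨x, hx⟩) x := fun g x hx => dif_pos hx
  have hmem : ∀ᵐ x ∂(volume.restrict Ω), x ∈ Ω := ae_restrict_mem hΩ.isOpen.measurableSet
  let S : Submodule ℝ (G × H10 Ω) :=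
    { carrier := {p | fn p.2 =ᵐ[volume.restrict Ω] Ψ p.1}
      zero_mem' := by
        filter_upwards [hmem, Lp.coeFn_zero ℝ 2 (volume.restrict Ω)] with x hx h0
        rw [hΨ _ _ hx]
        exact h0
      add_mem' := by
        rintro p q hp hq
        filter_upwards [hmem, hp, hq, Lp.coeFn_add (fn p.2) (fn q.2)] with x hx h1 h2 h3
        refine h3.trans ?_
        rw [Pi.add_apply, h1, h2, hΨ _ _ hx, hΨ _ _ hx, hΨ _ _ hx]
        rfl
      smul_mem' := by
        rintro a p hp
        filter_upwards [hmem, hp, Lp.coeFn_smul a (fn p.2)] with x hx h1 h2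
        refine h2.trans ?_
        rw [Pi.smul_apply, h1, hΨ _ _ hx, hΨ _ _ hx]
        rfl }
  have hS : FiniteDimensional ℝ S := by
    have hinj : Function.Injective ((LinearMap.fst ℝ G (H10 Ω)).comp S.subtype) := by
      refine (injective_iff_map_eq_zero _).2 ?_
      rintro ⟨⟨g, v⟩, hp⟩ h0
      have hg : g = 0 := h0
      subst hg
      have hv : fn v = 0 := by
        rw [Lp.eq_zero_iff_ae_eq_zero]
        filter_upwards [hmem, hp] with x hx h1
        rw [h1, hΨ _ _ hx]
        rfl
      have hv0 := eq_zero_of_fn_eq_zero hΩ.isOpen hΩ.isBounded hv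
      subst hv0
      rfl
    exact FiniteDimensional.of_injective _ hinj
  refine Submodule.finiteDimensional_of_le (S₂ := S.map (LinearMap.snd ℝ G (H10 Ω))) ?_
  rintro v ⟨φ, -, h2, h3⟩
  choose! g hg using h3
  refine ⟨(fun K => g K.1, v), ?_, rfl⟩
  change fn v =ᵐ[volume.restrict Ω] Ψ fun K => g K.1
  filter_upwards [hmem, h2] with x hx h1
  rw [h1]
  exact (hg _ (c ⟨x, hx⟩).2 ⟨hc ⟨x, hx⟩, hx⟩).trans (hΨ (fun K => g K.1) x hx).symm

end FiniteElements

section Translation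

variable {d : ℕ} {Ω : Set (E d)} {A : E d → Matrix (Fin d) (Fin d) ℝ}

namespace EnergySpace

open Galerkin

variable (hd : 0 < d) (hΩ : IsBoundedDomain Ω) (hA : IsDiffusion Ω A)

/-- A subspace of `H₀¹(Ω)` as a subspace of the energy space. -/
noncomputable def sub (X : Submodule ℝ (H10 Ω)) : Submodule ℝ (EnergySpace hd hΩ hA) :=
  X.map (equiv hd hΩ hA).toLinearMap

variable {X Y : Submodule ℝ (H10 Ω)}

theorem equiv_mem_sub {v : H10 Ω} : equiv hd hΩ hA v ∈ sub hd hΩ hA X ↔ v ∈ X :=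
  ⟨fun ⟨_, hw, h⟩ => (equiv hd hΩ hA).injective h ▸ hw, fun h => ⟨v, h, rfl⟩⟩

theorem sub_top : sub hd hΩ hA ⊤ = ⊤ := by
  rw [sub, Submodule.map_top, LinearEquiv.range]

theorem sub_mono (h : X ≤ Y) : sub hd hΩ hA X ≤ sub hd hΩ hA Y := Submodule.map_mono h

theorem finrank_sub : Module.finrank ℝ (sub hd hΩ hA X) = Module.finrank ℝ X :=
  LinearEquiv.finrank_map_eq (equiv hd hΩ hA) X

instance [FiniteDimensional ℝ X] : FiniteDimensional ℝ (sub hd hΩ hA X) :=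
  inferInstanceAs (FiniteDimensional ℝ (X.map (equiv hd hΩ hA).toLinearMap))

theorem sub_sup_span (v : H10 Ω) : sub hd hΩ hA (X ⊔ Submodule.span ℝ {v}) =
    sub hd hΩ hA X ⊔ Submodule.span ℝ {equiv hd hΩ hA v} := by
  rw [sub, Submodule.map_sup, Submodule.map_span, Set.image_singleton]
  rfl

theorem inner_toL2 (u v : H10 Ω) :
    inner ℝ (toL2 hd hΩ hA (equiv hd hΩ hA u)) (toL2 hd hΩ hA (equiv hd hΩ hA v)) = bForm u v := by
  rw [toL2_equiv, toL2_equiv, bForm_eq_inner]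

theorem eigenpair_iff {lam : ℝ} {u : H10 Ω} :
    Eigenpair (toL2 hd hΩ hA) (sub hd hΩ hA X) lam (equiv hd hΩ hA u) ↔
      IsEigenpair A X lam u := by
  refine and_congr (equiv_mem_sub hd hΩ hA) (and_congr ?_ ?_)
  · exact not_congr (LinearEquiv.map_eq_zero_iff _)
  · constructor
    · intro h v hv
      have h1 := h _ ((equiv_mem_sub hd hΩ hA).2 hv)
      rwa [inner_equiv, inner_toL2] at h1
    · rintro h _ ⟨v, hv, rfl⟩
      have h1 := h v hv
      rwa [← inner_toL2 hd hΩ hA, ← inner_equiv hd hΩ hA] at h1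

theorem sub_eigenSpan (t : ℝ) : sub hd hΩ hA (eigenSpan A X t) =
    specSpan (toL2 hd hΩ hA) (sub hd hΩ hA X) t := by
  rw [sub, eigenSpan, Submodule.map_span, specSpan]
  congr 1
  ext w
  constructor
  · rintro ⟨u, ⟨s, hs, hu⟩, rfl⟩
    exact ⟨s, hs, (eigenpair_iff hd hΩ hA).2 hu⟩
  · rintro ⟨s, hs, hw⟩
    obtain ⟨u, rfl⟩ := (equiv hd hΩ hA).surjective w
    exact ⟨u, ⟨s, hs, (eigenpair_iff hd hΩ hA).1 hw⟩, rfl⟩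

theorem specVal_sub (X : Submodule ℝ (H10 Ω)) (j : ℕ) :
    specVal (toL2 hd hΩ hA) (sub hd hΩ hA X) j = eigenvalue A X j := by
  have h : ∀ t, Module.rank ℝ (specSpan (toL2 hd hΩ hA) (sub hd hΩ hA X) t) =
      Module.rank ℝ (eigenSpan A X t) := fun t => by
    rw [← sub_eigenSpan]
    exact LinearEquiv.rank_map_eq (equiv hd hΩ hA) _
  rw [specVal, eigenvalue]
  simp only [h]

theorem specVal_top (j : ℕ) : specVal (toL2 hd hΩ hA) ⊤ j = exactEigenvalue Ω A j := by
  rw [← sub_top hd hΩ hA, specVal_sub]; rfl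

theorem aDist_eq (X : Submodule ℝ (H10 Ω)) [FiniteDimensional ℝ X] (w : H10 Ω) : aDist A w X =
    ‖equiv hd hΩ hA w - (sub hd hΩ hA X).starProjection (equiv hd hΩ hA w)‖ := by
  refine IsLeast.csInf_eq ⟨?_, ?_⟩
  · obtain ⟨v, hv, hv'⟩ := (sub hd hΩ hA X).starProjection_apply_mem (equiv hd hΩ hA w)
    refine ⟨v, hv, ?_⟩
    rw [← hv', ← norm_equiv hd hΩ hA, map_sub]
    rfl
  · rintro _ ⟨v, hv, rfl⟩
    rw [Submodule.starProjection_minimal, ← norm_equiv hd hΩ hA, map_sub]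
    exact ciInf_le ⟨0, by rintro _ ⟨_, rfl⟩; exact norm_nonneg _⟩
      (⟨_, (equiv_mem_sub hd hΩ hA).2 hv⟩ : sub hd hΩ hA X)

theorem aDist_le (X : Submodule ℝ (H10 Ω)) [FiniteDimensional ℝ X] (w : H10 Ω) :
    aDist A w X ≤ ‖equiv hd hΩ hA w‖ := by
  rw [aDist_eq hd hΩ hA, Submodule.starProjection_minimal]
  refine (ciInf_le ⟨0, by rintro _ ⟨_, rfl⟩; exact norm_nonneg _⟩ (0 : sub hd hΩ hA X)).trans ?_
  simp

theorem norm_sub_starProjection_le_deltaApprox (X : Submodule ℝ (H10 Ω)) [FiniteDimensional ℝ X]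
    {lam : ℝ} {u : H10 Ω} (hu : IsEigenpair A ⊤ lam u) (hu1 : aNorm A u = 1) :
    ‖equiv hd hΩ hA u - (sub hd hΩ hA X).starProjection (equiv hd hΩ hA u)‖ ≤
      deltaApprox A X lam := by
  rw [← aDist_eq]
  refine le_csSup ⟨1, ?_⟩ ⟨u, hu, hu1, rfl⟩
  rintro _ ⟨w, -, hw, rfl⟩
  exact (aDist_le hd hΩ hA X w).trans_eq ((norm_equiv hd hΩ hA w).trans hw)

include hd hΩ hA in
theorem aDist_nonneg (X : Submodule ℝ (H10 Ω)) [FiniteDimensional ℝ X] (w : H10 Ω) :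
    0 ≤ aDist A w X := by
  rw [aDist_eq hd hΩ hA]
  exact norm_nonneg _

include hd hΩ hA in
theorem eta_nonneg (X : Submodule ℝ (H10 Ω)) [FiniteDimensional ℝ X] : 0 ≤ eta A X := by
  refine Real.sSup_nonneg ?_
  rintro _ ⟨f, w, -, -, rfl⟩
  exact aDist_nonneg hd hΩ hA X w

theorem etaBound (X : Submodule ℝ (H10 Ω)) [FiniteDimensional ℝ X] :
    EtaBound (toL2 hd hΩ hA) (sub hd hΩ hA X) (eta A X) := by
  intro w hw
  set J := toL2 hd hΩ hA
  rcases eq_or_ne (J w) 0 with h0 | h0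
  · rw [h0, norm_zero]
    exact mul_nonneg (eta_nonneg hd hΩ hA X) (norm_nonneg _)
  set f : L2 Ω := (‖J w‖)⁻¹ • J w with hf
  have hf1 : ‖f‖ = 1 := norm_smul_inv_norm h0
  set t := J.adjoint f with ht
  obtain ⟨t', ht'⟩ := (equiv hd hΩ hA).surjective t
  set P := (sub hd hΩ hA X).starProjection
  have h1 : ‖J w‖ = inner ℝ (t - P t) w := by
    rw [inner_sub_left, (Submodule.mem_orthogonal _ _).1 hw _
      ((sub hd hΩ hA X).starProjection_apply_mem t), sub_zero, ht,
      ContinuousLinearMap.adjoint_inner_left, hf, real_inner_smul_left, real_inner_self_eq_norm_sq]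
    have := norm_ne_zero_iff.2 h0
    field_simp
  have h2 : ‖t - P t‖ ≤ eta A X := by
    rw [← ht', ← aDist_eq]
    refine le_csSup ⟨‖J‖, ?_⟩ ⟨f, t', ?_, fun v => ?_, rfl⟩
    · rintro _ ⟨g, z, hg, hz, rfl⟩
      rw [l2Form_eq_inner, real_inner_self_eq_norm_sq, Real.sqrt_sq (norm_nonneg _)] at hg
      refine (aDist_le hd hΩ hA X z).trans ?_
      have h3 : ‖equiv hd hΩ hA z‖ ^ 2 ≤ ‖J‖ * ‖equiv hd hΩ hA z‖ := by
        rw [norm_equiv_sq, hz, l2Form_eq_inner]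
        refine (real_inner_le_norm _ _).trans ?_
        rw [hg, one_mul, ← toL2_equiv hd hΩ hA]
        exact J.le_opNorm _
      rcases (norm_nonneg (equiv hd hΩ hA z)).eq_or_lt' with h4 | h4
      · rw [h4]; exact norm_nonneg J
      · rw [sq] at h3
        exact le_of_mul_le_mul_right h3 h4
    · rw [l2Form_eq_inner, real_inner_self_eq_norm_sq, hf1, one_pow, Real.sqrt_one]
    · rw [← inner_equiv hd hΩ hA, ht', ht, ContinuousLinearMap.adjoint_inner_left,
        l2Form_eq_inner, toL2_equiv]
  rw [h1]
  exact (real_inner_le_norm _ _).trans (by gcongr)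

theorem norm_equiv_eq_one {v : H10 Ω} (hv : aForm A v v = 1) : ‖equiv hd hΩ hA v‖ = 1 := by
  rw [norm_equiv, aNorm, hv, Real.sqrt_one]

/-- A pair of `ℝ × H₀¹(Ω)` in the energy space. -/
noncomputable def pair (p : ℝ × H10 Ω) : ℝ × EnergySpace hd hΩ hA := (p.1, equiv hd hΩ hA p.2)

theorem correction_of_isCorrection {θ lam : ℝ} {p q : ℝ × H10 Ω}
    (h : IsCorrection A θ lam X Y p q) : Correction (toL2 hd hΩ hA) θ lam (sub hd hΩ hA X)
      (sub hd hΩ hA Y) (pair hd hΩ hA p) (pair hd hΩ hA q) := by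
  obtain ⟨uhat, h1, ut, h2, h3, h4, h5, h6, h7⟩ := h
  refine ⟨equiv hd hΩ hA uhat, (equiv_mem_sub hd hΩ hA).2 h1, equiv hd hΩ hA ut,
    (equiv_mem_sub hd hΩ hA).2 h2, ?_, ?_, ?_, norm_equiv_eq_one hd hΩ hA h6, ?_⟩
  · rintro _ ⟨v, hv, rfl⟩
    have h8 := h3 v hv
    rwa [← inner_toL2 hd hΩ hA, ← inner_equiv hd hΩ hA] at h8
  · rw [pair, ← map_sub, ← map_sub, norm_equiv, norm_equiv]
    exact h4
  · rw [← sub_sup_span]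
    exact (eigenpair_iff hd hΩ hA).2 h5
  · intro s w hw
    rw [← sub_sup_span] at hw
    obtain ⟨w, rfl⟩ := (equiv hd hΩ hA).surjective w
    have h8 := h7 s w ((eigenpair_iff hd hΩ hA).1 hw)
    simpa only [one_div, pair] using h8

theorem gapBound {i : ℕ} {g : ℝ} (h : IsGapBound A X (i + 1) g) :
    GapBound (toL2 hd hΩ hA) (sub hd hΩ hA X) (exactEigenvalue Ω A (i + 1)) g i := by
  intro j hj hji
  rw [finrank_sub] at hj
  have h1 := h (j + 1) (by omega) (by omega) (by omega)
  rwa [one_div, one_div, ← specVal_sub hd hΩ hA] at h1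

theorem exists_exact (X : Submodule ℝ (H10 Ω)) [FiniteDimensional ℝ X] {k : ℕ}
    (hk : k < Module.finrank ℝ X) :
    (∃ u : H10 Ω, IsEigenpair A ⊤ (exactEigenvalue Ω A (k + 1)) u ∧ aForm A u u = 1) ∧
    (∃ W : Submodule ℝ (EnergySpace hd hΩ hA), Module.finrank ℝ W = k + 1 ∧
      ∀ v ∈ W, ‖v‖ ^ 2 ≤ exactEigenvalue Ω A (k + 1) * ‖toL2 hd hΩ hA v‖ ^ 2) ∧
    exactEigenvalue Ω A (k + 1) ≤ eigenvalue A X (k + 1) := by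
  rw [← finrank_sub hd hΩ hA] at hk
  obtain ⟨B⟩ := exists_eigenBasis (toL2 hd hΩ hA) (toL2_injective hd hΩ hA) (sub hd hΩ hA X)
  have h1 := B.exists_exact (finiteRankApprox hd hΩ hA) (toL2_injective hd hΩ hA) ⟨k, hk⟩
  have h2 := B.specVal_top_le (finiteRankApprox hd hΩ hA) (toL2_injective hd hΩ hA) ⟨k, hk⟩
  rw [← B.specVal_eq ⟨k, hk⟩, specVal_sub] at h2
  rw [specVal_top] at h1 h2
  obtain ⟨⟨u, hu, hu1⟩, W, -, hWd, hW⟩ := h1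
  obtain ⟨u, rfl⟩ := (equiv hd hΩ hA).surjective u
  rw [← sub_top hd hΩ hA, eigenpair_iff] at hu
  refine ⟨⟨u, hu, ?_⟩, ⟨W, hWd, hW⟩, h2⟩
  rw [← norm_equiv_sq hd hΩ hA, hu1, one_pow]

theorem exactEigenvalue_one_mul_le (v : EnergySpace hd hΩ hA) :
    exactEigenvalue Ω A 1 * ‖toL2 hd hΩ hA v‖ ^ 2 ≤ ‖v‖ ^ 2 := by
  rw [← specVal_top hd hΩ hA]
  exact specVal_one_mul_le (finiteRankApprox hd hΩ hA) v

include hd hΩ hA in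
theorem exactEigenvalue_one_le {lam : ℝ} {u : H10 Ω} (hu : IsEigenpair A ⊤ lam u) :
    exactEigenvalue Ω A 1 ≤ lam := by
  have h1 := (eigenpair_iff hd hΩ hA).2 hu
  have h2 := exactEigenvalue_one_mul_le hd hΩ hA (equiv hd hΩ hA u)
  rw [h1.norm_sq] at h2
  refine le_of_mul_le_mul_right h2 ?_
  have h3 := norm_pos_iff.2 ((map_ne_zero_iff _ (toL2_injective hd hΩ hA)).2 h1.2.1)
  positivity

include hd hΩ hA in
theorem eigenvalue_pos {lam : ℝ} {u : H10 Ω} (hu : IsEigenpair A X lam u) : 0 < lam :=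
  ((eigenpair_iff hd hΩ hA).2 hu).pos

end EnergySpace

theorem le_finrank_of_isEigenpair (hd : 0 < d) (hΩ : IsBoundedDomain Ω) (hA : IsDiffusion Ω A)
    {X : Submodule ℝ (H10 Ω)} [FiniteDimensional ℝ X] {i : ℕ} {u : H10 Ω}
    (h : IsEigenpair A X (eigenvalue A X i) u) : i ≤ Module.finrank ℝ X := by
  by_contra! hlt
  have hpos := EnergySpace.eigenvalue_pos hd hΩ hA h
  refine hpos.ne' ?_
  rw [eigenvalue]
  convert Real.sInf_empty
  rw [Set.eq_empty_iff_forall_notMem]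
  intro t ht
  have h1 : eigenSpan A X t ≤ X := by
    refine Submodule.span_le.2 ?_
    rintro w ⟨s, -, hw⟩
    exact hw.1
  have h2 : (i : Cardinal) ≤ Module.rank ℝ (eigenSpan A X t) := ht
  have h3 := h2.trans (Submodule.rank_mono h1)
  rw [← Module.finrank_eq_rank, Nat.cast_le] at h3
  omega

theorem smallEta_of_mul_lt_one {lam1 L g η lb D : ℝ} (h1 : 0 < lam1) (h1L : lam1 ≤ L) (hg : 0 < g)
    (hη : 0 ≤ η) (hlb : L ≤ lb)
    (hD : √lam1 * D = 2 * L * (1 + 1 / (lam1 * g)) + lb * √(1 + 1 / (lam1 * g ^ 2) * η ^ 2))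
    (hDη : D * η < 1) : Galerkin.SmallEta lam1 L g η := by
  have hL : 0 < L := h1.trans_le h1L
  have hs : 0 < √lam1 := Real.sqrt_pos.2 h1
  have hs2 : √lam1 ^ 2 = lam1 := Real.sq_sqrt h1.le
  have hroot : 1 ≤ √(1 + 1 / (lam1 * g ^ 2) * η ^ 2) := by
    rw [Real.one_le_sqrt]
    have : 0 ≤ 1 / (lam1 * g ^ 2) * η ^ 2 := by positivity
    linarith
  have h2 : 3 * L + 2 * L / (lam1 * g) ≤ √lam1 * D := by
    rw [hD]
    have h3 : L * 1 ≤ lb * √(1 + 1 / (lam1 * g ^ 2) * η ^ 2) := by gcongr; linarith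
    have h4 : 2 * L * (1 + 1 / (lam1 * g)) = 2 * L + 2 * L / (lam1 * g) := by ring
    linarith
  set s := √lam1
  set a := 3 * L * η with ha
  set b := 2 * L / (lam1 * g) * η with hb
  have ha0 : 0 ≤ a := by positivity
  have hb0 : 0 ≤ b := by positivity
  have hab : a + b ≤ s := by
    calc a + b = (3 * L + 2 * L / (lam1 * g)) * η := by rw [ha, hb]; ring
      _ ≤ s * D * η := by gcongr
      _ = s * (D * η) := by ring
      _ ≤ s * 1 := by gcongr
      _ = s := mul_one s
  have hbe : b * (lam1 * g) = 2 * L * η := by rw [hb]; field_simp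
  refine ⟨h1, h1L, hg, hη, ?_, ?_, ?_⟩
  · have h3 : a ^ 2 ≤ s ^ 2 := by gcongr; linarith
    have h4 : L * (9 * L * η ^ 2) ≤ L * 1 := by rw [hs2, ha] at h3; nlinarith
    exact le_of_mul_le_mul_left h4 hL
  · have h3 : 2 * L * η ≤ s * (lam1 * g) := by
      rw [← hbe]; gcongr; linarith
    have h4 : lam1 * (2 * η) ≤ lam1 * (s * g) := by
      calc lam1 * (2 * η) ≤ L * (2 * η) := by gcongr
        _ = 2 * L * η := by ring
        _ ≤ s * (lam1 * g) := h3
        _ = _ := by ring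
    have h5 := le_of_mul_le_mul_left h4 h1
    have h6 : (2 * η) ^ 2 ≤ (s * g) ^ 2 := by gcongr
    rw [mul_pow, mul_pow, hs2] at h6
    linarith
  · have h3 : 4 * (a * b) ≤ lam1 := by
      have h5 : (a + b) ^ 2 ≤ s ^ 2 := by gcongr
      rw [hs2] at h5
      nlinarith [sq_nonneg (a - b)]
    have h4 : 4 * (a * b) * (lam1 * g) = 24 * L ^ 2 * η ^ 2 := by
      rw [mul_assoc, mul_assoc, hbe, ha]; ring
    have h5 : 24 * L ^ 2 * η ^ 2 ≤ lam1 * (lam1 * g) := by rw [← h4]; gcongr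
    have h6 : lam1 ^ 2 * (24 * η ^ 2) ≤ lam1 ^ 2 * g := by
      calc lam1 ^ 2 * (24 * η ^ 2) ≤ L ^ 2 * (24 * η ^ 2) := by gcongr
        _ = 24 * L ^ 2 * η ^ 2 := by ring
        _ ≤ _ := h5
        _ = _ := by ring
    exact le_of_mul_le_mul_left h6 (by positivity)

end Translation
end AugSub

set_option maxHeartbeats 400000 in
theorem mainTheorem1 {d : ℕ} (hd : d = 2 ∨ d = 3)
    {Ω : Set (AugSub.E d)} (hΩ : AugSub.IsBoundedDomain Ω)
    {A : AugSub.E d → Matrix (Fin d) (Fin d) ℝ} (hA : AugSub.IsDiffusion Ω A)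
    {n m ϖ ϖn : ℕ} (hn : 2 ≤ n)
    {β θ : ℝ} (hβ : 1 < β) (hθ0 : 0 ≤ θ) (hθ1 : θ < 1)
    {TH : AugSub.Mesh Ω} {T : ℕ → AugSub.Mesh Ω} (hT : AugSub.IsHierarchy n β TH T)
    {VH : Submodule ℝ (AugSub.H10 Ω)} (hVH : VH = AugSub.feSpace TH)
    {V : ℕ → Submodule ℝ (AugSub.H10 Ω)} (hV : ∀ k, V k = AugSub.feSpace (T k))
    {out : ℕ → ℕ → ℝ × AugSub.H10 Ω} {iter : ℕ → ℕ → ℕ → ℝ × AugSub.H10 Ω}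
    (hrun : AugSub.IsRun A θ n m ϖ ϖn VH V out iter)
    (i : ℕ) (hi1 : 1 ≤ i) (him : i ≤ m)
    {lam1 lam : ℝ} (hlam1 : lam1 = AugSub.exactEigenvalue Ω A 1)
    (hlam : lam = AugSub.exactEigenvalue Ω A i)
    (hδ : ∀ k, 2 ≤ k → k ≤ n →
      AugSub.deltaApprox A (V (k - 1)) lam ≤ β * AugSub.deltaApprox A (V k) lam)
    {gap : ℝ} (hgap : 0 < gap) (hgapH : AugSub.IsGapBound A VH i gap)
    (hgaph : ∀ k, 1 ≤ k → k ≤ n → AugSub.IsGapBound A (V k) i gap)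
    (hsmall : AugSub.Dbar A VH (V 1) i gap * AugSub.eta A VH < 1)
    {γ : ℝ} (hγ : γ = AugSub.gammaRate A VH (V 1) i gap θ)
    (hconv : γ ^ ϖ * β < 1) :
    ∃ u : AugSub.H10 Ω, AugSub.IsEigenpair A ⊤ lam u ∧ AugSub.aForm A u u = 1 ∧
      AugSub.aNorm A (u - (out i n).2) ≤
        (√(2 * (1 + 1 / (lam1 * gap ^ 2) * AugSub.eta A (V n) ^ 2)) +
          2 * β * γ ^ ϖn * (1 + 2 * γ ^ ϖ * β / (1 - γ ^ ϖ * β))) *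
        AugSub.deltaApprox A (V n) lam ∧
      AugSub.bNorm (u - (out i n).2) ≤
        2 * (1 + 1 / (lam1 * gap)) *
          (AugSub.eta A (V n) * √(2 * (1 + 1 / (lam1 * gap ^ 2) * AugSub.eta A (V n) ^ 2)) +
            2 * AugSub.eta A VH * β * γ ^ ϖn * (1 + 2 * γ ^ ϖ * β / (1 - γ ^ ϖ * β))) *
        AugSub.deltaApprox A (V n) lam ∧
      |lam - (out i n).1| ≤
        (out i n).1 *
          (√(2 * (1 + 1 / (lam1 * gap ^ 2) * AugSub.eta A (V n) ^ 2)) +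
            2 * β * γ ^ ϖn * (1 + 2 * γ ^ ϖ * β / (1 - γ ^ ϖ * β))) ^ 2 *
        AugSub.deltaApprox A (V n) lam ^ 2 := by
  have hd0 : 0 < d := by omega
  obtain ⟨k, rfl⟩ : ∃ k, i = k + 1 := ⟨i - 1, by omega⟩
  have hfinV : ∀ j, FiniteDimensional ℝ (V j) := fun j => by
    rw [hV]; exact AugSub.feSpace_finiteDimensional hΩ _
  have hfinH : FiniteDimensional ℝ VH := by
    rw [hVH]; exact AugSub.feSpace_finiteDimensional hΩ _
  have hH1 : VH ≤ V 1 := by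
    rw [hVH, hV]; exact hT.coarse.feSpace_le
  have hmono : ∀ j, 2 ≤ j → j ≤ n → V (j - 1) ≤ V j := fun j h1 h2 => by
    rw [hV, hV]; exact (hT.refines j h1 h2).feSpace_le
  have hH : ∀ j, 1 ≤ j → j ≤ n → VH ≤ V j := by
    intro j hj
    induction j, hj using Nat.le_induction with
    | base => exact fun _ => hH1
    | succ j hj ih => exact fun h => (ih (by omega)).trans (hmono (j + 1) (by omega) h)
  have hinj := AugSub.EnergySpace.toL2_injective hd0 hΩ hA
  obtain ⟨hinit, hinit1⟩ := hrun.init_eigenpair (k + 1) hi1 him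
  have hval := hrun.init_eigenvalue (k + 1) hi1 him
  have hk1 : k < Module.finrank ℝ (V 1) := by
    have h1 := hinit
    rw [hval] at h1
    exact AugSub.le_finrank_of_isEigenpair hd0 hΩ hA h1
  obtain ⟨⟨u0, hu0, hu01⟩, ⟨W, hWd, hW⟩, hlb⟩ :=
    AugSub.EnergySpace.exists_exact hd0 hΩ hA (V 1) hk1
  obtain ⟨⟨w0, hw0, -⟩, -⟩ :=
    AugSub.EnergySpace.exists_exact hd0 hΩ hA (V 1) (k := 0) (by omega)
  rw [zero_add, ← hlam1] at hw0
  rw [← hlam] at hu0 hW hlb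
  have hP := AugSub.EnergySpace.exactEigenvalue_one_mul_le hd0 hΩ hA
  have hl1l := AugSub.EnergySpace.exactEigenvalue_one_le hd0 hΩ hA hu0
  rw [← hlam1] at hP hl1l
  have hl1 := AugSub.EnergySpace.eigenvalue_pos hd0 hΩ hA hw0
  have hl := AugSub.EnergySpace.eigenvalue_pos hd0 hΩ hA hu0
  have hle : ∀ j, k < Module.finrank ℝ (AugSub.EnergySpace.sub hd0 hΩ hA (V j)) →
      lam ≤ AugSub.Galerkin.specVal (AugSub.EnergySpace.toL2 hd0 hΩ hA)
        (AugSub.EnergySpace.sub hd0 hΩ hA (V j)) (k + 1) := by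
    intro j hj
    rw [AugSub.EnergySpace.finrank_sub] at hj
    rw [AugSub.EnergySpace.specVal_sub, hlam]
    exact (AugSub.EnergySpace.exists_exact hd0 hΩ hA (V j) hj).2.2
  have hη0 := AugSub.EnergySpace.eta_nonneg hd0 hΩ hA VH
  have hηH := AugSub.EnergySpace.etaBound hd0 hΩ hA VH
  have hroot : 0 < √lam1 := Real.sqrt_pos.2 hl1
  set D := AugSub.Dbar A VH (V 1) (k + 1) gap with hDdef
  have hCD : AugSub.Cbar A VH (V 1) (k + 1) gap = √lam1 * D := by
    rw [hDdef, AugSub.Dbar, ← hlam1]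
    field_simp
  have hD : √lam1 * D = 2 * lam * (1 + 1 / (lam1 * gap)) +
      AugSub.eigenvalue A (V 1) (k + 1) *
        √(1 + 1 / (lam1 * gap ^ 2) * AugSub.eta A VH ^ 2) := by
    rw [← hCD, AugSub.Cbar, ← hlam, ← hlam1, abs_of_pos hl]
  have hSE : AugSub.Galerkin.SmallEta lam1 lam gap (AugSub.eta A VH) :=
    AugSub.smallEta_of_mul_lt_one hl1 hl1l hgap hη0 hlb hD hsmall
  have hD' : 2 * lam * (1 + 1 / (lam1 * gap)) ≤ √lam1 * D := by
    rw [hD]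
    exact le_add_of_nonneg_right (mul_nonneg (hl.le.trans hlb) (Real.sqrt_nonneg _))
  have hD0 : 0 ≤ D := by
    refine nonneg_of_mul_nonneg_right (le_trans ?_ hD') hroot
    positivity
  have hγ' : γ = 1 / (1 - D * AugSub.eta A VH) * (θ + (1 + θ) * (D * AugSub.eta A VH)) := by
    rw [hγ, AugSub.gammaRate, ← hlam1, hCD, mul_div_cancel_left₀ _ hroot.ne', mul_assoc (1 + θ)]
  have hDη1 : 0 < 1 - D * AugSub.eta A VH := by linarith
  have hγ0 : 0 ≤ γ := by rw [hγ']; positivity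
  have hγ1 : θ + (1 + θ) * (D * AugSub.eta A VH) ≤ γ * (1 - D * AugSub.eta A VH) := by
    rw [hγ']
    refine le_of_eq ?_
    field_simp
  have hgH := AugSub.EnergySpace.gapBound hd0 hΩ hA hgapH
  have hgV := fun j h1 h2 => AugSub.EnergySpace.gapBound hd0 hΩ hA (hgaph j h1 h2)
  rw [← hlam] at hgH hgV
  have hbetween := fun j h1 h2 X hX hX' => AugSub.Galerkin.isolated_of_between (X := X) hinj hX hX'
    hSE hηH hWd hW hgH (hgV j h1 h2) (hle j)
  have hkH := (hbetween 1 le_rfl (by omega) _ le_rfl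
    (AugSub.EnergySpace.sub_mono hd0 hΩ hA hH1)).1
  have hu0' := (AugSub.EnergySpace.eigenpair_iff hd0 hΩ hA).2 hu0
  rw [AugSub.EnergySpace.sub_top] at hu0'
  have hu01' := AugSub.EnergySpace.norm_equiv_eq_one hd0 hΩ hA hu01
  have hδ' := fun j => AugSub.EnergySpace.norm_sub_starProjection_le_deltaApprox hd0 hΩ hA (V j) hu0
    ((AugSub.EnergySpace.norm_equiv hd0 hΩ hA u0).symm.trans hu01')
  obtain ⟨hout, lb, ub, hub, hdist⟩ := AugSub.Galerkin.multilevel_estimate hinj hSE hP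
    (k := k) (VH := AugSub.EnergySpace.sub hd0 hΩ hA VH) (Vh := fun j => AugSub.EnergySpace.sub hd0 hΩ hA (V j)) (fun j => inferInstance) hηH hn
    (AugSub.EnergySpace.sub_mono hd0 hΩ hA hH1)
    (fun j h1 h2 => AugSub.EnergySpace.sub_mono hd0 hΩ hA (hmono j h1 h2))
    (fun j h1 h2 X hX hX' => (hbetween j h1 h2 X hX hX').2) hkH hu0' hu01'
    (δ := fun j => AugSub.deltaApprox A (V j) lam) (fun j _ _ => hδ' j) (by linarith) hδ
    hθ0 hγ0 hD' hsmall hγ1 hconv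
    (out := fun j => AugSub.EnergySpace.pair hd0 hΩ hA (out (k + 1) j)) 
    (iter := fun j l => AugSub.EnergySpace.pair hd0 hΩ hA (iter (k + 1) j l))
    (ϖn := ϖn)
    (hval.trans (AugSub.EnergySpace.specVal_sub hd0 hΩ hA _ _).symm)
    ((AugSub.EnergySpace.eigenpair_iff hd0 hΩ hA).2 hinit)
    (AugSub.EnergySpace.norm_equiv_eq_one hd0 hΩ hA hinit1)
    (fun j h1 h2 => congrArg (AugSub.EnergySpace.pair hd0 hΩ hA) (hrun.mid_start _ hi1 him j h1 h2))
    (fun j h1 h2 l h3 => by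
      rw [hlam]
      exact AugSub.EnergySpace.correction_of_isCorrection hd0 hΩ hA
        (hrun.mid_step _ hi1 him j h1 h2 l h3))
    (fun j h1 h2 => congrArg (AugSub.EnergySpace.pair hd0 hΩ hA) (hrun.mid_out _ hi1 him j h1 h2))
    (congrArg (AugSub.EnergySpace.pair hd0 hΩ hA) (hrun.fin_start _ hi1 him))
    (fun l h3 => by
      rw [hlam]
      exact AugSub.EnergySpace.correction_of_isCorrection hd0 hΩ hA
        (hrun.fin_step _ hi1 him l h3))
    (congrArg (AugSub.EnergySpace.pair hd0 hΩ hA) (hrun.fin_out _ hi1 him))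
  obtain ⟨u, hu, hu1, r1, r2, r3⟩ := AugSub.Galerkin.final_estimate hinj hSE hP hηH
    (AugSub.EnergySpace.sub_mono hd0 hΩ hA (hH n (by omega) le_rfl)) (AugSub.EnergySpace.eta_nonneg hd0 hΩ hA (V n))
    (AugSub.EnergySpace.etaBound hd0 hΩ hA (V n)) hout hub hu0' hu01'
    (hδ' n) hdist
  obtain ⟨u, rfl⟩ := (AugSub.EnergySpace.equiv hd0 hΩ hA).surjective u
  refine ⟨u, ?_, ?_, ?_, ?_, r3⟩
  · rw [← AugSub.EnergySpace.sub_top hd0 hΩ hA] at hu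
    exact (AugSub.EnergySpace.eigenpair_iff hd0 hΩ hA).1 hu
  · rw [← AugSub.EnergySpace.norm_equiv_sq hd0 hΩ hA]
    rw [hu1, one_pow]
  · rw [← AugSub.EnergySpace.norm_equiv hd0 hΩ hA, map_sub]
    exact r1
  · rw [AugSub.bNorm_eq_norm, ← AugSub.EnergySpace.toL2_equiv hd0 hΩ hA, map_sub]
    refine r2.trans_eq ?_
    ring
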